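/- **Setting.** Let $\mathbb{R}^{4,1}$ be $\mathbb{R}^5$ with $x\circ y=x_1y_1+x_2y_2+x_3y_3+x_4y_4-x_5y_5$ and let $\mathbb{H}^4=\{x : x\circ x=-1,\ x_5>0\}$ be hyperbolic $4$-space. Let $e_1,\dots,e_5\in\mathbb{R}^{4,1}$ be vectors with Gram matrix $$G=(e_i\circ e_j)=\begin{pmatrix}1&-\cos\frac{\pi}{5}&0&-\frac12&0\\-\cos\frac{\pi}{5}&1&-\frac12&0&-\frac12\\0&-\frac12&1&-\cos\frac{\pi}{5}&0\\-\frac12&0&-\cos\frac{\pi}{5}&1&-\frac12\\0&-\frac12&0&-\frac12&1\end{pmatrix},$$ and let $v_i$ be the vector with $v_i\circ v_i=1$, $v_i\circ e_j=0$ for $j\ne i$, and $v_i\circ e_i<0$. Let $$T=\{x\in\mathbb{H}^4 : x\circ e_i\le 0\text{ and }x\circ v_i\le 0\text{ for } i=1,\dots,5\},$$ where the $e_i$ are chosen (up to a common sign) so that $T\neq\emptyset$. Then $T$ is a compact Coxeter polytope, unique up to isometry, called the Coxeter domino $T$. Its orthogonal facets $F_i=\{x\in T: x\circ v_i=0\}$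 are Coxeter $3$-simplices: $F_1,F_3$ (type $A$; the Coxeter graph is a cycle with labels $5,3,3,3$), $F_2,F_4$ (type $B$; a star with labels $5,3,3$) and $F_5$ (type $C$; a cycle with labels $5,3,5,3$). Gluing a further copy of $T$ to a polytope already built from copies of $T$ means placing it so that the two meet exactly in a common facet that is an orthogonal facet, of the same type, of the new copy and of one of the old copies. The polytopes built from $n+1$ copies of $T$ by $n$ successive gluings are called Coxeter dominoes. For a Coxeter domino $D$ let $W$ be the group generated by the set $S$ of reflections in the hyperplanes bounding $D$, let $a_k$ be the number of elements of $W$ of word length $k$ with respect to $S$, let $f_S(t)=\sum_{k\ge0}a_kt^k$ be its growth series, and let $\tau=\limsup_{k\to\infty}\sqrt[k]{a_k}$ be its growth rate. The denominator polynomial of $f_S$ is the polynomial $q\in\mathbb{Z}[t]$ with $q(0)=1$ such that $f_S=p/q$ for some $p\in\mathbb{Z}[t]$ relatively prime to $q$. A $2$-Salem number is an algebraic integer $\alpha$ with $|\alpha|>1$ that has one conjugate $\beta\neq\alpha$ with $|\beta|>1$, while all other conjugates $\omega$ satisfy $|\omega|\le1$ and at least one of them lies on the unit circle. For integers $\ell,m,n$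 put $$\begin{aligned}Q_{\ell,m,n}(t)&=t^{18}-(4n+6)t^{17}+(2n-m+3)t^{16}-(3n-m+\ell+5)t^{15}+(5n-3m+5)t^{14}\\&-(n-4m+1)t^{13}+(8n-4m+\ell+9)t^{12}+(5m-\ell)t^{11}+(10n-5m+\ell+11)t^{10}\\&-(2n-6m+2)t^{9}+(10n-5m+\ell+11)t^{8}+(5m-\ell)t^{7}+(8n-4m+\ell+9)t^{6}\\&-(n-4m+1)t^{5}+(5n-3m+5)t^{4}-(3n-m+\ell+5)t^{3}+(2n-m+3)t^{2}-(4n+6)t+1.\end{aligned}$$ **Theorem.** Let $n\ge 1$ be an integer with $n\equiv1\pmod 3$. Then $Q_{0,n,n}(t)$ and $Q_{n,0,n}(t)$ are irreducible over $\mathbb{Z}$. Moreover, there are Coxeter dominoes obtained by gluing $n+1$ copies of $T$ only along facets of type $B$, and for every one of them the denominator polynomial of the growth series is $Q_{0,n,n}(t)$ and the growth rate $\tau_{0,n,n}$ is a $2$-Salem number. Likewise, there are Coxeter dominoes obtained by gluing $n+1$ copies of $T$ only along facets of type $A$, and for every one of them the denominator polynomial of the growth series is $Q_{n,0,n}(t)$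 and the growth rate $\tau_{n,0,n}$ is a $2$-Salem number. -/

import Mathlib

noncomputable section

namespace CoxeterDomino

open Polynomial

/-! ## Growth of a group with respect to a generating set -/

section Growth

variable {Γ : Type*} [Group Γ]

/-- Word length of `w` with respect to `S`: the least number of factors in an expression of `w`
as a product of elements of `S`. (It is used for sets `S` of involutions and for elements of the
subgroup generated by `S`, so that no inverses are needed and an expression exists.) -/
def wordLength (S : Set Γ) (w : Γ) : ℕ :=
  sInf {k : ℕ | ∃ l : List Γ, (∀ s ∈ l, s ∈ S) ∧ l.length = k ∧ l.prod = w}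

/-- The number of elements of word length `k` in the group generated by `S`. -/
def growthCoeff (S : Set Γ) (k : ℕ) : ℕ :=
  Set.ncard {w : Γ | w ∈ Subgroup.closure S ∧ wordLength S w = k}

/-- The growth series of the group generated by `S`. -/
def growthSeries (S : Set Γ) : PowerSeries ℤ :=
  PowerSeries.mk fun k => (growthCoeff S k : ℤ)

/-- The growth rate: the upper limit of the `k`-th roots of the coefficients of the growth
series. -/
def growthRate (S : Set Γ) : ℝ :=
  Filter.limsup (fun k : ℕ => (growthCoeff S k : ℝ) ^ (1 / (k : ℝ))) Filter.atTop

/-- `q` is the denominator polynomial of the growth function: the growth series equals `p / q`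
with `p` and `q` relatively prime integral polynomials and `q` normalized by `q(0) = 1`. -/
def IsGrowthDenominator (S : Set Γ) (q : ℤ[X]) : Prop :=
  q.coeff 0 = 1 ∧
    ∃ p : ℤ[X], IsRelPrime p q ∧ (q : PowerSeries ℤ) * growthSeries S = (p : PowerSeries ℤ)

end Growth

/-! ## Algebraic numbers -/

/-- A `2`-Salem number: an algebraic integer `α` with `|α| > 1` that has a conjugate `β ≠ α` with
`|β| > 1`, all other conjugates lying in the closed unit disc and at least one of them on the unit
circle. -/
def IsTwoSalem (α : ℂ) : Prop :=
  IsIntegral ℤ α ∧ 1 < ‖α‖ ∧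
    ∃ β : ℂ, IsConjRoot ℚ α β ∧ β ≠ α ∧ 1 < ‖β‖ ∧
      (∀ ω : ℂ, IsConjRoot ℚ α ω → ω ≠ α → ω ≠ β → ‖ω‖ ≤ 1) ∧
      ∃ ω : ℂ, IsConjRoot ℚ α ω ∧ ω ≠ α ∧ ω ≠ β ∧ ‖ω‖ = 1

/-! ## Hyperbolic 4-space and convex polytopes in it -/

/-- The real vector space underlying Lorentzian space of signature `(4, 1)`. -/
abbrev LorentzSpace : Type := Fin 5 → ℝ

/-- The Lorentzian inner product. -/
def lor (x y : LorentzSpace) : ℝ :=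
  x 0 * y 0 + x 1 * y 1 + x 2 * y 2 + x 3 * y 3 - x 4 * y 4

/-- Hyperbolic 4-space in the hyperboloid model. -/
def hyperbolicSpace : Set LorentzSpace :=
  {x | lor x x = -1 ∧ 0 < x 4}

/-- The intersection of hyperbolic 4-space with the closed half-spaces having outward normal
vectors in `N`. -/
def polyhedron (N : Set LorentzSpace) : Set LorentzSpace :=
  {x | x ∈ hyperbolicSpace ∧ ∀ u ∈ N, lor x u ≤ 0}

/-- The outward unit normal vectors of the facets of a convex polytope `D` in hyperbolic 4-space:
`D` lies in the half-space with outward normal `u`, and meets its bounding hyperplane in a face of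
hyperbolic dimension 3, that is, in a set with 4-dimensional linear span. -/
def facetNormals (D : Set LorentzSpace) : Set LorentzSpace :=
  {u | lor u u = 1 ∧ (∀ x ∈ D, lor x u ≤ 0) ∧
    Module.finrank ℝ (Submodule.span ℝ {x | x ∈ D ∧ lor x u = 0}) = 4}

/-- The reflections with respect to the hyperplanes bounding `D`, as Lorentz transformations. They
generate the reflection group associated with `D`. -/
def facetReflections (D : Set LorentzSpace) : Set (LorentzSpace ≃ₗ[ℝ] LorentzSpace) :=
  {r | ∃ u ∈ facetNormals D, ∀ x, r x = x - (2 * lor x u) • u}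

/-! ## The totally truncated simplex `T` -/

/-- The Gram matrix of the underlying Coxeter simplex with ultraideal vertices. Its Coxeter graph
is the cycle `0 - 1 - 2 - 3 - 0` with labels `5, 3, 5, 3`, together with a node `4` joined to `1`
and to `3` by edges labelled `3`. -/
def gram : Matrix (Fin 5) (Fin 5) ℝ :=
  !![1, -Real.cos (Real.pi / 5), 0, -(1 / 2), 0;
     -Real.cos (Real.pi / 5), 1, -(1 / 2), 0, -(1 / 2);
     0, -(1 / 2), 1, -Real.cos (Real.pi / 5), 0;
     -(1 / 2), 0, -Real.cos (Real.pi / 5), 1, -(1 / 2);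
     0, -(1 / 2), 0, -(1 / 2), 1]

/-- The `i`-th ultraideal vertex of the simplex with outward normals `e`, that is, the vector `v`
with `v ∘ v = 1`, `v ∘ e j = 0` for `j ≠ i` and `v ∘ e i < 0`, by the cofactor formula. It is
also the outward normal vector of the hyperplane truncating this vertex. -/
def vertex (e : Fin 5 → LorentzSpace) (i : Fin 5) : LorentzSpace :=
  (Real.sqrt (gram.adjugate i i * gram.det))⁻¹ • ∑ k, gram.adjugate i k • e k

/-- The totally truncated simplex `T` determined by outward normals `e`. -/
def truncSimplex (e : Fin 5 → LorentzSpace) : Set LorentzSpace :=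
  polyhedron (Set.range e ∪ Set.range (vertex e))

/-- The orthogonal facet of `T` that replaces the `i`-th ultraideal vertex. -/
def orthFacet (e : Fin 5 → LorentzSpace) (i : Fin 5) : Set LorentzSpace :=
  {x | x ∈ truncSimplex e ∧ lor x (vertex e i) = 0}

/-- `e` determines a copy of `T`: its Gram matrix is the prescribed one, and the half-spaces are
taken with the signs for which `T` lies on the sheet used as hyperbolic space. Any two such `e`
differ by an isometry of hyperbolic 4-space, and every isometric image of a copy is a copy. -/
def IsCopy (e : Fin 5 → LorentzSpace) : Prop :=
  (∀ i j, lor (e i) (e j) = gram i j) ∧ (truncSimplex e).Nonempty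

/-- The three isometry types of orthogonal facets of `T`. -/
inductive FacetType : Type
  | A
  | B
  | C

/-- The type of the `i`-th orthogonal facet. This facet is a Coxeter 3-simplex whose graph is the
graph of `gram` without the node `i`: a cycle with labels `5, 3, 3, 3` (type `A`), a star with
labels `5, 3, 3` (type `B`), or a cycle with labels `5, 3, 5, 3` (type `C`). -/
def facetType : Fin 5 → FacetType :=
  ![FacetType.A, FacetType.B, FacetType.A, FacetType.B, FacetType.C]

/-! ## Coxeter dominoes -/

/-- The union of the copies of `T` listed in `L`. -/
def body (L : List (Fin 5 → LorentzSpace)) : Set LorentzSpace :=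
  {x | ∃ e ∈ L, x ∈ truncSimplex e}

/-- The copy of `T` given by `e'` is glued to the polytope composed of the copies in `L` along an
orthogonal facet of type `τ`: this copy and the polytope intersect exactly in a common facet, which
is an orthogonal facet of type `τ` of `e'` and of one of the copies in `L`. -/
def Glues (τ : FacetType) (L : List (Fin 5 → LorentzSpace)) (e' : Fin 5 → LorentzSpace) : Prop :=
  IsCopy e' ∧ ∃ e ∈ L, ∃ i i' : Fin 5, facetType i = τ ∧ facetType i' = τ ∧
    orthFacet e i = orthFacet e' i' ∧ body L ∩ truncSimplex e' = orthFacet e' i'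

/-- `IsDomino ℓ m n L`: the copies of `T` in `L` form a Coxeter domino obtained from `n + 1` copies
by `n` gluings, of which `ℓ` are along facets of type `A`, `m` along facets of type `B`, and the
others along facets of type `C`. -/
inductive IsDomino : ℕ → ℕ → ℕ → List (Fin 5 → LorentzSpace) → Prop
  | single {e : Fin 5 → LorentzSpace} : IsCopy e → IsDomino 0 0 0 [e]
  | glueA {ℓ m n : ℕ} {L : List (Fin 5 → LorentzSpace)} {e : Fin 5 → LorentzSpace} :
      IsDomino ℓ m n L → Glues FacetType.A L e → IsDomino (ℓ + 1) m (n + 1) (e :: L)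
  | glueB {ℓ m n : ℕ} {L : List (Fin 5 → LorentzSpace)} {e : Fin 5 → LorentzSpace} :
      IsDomino ℓ m n L → Glues FacetType.B L e → IsDomino ℓ (m + 1) (n + 1) (e :: L)
  | glueC {ℓ m n : ℕ} {L : List (Fin 5 → LorentzSpace)} {e : Fin 5 → LorentzSpace} :
      IsDomino ℓ m n L → Glues FacetType.C L e → IsDomino ℓ m (n + 1) (e :: L)

/-- The generating reflections of the Coxeter group of the domino composed of the copies in `L`. -/
def dominoReflections (L : List (Fin 5 → LorentzSpace)) :
    Set (LorentzSpace ≃ₗ[ℝ] LorentzSpace) :=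
  facetReflections (body L)

/-- The polynomial `Q_{ℓ,m,n}`. -/
def Q (ℓ m n : ℤ) : ℤ[X] :=
  X ^ 18 - C (4 * n + 6) * X ^ 17 + C (2 * n - m + 3) * X ^ 16
    - C (3 * n - m + ℓ + 5) * X ^ 15 + C (5 * n - 3 * m + 5) * X ^ 14
    - C (n - 4 * m + 1) * X ^ 13 + C (8 * n - 4 * m + ℓ + 9) * X ^ 12
    + C (5 * m - ℓ) * X ^ 11 + C (10 * n - 5 * m + ℓ + 11) * X ^ 10
    - C (2 * n - 6 * m + 2) * X ^ 9
    + C (10 * n - 5 * m + ℓ + 11) * X ^ 8 + C (5 * m - ℓ) * X ^ 7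
    + C (8 * n - 4 * m + ℓ + 9) * X ^ 6 - C (n - 4 * m + 1) * X ^ 5
    + C (5 * n - 3 * m + 5) * X ^ 4 - C (3 * n - m + ℓ + 5) * X ^ 3
    + C (2 * n - m + 3) * X ^ 2 - C (4 * n + 6) * X + 1

end CoxeterDomino

end

/-! The inverse of the growth series of a domino is computed exactly; its numerator turns out to be
`Q`, whose roots are then located.

Growth. Let `Δ` be the set of outward normals of the walls. As for root systems, the reflection in
`s ∈ Δ` lengthens or shortens `w` according to whether `w s` or `-w s` lies in the cone of `Δ`
(`IsBase.map_mem_cone_of_len_le`). Hence elements factor uniquely, with additive lengths, through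
every parabolic subgroup, and inclusion–exclusion over descents writes the inverse growth series as
a sum of terms attached to the subsets `I` of `Δ` (`IsBase.invGrowth_eq_sum`). Writing `f_I` for the
growth series of the parabolic subgroup of `I`, the term is `(-1)^|I| t^m / f_I` if this subgroup
has a longest element, of length `m`, and it vanishes if the cone of `I` contains a nonzero causal
vector. In particular a pair of normals with product at most `-1` kills every subset containing it,
so inverse growth series behave additively under amalgamation (`IsBase.invGrowth_union`).

Gluing. A truncating wall `v` is orthogonal to its neighbours `N` and has product at most `-1` with
all other walls. Gluing a copy of `T` along it removes `v` and `-v`, identifies the two copies of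
`N`, and makes all remaining pairs from opposite sides have product at most `-1`. So the inverse
growth series changes by that of `T` plus `(t - 1) / (1 + t)` times that of `N` (`IsTiling.glue`).
The last term depends only on the type of the facet. Once the finitely many parabolic terms of `T`
are evaluated, every domino has inverse growth series `Q / cycProd`, however its copies are arranged
(`IsDomino.exists_tiling`, `IsDomino.mul_growthSeries`). Dominoes with gluings of type `A` only, or
`B` only, exist in every size: `T` has two facets of each of these types, so the newest copy always
keeps a free one, across which it can be reflected.

Arithmetic. For `n ≡ 1` modulo 3 the reduction of `Q` modulo 3 is one fixed polynomial of degree 18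
for each of the two families. It has no root in a field with `3 ^ d` elements for `d ≤ 9`, hence no
factor of degree at most 9, and `Q` is irreducible. Moreover `Q` is palindromic, so it comes from a
polynomial of degree 9 in `x + 1 / x`. Nine sign changes show that this has seven roots in `(-2,
2)`, one in `(2, 3)` and one beyond 3. Thus `Q` has two real pairs of reciprocal roots and fourteen
roots on the unit circle. The largest root `α` is the growth rate, because `cycProd` does not vanish
at `1 / α`; by irreducibility its conjugates are all the roots of `Q`, so `α` is a 2-Salem number.
-/

namespace CoxeterDomino

/-! ## Word length with respect to a set of involutions -/

section WordLength

variable {Γ : Type*} [Group Γ] {S : Set Γ}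

theorem wordLength_prod_le {l : List Γ} (hl : ∀ s ∈ l, s ∈ S) : wordLength S l.prod ≤ l.length :=
  Nat.sInf_le ⟨l, hl, rfl, rfl⟩

theorem exists_list_of_mem_closure (hS : ∀ s ∈ S, s * s = 1) {w : Γ}
    (hw : w ∈ Subgroup.closure S) : ∃ l : List Γ, (∀ s ∈ l, s ∈ S) ∧ l.prod = w := by
  rw [← Subgroup.mem_toSubmonoid, Subgroup.closure_toSubmonoid] at hw
  obtain ⟨l, hl, rfl⟩ := Submonoid.exists_list_of_mem_closure hw
  refine ⟨l, fun s hs => ?_, rfl⟩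
  rcases hl s hs with h | h
  · exact h
  · rw [Set.mem_inv] at h
    have h2 : s⁻¹ = s := by simpa using eq_inv_of_mul_eq_one_left (hS _ h)
    rwa [h2] at h

theorem exists_reduced_word (hS : ∀ s ∈ S, s * s = 1) {w : Γ} (hw : w ∈ Subgroup.closure S) :
    ∃ l : List Γ, (∀ s ∈ l, s ∈ S) ∧ l.length = wordLength S w ∧ l.prod = w := by
  obtain ⟨l, hl, rfl⟩ := exists_list_of_mem_closure hS hw
  exact Nat.sInf_mem
    (s := {k : ℕ | ∃ l' : List Γ, (∀ s ∈ l', s ∈ S) ∧ l'.length = k ∧ l'.prod = l.prod})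
    ⟨l.length, l, hl, rfl, rfl⟩

theorem wordLength_mul_le (hS : ∀ s ∈ S, s * s = 1) {x y : Γ} (hx : x ∈ Subgroup.closure S)
    (hy : y ∈ Subgroup.closure S) : wordLength S (x * y) ≤ wordLength S x + wordLength S y := by
  obtain ⟨l, hl, hlen, rfl⟩ := exists_reduced_word hS hx
  obtain ⟨l', hl', hlen', rfl⟩ := exists_reduced_word hS hy
  rw [← hlen, ← hlen', ← List.prod_append, ← List.length_append]
  refine wordLength_prod_le fun s hs => ?_
  rcases List.mem_append.1 hs with h | h
  exacts [hl s h, hl' s h]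

theorem wordLength_one : wordLength S (1 : Γ) = 0 := by
  have := wordLength_prod_le (S := S) (l := []) (by simp)
  simpa using this

theorem wordLength_gen_le {s : Γ} (hs : s ∈ S) : wordLength S s ≤ 1 := by
  have := wordLength_prod_le (S := S) (l := [s]) (by simpa using hs)
  simpa using this

theorem wordLength_mul_gen_le (hS : ∀ s ∈ S, s * s = 1) {x s : Γ} (hx : x ∈ Subgroup.closure S)
    (hs : s ∈ S) : wordLength S (x * s) ≤ wordLength S x + 1 :=
  (wordLength_mul_le hS hx (Subgroup.subset_closure hs)).trans
    (Nat.add_le_add_left (wordLength_gen_le hs) _)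

theorem wordLength_le_mul_gen (hS : ∀ s ∈ S, s * s = 1) {x s : Γ} (hx : x ∈ Subgroup.closure S)
    (hs : s ∈ S) : wordLength S x ≤ wordLength S (x * s) + 1 := by
  have := wordLength_mul_gen_le hS (mul_mem hx (Subgroup.subset_closure hs)) hs
  rwa [mul_assoc, hS s hs, mul_one] at this

theorem eq_one_of_wordLength_eq_zero (hS : ∀ s ∈ S, s * s = 1) {w : Γ}
    (hw : w ∈ Subgroup.closure S) (h : wordLength S w = 0) : w = 1 := by
  obtain ⟨l, -, hlen, rfl⟩ := exists_reduced_word hS hw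
  rw [h, List.length_eq_zero_iff] at hlen
  simp [hlen]

theorem exists_gen_lt_of_ne_one (hS : ∀ s ∈ S, s * s = 1) {w : Γ}
    (hw : w ∈ Subgroup.closure S) (h : w ≠ 1) :
    ∃ s ∈ S, wordLength S (w * s) + 1 = wordLength S w := by
  obtain ⟨l, hl, hlen, rfl⟩ := exists_reduced_word hS hw
  rcases List.eq_nil_or_concat' l with rfl | ⟨l, s, rfl⟩
  · simp at h
  · have hs : s ∈ S := hl s (by simp)
    refine ⟨s, hs, le_antisymm ?_ (wordLength_le_mul_gen hS hw hs)⟩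
    rw [← hlen]
    have : (l ++ [s]).prod * s = l.prod := by simp [mul_assoc, hS s hs]
    rw [this, List.length_append]
    exact Nat.add_le_add_right (wordLength_prod_le fun x hx => hl x (by simp [hx])) _

/-- `Set.ncard` is zero on infinite sets, so this finiteness makes the coefficients of the growth
series genuine counts. -/
theorem finite_wordLength_eq (hS : ∀ s ∈ S, s * s = 1) (hfin : S.Finite) (k : ℕ) :
    {w : Γ | w ∈ Subgroup.closure S ∧ wordLength S w = k}.Finite := by
  have : Finite S := hfin
  refine ((List.finite_length_eq S k).image fun l => (l.map Subtype.val).prod).subset ?_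
  rintro w ⟨hw, rfl⟩
  obtain ⟨l, hl, hlen, hprod⟩ := exists_reduced_word hS hw
  refine ⟨l.attach.map fun x => ⟨x.1, hl x.1 x.2⟩, by simpa using hlen, ?_⟩
  simpa [Function.comp_def] using hprod

end WordLength

/-! ## Alternating words in two involutions -/

section Alternating

variable {Γ : Type*} [Group Γ]

/-- The alternating product of `k` factors `s` and `t` that ends in `t`. -/
def alt : ℕ → Γ → Γ → Γ
  | 0, _, _ => 1
  | k + 1, s, t => alt k t s * t

@[simp] theorem alt_zero (s t : Γ) : alt 0 s t = 1 := rfl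

theorem alt_succ (k : ℕ) (s t : Γ) : alt (k + 1) s t = alt k t s * t := rfl

/-- Alternating words are anchored at their last letter, so the letter at the left end depends on
parity. -/
theorem alt_succ' (k : ℕ) (s t : Γ) :
    alt (k + 1) s t = (if Even k then t else s) * alt k s t := by
  induction k generalizing s t with
  | zero => simp [alt_succ]
  | succ k ih =>
    rw [alt_succ, ih t s, alt_succ, mul_assoc]
    by_cases h : Even k <;> simp [h, Nat.even_add_one]

theorem alt_add (j k : ℕ) (s t : Γ) :
    alt (j + k) s t = (if Even k then alt j s t else alt j t s) * alt k s t := by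
  induction k generalizing s t with
  | zero => simp
  | succ k ih =>
    rw [← add_assoc, alt_succ, ih t s, alt_succ, mul_assoc]
    by_cases h : Even k <;> simp [h, Nat.even_add_one]

theorem alt_mem (k : ℕ) (s t : Γ) : alt k s t ∈ Subgroup.closure ({s, t} : Set Γ) := by
  induction k generalizing s t with
  | zero => exact one_mem _
  | succ k ih =>
    refine mul_mem ?_ (Subgroup.subset_closure (by simp))
    rw [Set.pair_comm]
    exact ih t s

theorem wordLength_alt_le {s t : Γ} (hs : s * s = 1) (ht : t * t = 1) (k : ℕ) :
    wordLength {s, t} (alt k s t) ≤ k := by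
  have hS : ∀ x ∈ ({s, t} : Set Γ), x * x = 1 := by rintro x (rfl | rfl) <;> assumption
  induction k generalizing s t with
  | zero => simp [wordLength_one]
  | succ k ih =>
    refine (wordLength_mul_gen_le hS ?_ (by simp)).trans (Nat.add_le_add_right ?_ 1)
    · rw [Set.pair_comm]; exact alt_mem k t s
    · rw [Set.pair_comm]
      exact ih ht hs (by rintro x (rfl | rfl) <;> assumption)

/-- Two equal adjacent letters cancel, so every word in `s` and `t` collapses to an alternating one
that is no longer. -/
theorem exists_alt_of_list {s t : Γ} (hs : s * s = 1) (ht : t * t = 1) (l : List Γ)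
    (hl : ∀ x ∈ l, x ∈ ({s, t} : Set Γ)) :
    ∃ k ≤ l.length, l.prod = alt k s t ∨ l.prod = alt k t s := by
  have key : ∀ (k : ℕ) (x y : Γ), x * x = 1 → y * y = 1 →
      ∃ j ≤ k + 1, alt k x y * y = alt j x y ∨ alt k x y * y = alt j y x := by
    intro k x y _ hy
    cases k with
    | zero => exact ⟨1, le_refl _, Or.inl rfl⟩
    | succ k => exact ⟨k, by omega, Or.inr (by rw [alt_succ, mul_assoc, hy, mul_one])⟩
  induction l using List.reverseRecOn with
  | nil => exact ⟨0, le_refl _, Or.inl rfl⟩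
  | append_singleton l x ih =>
    obtain ⟨k, hk, h⟩ := ih fun y hy => hl y (by simp [hy])
    rw [List.prod_append, List.prod_singleton, List.length_append, List.length_singleton]
    have hx : x = s ∨ x = t := by simpa using hl x (by simp)
    rcases hx with rfl | rfl <;> rcases h with h | h <;> rw [h]
    · exact ⟨k + 1, by omega, Or.inr rfl⟩
    · obtain ⟨j, hj, hj'⟩ := key k t x ht hs
      exact ⟨j, by omega, hj'.symm⟩
    · obtain ⟨j, hj, hj'⟩ := key k s x hs ht
      exact ⟨j, by omega, hj'⟩
    · exact ⟨k + 1, by omega, Or.inl rfl⟩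

end Alternating

end CoxeterDomino

/-! ### Lorentzian geometry, reflections, and positive cones -/

noncomputable section

namespace CoxeterDomino

/-! ## The Lorentzian form -/

theorem lor_comm (x y : LorentzSpace) : lor x y = lor y x := by
  simp only [lor]; ring

theorem lor_add_left (x y z : LorentzSpace) : lor (x + y) z = lor x z + lor y z := by
  simp only [lor, Pi.add_apply]; ring

theorem lor_smul_left (a : ℝ) (x y : LorentzSpace) : lor (a • x) y = a * lor x y := by
  simp only [lor, Pi.smul_apply, smul_eq_mul]; ring

theorem lor_add_right (x y z : LorentzSpace) : lor x (y + z) = lor x y + lor x z := by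
  simp only [lor, Pi.add_apply]; ring

theorem lor_smul_right (a : ℝ) (x y : LorentzSpace) : lor x (a • y) = a * lor x y := by
  simp only [lor, Pi.smul_apply, smul_eq_mul]; ring

theorem lor_neg_left (x y : LorentzSpace) : lor (-x) y = -lor x y := by
  simp only [lor, Pi.neg_apply]; ring

theorem lor_neg_right (x y : LorentzSpace) : lor x (-y) = -lor x y := by
  simp only [lor, Pi.neg_apply]; ring

theorem lor_sub_left (x y z : LorentzSpace) : lor (x - y) z = lor x z - lor y z := by
  simp only [lor, Pi.sub_apply]; ring

theorem lor_sub_right (x y z : LorentzSpace) : lor x (y - z) = lor x y - lor x z := by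
  simp only [lor, Pi.sub_apply]; ring

theorem lor_zero_left (x : LorentzSpace) : lor 0 x = 0 := by simp [lor]

theorem lor_zero_right (x : LorentzSpace) : lor x 0 = 0 := by simp [lor]

/-- The Lorentzian inner product as a bilinear form. -/
def lorForm : LorentzSpace →ₗ[ℝ] LorentzSpace →ₗ[ℝ] ℝ :=
  LinearMap.mk₂ ℝ lor lor_add_left lor_smul_left lor_add_right lor_smul_right

theorem lorForm_apply (x y : LorentzSpace) : lorForm x y = lor x y := rfl

theorem lor_sum_left {ι : Type*} (s : Finset ι) (f : ι → LorentzSpace) (x : LorentzSpace) :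
    lor (∑ i ∈ s, f i) x = ∑ i ∈ s, lor (f i) x := by
  simp [← lorForm_apply, map_sum]

theorem lor_sum_right {ι : Type*} (s : Finset ι) (f : ι → LorentzSpace) (x : LorentzSpace) :
    lor x (∑ i ∈ s, f i) = ∑ i ∈ s, lor x (f i) := by
  simp [← lorForm_apply, map_sum]

theorem eq_zero_of_lor_eq_zero {x : LorentzSpace} (h : ∀ y, lor x y = 0) : x = 0 := by
  ext i
  have := h (Pi.single i 1)
  fin_cases i <;> simpa [lor, Pi.single_apply] using this

/-! ## Causal vectors -/

/-- Nonzero vectors in the closed future cone. -/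
def IsFuture (z : LorentzSpace) : Prop :=
  lor z z ≤ 0 ∧ 0 < z 4

theorem IsFuture.of_mem {x : LorentzSpace} (hx : x ∈ hyperbolicSpace) : IsFuture x :=
  ⟨by rw [hx.1]; norm_num, hx.2⟩

theorem cauchy_four (x z : LorentzSpace) :
    (x 0 * z 0 + x 1 * z 1 + x 2 * z 2 + x 3 * z 3) ^ 2 ≤
      (x 0 ^ 2 + x 1 ^ 2 + x 2 ^ 2 + x 3 ^ 2) * (z 0 ^ 2 + z 1 ^ 2 + z 2 ^ 2 + z 3 ^ 2) := by
  have := Finset.sum_mul_sq_le_sq_mul_sq Finset.univ (fun i : Fin 4 => x i.castSucc)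
    (fun i : Fin 4 => z i.castSucc)
  simpa [Fin.sum_univ_four] using this

theorem lor_nonpos_of_future {x z : LorentzSpace} (hx : IsFuture x) (hz : IsFuture z) :
    lor x z ≤ 0 := by
  obtain ⟨hx1, hx2⟩ := hx
  obtain ⟨hz1, hz2⟩ := hz
  have h := cauchy_four x z
  simp only [lor] at *
  have h2 : (x 0 ^ 2 + x 1 ^ 2 + x 2 ^ 2 + x 3 ^ 2) * (z 0 ^ 2 + z 1 ^ 2 + z 2 ^ 2 + z 3 ^ 2) ≤
      x 4 ^ 2 * z 4 ^ 2 :=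
    mul_le_mul (by nlinarith) (by nlinarith) (by positivity) (by positivity)
  have h3 := abs_le_of_sq_le_sq' (h.trans (h2.trans (by rw [mul_pow]))) (by positivity)
  linarith [h3.2]

/-- Strictness comes from `x`: its spatial part has squared length exactly `x 4 ^ 2 - 1`, so
Cauchy–Schwarz leaves room even if `z` is lightlike. -/
theorem lor_neg_of_future {x z : LorentzSpace} (hx : x ∈ hyperbolicSpace) (hz : IsFuture z) :
    lor x z < 0 := by
  obtain ⟨hx1, hx2⟩ := hx
  obtain ⟨hz1, hz2⟩ := hz
  have h := cauchy_four x z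
  simp only [lor] at *
  have h0 : 0 ≤ x 4 ^ 2 - 1 := by
    nlinarith [sq_nonneg (x 0), sq_nonneg (x 1), sq_nonneg (x 2), sq_nonneg (x 3)]
  have h2 : (x 0 ^ 2 + x 1 ^ 2 + x 2 ^ 2 + x 3 ^ 2) * (z 0 ^ 2 + z 1 ^ 2 + z 2 ^ 2 + z 3 ^ 2) ≤
      (x 4 ^ 2 - 1) * z 4 ^ 2 :=
    mul_le_mul (by nlinarith) (by nlinarith) (by positivity) h0
  have h3 : (x 0 * z 0 + x 1 * z 1 + x 2 * z 2 + x 3 * z 3) ^ 2 < (x 4 * z 4) ^ 2 := by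
    rw [mul_pow]; nlinarith [pow_pos hz2 2]
  linarith [(abs_lt_of_sq_lt_sq' h3 (by positivity)).2]

theorem eq_zero_of_causal {z : LorentzSpace} (hz : lor z z ≤ 0) (h4 : z 4 = 0) : z = 0 := by
  simp only [lor, h4, ← sq] at hz
  have p0 := sq_nonneg (z 0)
  have p1 := sq_nonneg (z 1)
  have p2 := sq_nonneg (z 2)
  have p3 := sq_nonneg (z 3)
  have h0 : z 0 = 0 := pow_eq_zero_iff two_ne_zero |>.1 (by linarith)
  have h1 : z 1 = 0 := pow_eq_zero_iff two_ne_zero |>.1 (by linarith)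
  have h2 : z 2 = 0 := pow_eq_zero_iff two_ne_zero |>.1 (by linarith)
  have h3 : z 3 = 0 := pow_eq_zero_iff two_ne_zero |>.1 (by linarith)
  ext i
  fin_cases i <;> assumption

/-- A causal vector is zero, future or past. -/
theorem causal_trichotomy {z : LorentzSpace} (hz : lor z z ≤ 0) :
    z = 0 ∨ IsFuture z ∨ IsFuture (-z) := by
  rcases lt_trichotomy (z 4) 0 with h | h | h
  · exact Or.inr (Or.inr ⟨by rwa [lor_neg_left, lor_neg_right, neg_neg], by simpa using h⟩)
  · exact Or.inl (eq_zero_of_causal hz h)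
  · exact Or.inr (Or.inl ⟨hz, h⟩)

theorem future_of_lor_neg {x z : LorentzSpace} (hx : x ∈ hyperbolicSpace) (hz : lor z z ≤ 0)
    (h : lor x z < 0) : IsFuture z := by
  rcases causal_trichotomy hz with h' | h' | h'
  · rw [h', lor_zero_right] at h; exact absurd h (lt_irrefl _)
  · exact h'
  · have := lor_neg_of_future hx h'
    rw [lor_neg_right] at this; linarith

/-! ## Reflections -/

/-- The set of reflections in the hyperplanes with normal vectors in `N`. -/
def reflections (N : Set LorentzSpace) : Set (LorentzSpace ≃ₗ[ℝ] LorentzSpace) :=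
  {r | ∃ u ∈ N, ∀ x, r x = x - (2 * lor x u) • u}

/-- The linear map underlying the reflection in the hyperplane with normal vector `u`. -/
def reflMap (u : LorentzSpace) : LorentzSpace →ₗ[ℝ] LorentzSpace where
  toFun x := x - (2 * lor x u) • u
  map_add' x y := by rw [lor_add_left]; module
  map_smul' a x := by rw [lor_smul_left, RingHom.id_apply]; module

theorem reflMap_apply (u x : LorentzSpace) : reflMap u x = x - (2 * lor x u) • u := rfl

theorem reflMap_involutive {u : LorentzSpace} (hu : lor u u = 1) :
    Function.Involutive (reflMap u) := by
  intro x
  rw [reflMap_apply, reflMap_apply, lor_sub_left, lor_smul_left, hu]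
  module

open Classical in
/-- The reflection in the hyperplane with unit normal vector `u`. -/
def refl (u : LorentzSpace) : LorentzSpace ≃ₗ[ℝ] LorentzSpace :=
  if h : lor u u = 1 then LinearEquiv.ofInvolutive (reflMap u) (reflMap_involutive h) else 1

theorem refl_apply {u : LorentzSpace} (hu : lor u u = 1) (x : LorentzSpace) :
    refl u x = x - (2 * lor x u) • u := by
  rw [refl, dif_pos hu]; rfl

theorem refl_self {u : LorentzSpace} (hu : lor u u = 1) : refl u u = -u := by
  rw [refl_apply hu, hu]; module

theorem refl_mul_self {u : LorentzSpace} (hu : lor u u = 1) : refl u * refl u = 1 := by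
  refine LinearEquiv.ext fun x => ?_
  have := reflMap_involutive hu x
  rwa [LinearEquiv.mul_apply, refl_apply hu, refl_apply hu]

theorem reflections_eq_image {N : Set LorentzSpace} (hN : ∀ u ∈ N, lor u u = 1) :
    reflections N = refl '' N := by
  ext r
  constructor
  · rintro ⟨u, hu, h⟩
    exact ⟨u, hu, LinearEquiv.ext fun x => by rw [refl_apply (hN u hu), h]⟩
  · rintro ⟨u, hu, rfl⟩
    exact ⟨u, hu, refl_apply (hN u hu)⟩

/-- Linear isometries of Lorentzian space. -/
def IsLorentz (w : LorentzSpace ≃ₗ[ℝ] LorentzSpace) : Prop :=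
  ∀ x y, lor (w x) (w y) = lor x y

theorem isLorentz_refl {u : LorentzSpace} (hu : lor u u = 1) : IsLorentz (refl u) := by
  intro x y
  simp only [refl_apply hu, lor_sub_left, lor_sub_right, lor_smul_left, lor_smul_right, hu,
    lor_comm u y]
  ring

/-- Lorentz transformations that preserve the future cone. -/
def IsOrtho (w : LorentzSpace ≃ₗ[ℝ] LorentzSpace) : Prop :=
  IsLorentz w ∧ ∀ z, IsFuture z → IsFuture (w z)

theorem isOrtho_refl {u : LorentzSpace} (hu : lor u u = 1) : IsOrtho (refl u) := by
  refine ⟨isLorentz_refl hu, fun z hz => ?_⟩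
  have hc : lor (refl u z) (refl u z) ≤ 0 := by rw [isLorentz_refl hu]; exact hz.1
  rcases causal_trichotomy hc with h | h | h
  · have : z = 0 := by simpa using h
    have h4 := hz.2
    simp [this] at h4
  · exact h
  -- If the image were past, then `lor z z ≥ 2 * (lor z u) ^ 2`. As `z` is causal this forces `lor z
  -- u = 0`, so `z` is fixed and cannot have become past.
  · have h1 := lor_nonpos_of_future hz h
    rw [lor_neg_right, refl_apply hu, lor_sub_right, lor_smul_right] at h1
    have h2 : lor z u = 0 := by nlinarith [hz.1, sq_nonneg (lor z u)]
    rw [refl_apply hu, h2] at h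
    have := h.2
    have h4 := hz.2
    simp at this
    linarith

theorem IsOrtho.mul {v w : LorentzSpace ≃ₗ[ℝ] LorentzSpace} (hv : IsOrtho v) (hw : IsOrtho w) :
    IsOrtho (v * w) :=
  ⟨fun x y => by rw [LinearEquiv.mul_apply, LinearEquiv.mul_apply, hv.1, hw.1],
    fun z hz => hv.2 _ (hw.2 z hz)⟩

theorem isOrtho_one : IsOrtho 1 := ⟨fun _ _ => rfl, fun _ hz => hz⟩

theorem refl_conj {w : LorentzSpace ≃ₗ[ℝ] LorentzSpace} (hw : IsLorentz w) {u : LorentzSpace}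
    (hu : lor u u = 1) : w * refl u = refl (w u) * w := by
  refine LinearEquiv.ext fun x => ?_
  rw [LinearEquiv.mul_apply, LinearEquiv.mul_apply, refl_apply hu,
    refl_apply (by rw [hw, hu]), hw, map_sub, map_smul]

theorem refl_neg {u : LorentzSpace} (hu : lor u u = 1) : refl (-u) = refl u := by
  refine LinearEquiv.ext fun x => ?_
  rw [refl_apply hu, refl_apply (by rw [lor_neg_left, lor_neg_right, hu, neg_neg]), lor_neg_right]
  module

/-! ## Cones -/

/-- Nonnegative linear combinations of the vectors in `I`. -/
def cone (I : Finset LorentzSpace) : Set LorentzSpace :=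
  {v | ∃ c : LorentzSpace → ℝ, (∀ u ∈ I, 0 ≤ c u) ∧ v = ∑ u ∈ I, c u • u}

theorem subset_cone {I : Finset LorentzSpace} {u : LorentzSpace} (hu : u ∈ I) : u ∈ cone I := by
  classical
  refine ⟨fun x => if x = u then 1 else 0, fun x _ => by dsimp only; split_ifs <;> norm_num, ?_⟩
  simp [ite_smul, hu]

theorem add_mem_cone {I : Finset LorentzSpace} {x y : LorentzSpace} (hx : x ∈ cone I)
    (hy : y ∈ cone I) : x + y ∈ cone I := by
  obtain ⟨c, hc, rfl⟩ := hx
  obtain ⟨d, hd, rfl⟩ := hy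
  exact ⟨c + d, fun u hu => add_nonneg (hc u hu) (hd u hu), by
    simp [add_smul, Finset.sum_add_distrib]⟩

theorem smul_mem_cone {I : Finset LorentzSpace} {x : LorentzSpace} {a : ℝ} (ha : 0 ≤ a)
    (hx : x ∈ cone I) : a • x ∈ cone I := by
  obtain ⟨c, hc, rfl⟩ := hx
  exact ⟨fun u => a * c u, fun u hu => mul_nonneg ha (hc u hu), by
    simp [mul_smul, Finset.smul_sum]⟩

theorem zero_mem_cone (I : Finset LorentzSpace) : (0 : LorentzSpace) ∈ cone I :=
  ⟨0, fun _ _ => le_refl _, by simp⟩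

theorem sum_mem_cone {I : Finset LorentzSpace} {ι : Type*} (s : Finset ι) (f : ι → LorentzSpace)
    (h : ∀ i ∈ s, f i ∈ cone I) : ∑ i ∈ s, f i ∈ cone I := by
  classical
  induction s using Finset.induction_on with
  | empty => simpa using zero_mem_cone I
  | insert a s ha ih =>
    rw [Finset.sum_insert ha]
    exact add_mem_cone (h a (by simp)) (ih fun i hi => h i (by simp [hi]))

/-- A linear map that sends `I` into the cone of `J` sends the cone of `I` into that of `J`. -/
theorem map_mem_cone {I J : Finset LorentzSpace} (w : LorentzSpace ≃ₗ[ℝ] LorentzSpace)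
    (h : ∀ u ∈ I, w u ∈ cone J) {x : LorentzSpace} (hx : x ∈ cone I) : w x ∈ cone J := by
  obtain ⟨c, hc, rfl⟩ := hx
  rw [map_sum]
  exact sum_mem_cone _ _ fun u hu => by
    rw [map_smul]; exact smul_mem_cone (hc u hu) (h u hu)

theorem neg_map_mem_cone {I J : Finset LorentzSpace} (w : LorentzSpace ≃ₗ[ℝ] LorentzSpace)
    (h : ∀ u ∈ I, -w u ∈ cone J) {x : LorentzSpace} (hx : x ∈ cone I) : -w x ∈ cone J := by
  obtain ⟨c, hc, rfl⟩ := hx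
  rw [map_sum, ← Finset.sum_neg_distrib]
  exact sum_mem_cone _ _ fun u hu => by
    rw [map_smul, ← smul_neg]; exact smul_mem_cone (hc u hu) (h u hu)

theorem cone_mono {I J : Finset LorentzSpace} (h : I ⊆ J) : cone I ⊆ cone J := fun _ hx =>
  map_mem_cone 1 (fun _ hu => subset_cone (h hu)) hx

theorem lor_cone_nonpos {I : Finset LorentzSpace} {x z : LorentzSpace}
    (hx : ∀ u ∈ I, lor x u ≤ 0) (hz : z ∈ cone I) : lor x z ≤ 0 := by
  obtain ⟨c, hc, rfl⟩ := hz
  rw [lor_sum_right]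
  refine Finset.sum_nonpos fun u hu => ?_
  rw [lor_smul_right]
  exact mul_nonpos_of_nonneg_of_nonpos (hc u hu) (hx u hu)

theorem lor_cone_neg {I : Finset LorentzSpace} {x z : LorentzSpace}
    (hx : ∀ u ∈ I, lor x u < 0) (hz : z ∈ cone I) (h0 : z ≠ 0) : lor x z < 0 := by
  refine lt_of_le_of_ne (lor_cone_nonpos (fun u hu => (hx u hu).le) hz) fun h => h0 ?_
  obtain ⟨c, hc, rfl⟩ := hz
  rw [lor_sum_right] at h
  have h' := (Finset.sum_eq_zero_iff_of_nonpos fun u hu => by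
    rw [lor_smul_right]; exact mul_nonpos_of_nonneg_of_nonpos (hc u hu) (hx u hu).le).1 h
  refine Finset.sum_eq_zero fun u hu => ?_
  have := h' u hu
  rw [lor_smul_right] at this
  rcases mul_eq_zero.1 this with h | h
  · rw [h, zero_smul]
  · exact absurd h (hx u hu).ne

/-! ## Bases of reflection groups -/

/-- A finite set of outward unit normal vectors of a polyhedron with interior points in hyperbolic
space whose dihedral angles are submultiples of `π`. -/
structure IsBase (Δ : Finset LorentzSpace) : Prop where
  unit : ∀ u ∈ Δ, lor u u = 1
  angle : ∀ u ∈ Δ, ∀ v ∈ Δ, u ≠ v →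
    (∃ m : ℕ, 2 ≤ m ∧ lor u v = -Real.cos (Real.pi / m)) ∨ lor u v ≤ -1
  interior : ∃ x ∈ hyperbolicSpace, ∀ u ∈ Δ, lor x u < 0

/-- The reflection group generated by the reflections with normal vectors in `Δ`. -/
def reflGroup (Δ : Finset LorentzSpace) : Subgroup (LorentzSpace ≃ₗ[ℝ] LorentzSpace) :=
  Subgroup.closure (reflections ↑Δ)

/-- Length with respect to the reflections with normal vectors in `Δ`. -/
def len (Δ : Finset LorentzSpace) (w : LorentzSpace ≃ₗ[ℝ] LorentzSpace) : ℕ :=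
  wordLength (reflections ↑Δ) w

namespace IsBase

variable {Δ I : Finset LorentzSpace}

theorem mono (h : IsBase Δ) (hI : I ⊆ Δ) : IsBase I where
  unit u hu := h.unit u (hI hu)
  angle u hu v hv := h.angle u (hI hu) v (hI hv)
  interior := by
    obtain ⟨x, hx, h'⟩ := h.interior
    exact ⟨x, hx, fun u hu => h' u (hI hu)⟩

theorem refl_mem (h : IsBase Δ) {u : LorentzSpace} (hu : u ∈ Δ) : refl u ∈ reflections ↑Δ :=
  ⟨u, hu, refl_apply (h.unit u hu)⟩

theorem exists_refl (h : IsBase Δ) {r : LorentzSpace ≃ₗ[ℝ] LorentzSpace}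
    (hr : r ∈ reflections ↑Δ) : ∃ u ∈ Δ, r = refl u := by
  rw [reflections_eq_image h.unit] at hr
  obtain ⟨u, hu, rfl⟩ := hr
  exact ⟨u, hu, rfl⟩

theorem refl_mem_group (h : IsBase Δ) {u : LorentzSpace} (hu : u ∈ Δ) : refl u ∈ reflGroup Δ :=
  Subgroup.subset_closure (h.refl_mem hu)

theorem involutive (h : IsBase Δ) : ∀ r ∈ reflections ↑Δ, r * r = 1 := by
  intro r hr
  obtain ⟨u, hu, rfl⟩ := h.exists_refl hr
  exact refl_mul_self (h.unit u hu)

theorem group_mono (hI : I ⊆ Δ) : reflGroup I ≤ reflGroup Δ :=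
  Subgroup.closure_mono fun _ ⟨u, hu, h⟩ => ⟨u, hI hu, h⟩

theorem isOrtho (h : IsBase Δ) {w : LorentzSpace ≃ₗ[ℝ] LorentzSpace} (hw : w ∈ reflGroup Δ) :
    IsOrtho w := by
  obtain ⟨l, hl, rfl⟩ := exists_list_of_mem_closure h.involutive hw
  clear hw
  induction l with
  | nil => exact isOrtho_one
  | cons r l ih =>
    obtain ⟨u, hu, rfl⟩ := h.exists_refl (hl r (by simp))
    rw [List.prod_cons]
    exact (isOrtho_refl (h.unit u hu)).mul (ih fun s hs => hl s (by simp [hs]))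

/-- The cone is pointed because an interior point is strictly negative on every normal. This
replaces linear independence of simple roots, which fails for the normals of a polytope with many
facets. -/
theorem cone_antisymm (h : IsBase Δ) {x : LorentzSpace} (hx : x ∈ cone Δ) (hx' : -x ∈ cone Δ) :
    x = 0 := by
  obtain ⟨x₀, -, h0⟩ := h.interior
  by_contra hne
  have h1 := lor_cone_neg h0 hx hne
  have h2 := lor_cone_neg h0 hx' (neg_ne_zero.2 hne)
  rw [lor_neg_right] at h2
  linarith

/-- The image of a root is not both positive and negative. -/
theorem not_mem_cone_neg (h : IsBase Δ) {w : LorentzSpace ≃ₗ[ℝ] LorentzSpace} {s : LorentzSpace}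
    (hs : s ∈ Δ) (h1 : w s ∈ cone Δ) (h2 : -w s ∈ cone Δ) : False := by
  have := h.cone_antisymm h1 h2
  have h0 : s = 0 := by simpa using this
  have := h.unit s hs
  rw [h0, lor_zero_left] at this
  exact zero_ne_one this

end IsBase

end CoxeterDomino

end

/-! ### Dihedral subgroups, and the sign of a root against the change of length -/

noncomputable section

namespace CoxeterDomino

/-! ## Dihedral groups -/

/-- The sequence `sin (kθ) / sin θ` for `c = cos θ`, given by its recursion. -/
def sinSeq (c : ℝ) : ℕ → ℝ
  | 0 => 0
  | 1 => 1
  | k + 2 => 2 * c * sinSeq c (k + 1) - sinSeq c k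

/-- For `c ≥ 1` the recursion preserves both nonnegativity and monotonicity. This case belongs to
pairs of walls that do not meet. -/
theorem sinSeq_nonneg_of_one_le {c : ℝ} (hc : 1 ≤ c) (k : ℕ) : 0 ≤ sinSeq c k := by
  have key : ∀ k, 0 ≤ sinSeq c k ∧ sinSeq c k ≤ sinSeq c (k + 1) := by
    intro k
    induction k with
    | zero => simp [sinSeq]
    | succ k ih =>
      refine ⟨ih.1.trans ih.2, ?_⟩
      rw [sinSeq]
      nlinarith [ih.1, ih.2]
  exact (key k).1

theorem sinSeq_cos_mul_sin (θ : ℝ) (k : ℕ) :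
    sinSeq (Real.cos θ) k * Real.sin θ = Real.sin (k * θ) := by
  have key : ∀ k, sinSeq (Real.cos θ) k * Real.sin θ = Real.sin (k * θ) ∧
      sinSeq (Real.cos θ) (k + 1) * Real.sin θ = Real.sin ((k + 1 : ℕ) * θ) := by
    intro k
    induction k with
    | zero => simp [sinSeq]
    | succ k ih =>
      refine ⟨ih.2, ?_⟩
      rw [sinSeq, sub_mul, ih.1, mul_assoc, ih.2]
      have h1 : ((k + 1 + 1 : ℕ) : ℝ) * θ = (k + 1 : ℕ) * θ + θ := by push_cast; ring
      have h2 : (k : ℝ) * θ = (k + 1 : ℕ) * θ - θ := by push_cast; ring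
      rw [h1, h2, Real.sin_add, Real.sin_sub]
      ring
  exact (key k).1

theorem sin_pi_div_pos {m : ℕ} (hm : 2 ≤ m) : 0 < Real.sin (Real.pi / m) := by
  have h2 : (2 : ℝ) ≤ m := by exact_mod_cast hm
  exact Real.sin_pos_of_pos_of_lt_pi (by positivity) (div_lt_self Real.pi_pos (by linarith))

theorem sinSeq_nonneg_of_le {m k : ℕ} (hm : 2 ≤ m) (hk : k ≤ m) :
    0 ≤ sinSeq (Real.cos (Real.pi / m)) k := by
  refine nonneg_of_mul_nonneg_left ?_ (sin_pi_div_pos hm)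
  rw [sinSeq_cos_mul_sin]
  have hm' : (0 : ℝ) < m := by exact_mod_cast (by omega : 0 < m)
  have hk' : (k : ℝ) ≤ m := by exact_mod_cast hk
  refine Real.sin_nonneg_of_nonneg_of_le_pi (by positivity) ?_
  calc (k : ℝ) * (Real.pi / m) ≤ m * (Real.pi / m) := by gcongr
    _ = Real.pi := by field_simp

theorem sinSeq_self {m : ℕ} (hm : 2 ≤ m) : sinSeq (Real.cos (Real.pi / m)) m = 0 := by
  have hm' : (m : ℝ) ≠ 0 := by exact_mod_cast (by omega : m ≠ 0)
  have h := sinSeq_cos_mul_sin (Real.pi / m) m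
  rw [mul_div_cancel₀ _ hm', Real.sin_pi] at h
  exact (mul_eq_zero.1 h).resolve_right (sin_pi_div_pos hm).ne'

theorem sinSeq_self_add_one {m : ℕ} (hm : 2 ≤ m) :
    sinSeq (Real.cos (Real.pi / m)) (m + 1) = -1 := by
  have hm' : (m : ℝ) ≠ 0 := by exact_mod_cast (by omega : m ≠ 0)
  have h := sinSeq_cos_mul_sin (Real.pi / m) (m + 1)
  have h1 : ((m + 1 : ℕ) : ℝ) * (Real.pi / m) = Real.pi / m + Real.pi := by
    push_cast; field_simp; ring
  rw [h1, Real.sin_add_pi, ← neg_one_mul] at h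
  exact mul_right_cancel₀ (sin_pi_div_pos hm).ne' h

/-- The coordinates of the image are consecutive terms of `sinSeq`, and each further reflection
advances the index by one and swaps the two roots. The offset `j` serves the induction; at `j = 0`
the vector is `s` itself. -/
theorem alt_refl_apply {c : ℝ} (k j : ℕ) {s t : LorentzSpace} (hs : lor s s = 1)
    (ht : lor t t = 1) (hc : lor s t = -c) :
    alt k (refl s) (refl t) (sinSeq c (j + 1) • s + sinSeq c j • t) =
      if Even k then sinSeq c (j + k + 1) • s + sinSeq c (j + k) • t
      else sinSeq c (j + k + 1) • t + sinSeq c (j + k) • s := by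
  induction k generalizing s t j with
  | zero => simp
  | succ k ih =>
    have h1 : refl t (sinSeq c (j + 1) • s + sinSeq c j • t) =
        sinSeq c (j + 1 + 1) • t + sinSeq c (j + 1) • s := by
      rw [map_add, map_smul, map_smul, refl_self ht, refl_apply ht, hc, sinSeq]
      module
    rw [alt_succ, LinearEquiv.mul_apply, h1, ih (j + 1) ht hs (by rw [lor_comm, hc])]
    have h2 : j + 1 + k = j + (k + 1) := by ring
    by_cases h : Even k <;> simp [h, Nat.even_add_one, h2]

theorem isLorentz_alt {s t : LorentzSpace} (hs : lor s s = 1) (ht : lor t t = 1) (k : ℕ) :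
    IsLorentz (alt k (refl s) (refl t)) := by
  suffices h : IsOrtho (alt k (refl s) (refl t)) from h.1
  induction k generalizing s t with
  | zero => exact isOrtho_one
  | succ k ih => exact (ih ht hs).mul (isOrtho_refl ht)

/-- The braid relation: after `m` letters the sequence takes the values `0` and `-1`, so the word
sends `s` to minus the root of its own leftmost letter. Moving `refl s` across the word therefore
cancels that letter. -/
theorem alt_refl_mul {m : ℕ} (hm : 2 ≤ m) {s t : LorentzSpace} (hs : lor s s = 1)
    (ht : lor t t = 1) (hc : lor s t = -Real.cos (Real.pi / m)) :
    alt m (refl s) (refl t) * refl s = alt (m - 1) (refl s) (refl t) := by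
  obtain ⟨k, rfl⟩ : ∃ k, m = k + 1 := ⟨m - 1, by omega⟩
  have h := alt_refl_apply (k + 1) 0 hs ht hc
  rw [zero_add (k + 1), sinSeq_self_add_one hm, sinSeq_self hm] at h
  rw [refl_conj (isLorentz_alt hs ht _) hs]
  have h' : alt (k + 1) (refl s) (refl t) s = if Even k then -t else -s := by
    have h0 : sinSeq (Real.cos (Real.pi / (k + 1 : ℕ))) (0 + 1) • s +
      sinSeq (Real.cos (Real.pi / (k + 1 : ℕ))) 0 • t = s := by simp [sinSeq]
    rw [zero_add] at h0
    rw [h0] at h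
    rw [h]
    by_cases hk : Even k <;> simp [hk, Nat.even_add_one]
  rw [h', alt_succ', ← mul_assoc, Nat.add_sub_cancel]
  by_cases hk : Even k
  · simp [hk, refl_neg ht, refl_mul_self ht]
  · simp [hk, refl_neg hs, refl_mul_self hs]

/-- In a dihedral reflection group the image of `s` under an element that is not shortened by the
reflection in `s` is a nonnegative combination of the two roots. -/
theorem dihedral_nonneg {s t : LorentzSpace} (hs : lor s s = 1) (ht : lor t t = 1)
    (hst : (∃ m : ℕ, 2 ≤ m ∧ lor s t = -Real.cos (Real.pi / m)) ∨ lor s t ≤ -1)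
    {x : LorentzSpace ≃ₗ[ℝ] LorentzSpace}
    (hx : x ∈ Subgroup.closure ({refl s, refl t} : Set (LorentzSpace ≃ₗ[ℝ] LorentzSpace)))
    (hl : wordLength {refl s, refl t} x ≤ wordLength {refl s, refl t} (x * refl s)) :
    ∃ a b : ℝ, 0 ≤ a ∧ 0 ≤ b ∧ x s = a • s + b • t := by
  have hss := refl_mul_self hs
  have htt := refl_mul_self ht
  have hS : ∀ r ∈ ({refl s, refl t} : Set (LorentzSpace ≃ₗ[ℝ] LorentzSpace)), r * r = 1 := by
    rintro r (rfl | rfl) <;> assumption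
  obtain ⟨l, hlS, hlen, rfl⟩ := exists_reduced_word hS hx
  obtain ⟨k, hk, hk'⟩ := exists_alt_of_list hss htt l hlS
  -- A shortest word may be taken empty or ending in `refl t`: one ending in `refl s` would be
  -- shortened by it, against `hl`.
  have hxk : ∃ k, l.prod = alt k (refl s) (refl t) ∧
      k = wordLength {refl s, refl t} l.prod := by
    rcases hk' with h | h
    · refine ⟨k, h, le_antisymm (hlen ▸ hk) ?_⟩
      rw [h]; exact wordLength_alt_le hss htt k
    · cases k with
      | zero => exact ⟨0, h, by rw [h]; exact wordLength_one.symm⟩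
      | succ k =>
        rw [h, alt_succ, mul_assoc, hss, mul_one, ← alt_succ, ← h] at hl
        have := wordLength_alt_le hss htt k
        omega
  obtain ⟨k, hxk, hkl⟩ := hxk
  have happ : ∀ c, lor s t = -c → l.prod s = if Even k then sinSeq c (k + 1) • s + sinSeq c k • t
      else sinSeq c (k + 1) • t + sinSeq c k • s := by
    intro c hc
    have h := alt_refl_apply k 0 hs ht hc
    have h0 : sinSeq c (0 + 1) • s + sinSeq c 0 • t = s := by simp [sinSeq]
    rw [h0, zero_add] at h
    rw [hxk, h]
  have fin : ∀ c, lor s t = -c → 0 ≤ sinSeq c k → 0 ≤ sinSeq c (k + 1) →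
      ∃ a b : ℝ, 0 ≤ a ∧ 0 ≤ b ∧ l.prod s = a • s + b • t := by
    intro c hc h1 h2
    rw [happ c hc]
    split_ifs
    · exact ⟨_, _, h2, h1, rfl⟩
    · exact ⟨_, _, h1, h2, add_comm _ _⟩
  rcases hst with ⟨m, hm, hc⟩ | hc
  · rcases Nat.lt_or_ge k m with hkm | hkm
    · exact fin _ hc (sinSeq_nonneg_of_le hm hkm.le) (sinSeq_nonneg_of_le hm hkm)
    -- With at least `m` letters the braid relation makes the product with `refl s` shorter, which
    -- `hl` forbids.
    · exfalso
      obtain ⟨j, rfl⟩ := Nat.exists_eq_add_of_le' hkm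
      have h1 : l.prod * refl s = (if Even m then alt j (refl s) (refl t)
          else alt j (refl t) (refl s)) * alt (m - 1) (refl s) (refl t) := by
        rw [hxk, alt_add, mul_assoc, alt_refl_mul hm hs ht hc]
      have h2 : wordLength {refl s, refl t} (if Even m then alt j (refl s) (refl t)
          else alt j (refl t) (refl s)) ≤ j := by
        split_ifs
        · exact wordLength_alt_le hss htt j
        · rw [Set.pair_comm]; exact wordLength_alt_le htt hss j
      have h3 : (if Even m then alt j (refl s) (refl t)
          else alt j (refl t) (refl s)) ∈
          Subgroup.closure ({refl s, refl t} : Set (LorentzSpace ≃ₗ[ℝ] LorentzSpace)) := by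
        split_ifs
        · exact alt_mem _ _ _
        · rw [Set.pair_comm]; exact alt_mem _ _ _
      have h4 := wordLength_mul_le hS h3 (alt_mem (m - 1) (refl s) (refl t))
      have h5 := wordLength_alt_le hss htt (m - 1)
      rw [← h1] at h4
      omega
  · exact fin (-lor s t) (by ring) (sinSeq_nonneg_of_one_le (by linarith) _)
      (sinSeq_nonneg_of_one_le (by linarith) _)

/-! ## The length function and positive roots -/

namespace IsBase

variable {Δ I : Finset LorentzSpace} {w u x : LorentzSpace ≃ₗ[ℝ] LorentzSpace} {s : LorentzSpace}

theorem len_mul_le (h : IsBase Δ) {x y : LorentzSpace ≃ₗ[ℝ] LorentzSpace} (hx : x ∈ reflGroup Δ)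
    (hy : y ∈ reflGroup Δ) : len Δ (x * y) ≤ len Δ x + len Δ y :=
  wordLength_mul_le h.involutive hx hy

theorem len_mul_refl_le (h : IsBase Δ) (hw : w ∈ reflGroup Δ) (hs : s ∈ Δ) :
    len Δ (w * refl s) ≤ len Δ w + 1 :=
  wordLength_mul_gen_le h.involutive hw (h.refl_mem hs)

theorem len_le_mul_refl (h : IsBase Δ) (hw : w ∈ reflGroup Δ) (hs : s ∈ Δ) :
    len Δ w ≤ len Δ (w * refl s) + 1 :=
  wordLength_le_mul_gen h.involutive hw (h.refl_mem hs)

theorem exists_descent (h : IsBase Δ) (hw : w ∈ reflGroup Δ) (h1 : w ≠ 1) :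
    ∃ s ∈ Δ, len Δ (w * refl s) + 1 = len Δ w := by
  obtain ⟨r, hr, h'⟩ := exists_gen_lt_of_ne_one h.involutive hw h1
  obtain ⟨s, hs, rfl⟩ := h.exists_refl hr
  exact ⟨s, hs, h'⟩

theorem mul_refl_mem (h : IsBase Δ) (hw : w ∈ reflGroup Δ) (hs : s ∈ Δ) :
    w * refl s ∈ reflGroup Δ := mul_mem hw (h.refl_mem_group hs)

/-- If the reflection in `s` does not shorten `w`, then `w s` is a positive root. -/
theorem map_mem_cone_of_len_le (h : IsBase Δ) (hw : w ∈ reflGroup Δ) (hs : s ∈ Δ)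
    (hl : len Δ w ≤ len Δ (w * refl s)) : w s ∈ cone Δ := by
  induction hn : len Δ w using Nat.strong_induction_on generalizing w s with
  | _ n ih =>
  subst hn
  by_cases h1 : w = 1
  · rw [h1, LinearEquiv.coe_one, id]; exact subset_cone hs
  obtain ⟨t, ht, hlt⟩ := h.exists_descent hw h1
  have hst : s ≠ t := by rintro rfl; omega
  -- Since `t` shortens `w` and `s` does not, `w` is split as `v * x` with `x` in the dihedral group
  -- of `s` and `t`. The rank-two computation handles `x`, and induction on length handles `v`.
  set P : Set (LorentzSpace ≃ₗ[ℝ] LorentzSpace) := {refl s, refl t} with hP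
  have hPΔ : P ⊆ reflections ↑Δ := by
    rintro r (rfl | rfl)
    exacts [h.refl_mem hs, h.refl_mem ht]
  have hPi : ∀ r ∈ P, r * r = 1 := fun r hr => h.involutive r (hPΔ hr)
  have hPle : Subgroup.closure P ≤ reflGroup Δ := Subgroup.closure_mono hPΔ
  have hPlen : ∀ y ∈ Subgroup.closure P, len Δ y ≤ wordLength P y := by
    intro y hy
    obtain ⟨l, hl, hlen, rfl⟩ := exists_reduced_word hPi hy
    rw [← hlen]
    exact wordLength_prod_le fun r hr => hPΔ (hl r hr)
  have hsP : refl s ∈ P := Or.inl rfl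
  have htP : refl t ∈ P := Or.inr rfl
  -- Among the `v` for which the lengths of the two factors add up to at most that of `w`, a
  -- shortest is chosen; `w * refl t` is one candidate, already shorter than `w`.
  have hex : ∃ k, ∃ v ∈ reflGroup Δ, v⁻¹ * w ∈ Subgroup.closure P ∧
      len Δ v + wordLength P (v⁻¹ * w) ≤ len Δ w ∧ len Δ v = k := by
    refine ⟨_, w * refl t, h.mul_refl_mem hw ht, ?_, ?_, rfl⟩
    · have : (w * refl t)⁻¹ * w = (refl t)⁻¹ := by group
      rw [this]
      exact inv_mem (Subgroup.subset_closure htP)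
    · have h2 : (w * refl t)⁻¹ * w = refl t := by
        rw [inv_mul_eq_iff_eq_mul, mul_assoc, refl_mul_self (h.unit t ht), mul_one]
      rw [h2]
      have := wordLength_gen_le htP
      omega
  classical
  obtain ⟨v, hv, hvP, hvl, hvk⟩ := Nat.find_spec hex
  have hmin : ∀ v' ∈ reflGroup Δ, v'⁻¹ * w ∈ Subgroup.closure P →
      len Δ v' + wordLength P (v'⁻¹ * w) ≤ len Δ w → len Δ v ≤ len Δ v' := by
    intro v' h1 h2 h3
    rw [hvk]
    exact Nat.find_min' hex ⟨v', h1, h2, h3, rfl⟩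
  have hvw : len Δ v < len Δ w := by
    have := hmin (w * refl t) (h.mul_refl_mem hw ht) (by
      have : (w * refl t)⁻¹ * w = (refl t)⁻¹ := by group
      rw [this]
      exact inv_mem (Subgroup.subset_closure htP)) (by
      have h2 : (w * refl t)⁻¹ * w = refl t := by
        rw [inv_mul_eq_iff_eq_mul, mul_assoc, refl_mul_self (h.unit t ht), mul_one]
      rw [h2]
      have := wordLength_gen_le htP
      omega)
    omega
  -- Neither generator of `P` shortens `v`, since it could be moved into the dihedral factor,
  -- against minimality. So the induction hypothesis applies to `v`.
  have hpos : ∀ r ∈ Δ, refl r ∈ P → v r ∈ cone Δ := by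
    intro r hr hrP
    refine ih (len Δ v) hvw hv hr ?_ rfl
    by_contra hlt'
    have h2 : (v * refl r)⁻¹ * w = refl r * (v⁻¹ * w) := by
      rw [mul_inv_rev, mul_assoc, inv_eq_of_mul_eq_one_right (refl_mul_self (h.unit r hr))]
    have h3 : refl r * (v⁻¹ * w) ∈ Subgroup.closure P :=
      mul_mem (Subgroup.subset_closure hrP) hvP
    have h4 := wordLength_mul_le hPi (Subgroup.subset_closure hrP) hvP
    have h5 := wordLength_gen_le hrP
    have := hmin (v * refl r) (h.mul_refl_mem hv hr) (h2 ▸ h3) (by rw [h2]; omega)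
    omega
  -- If `refl s` shortened the dihedral factor, then it would shorten `w`.
  obtain ⟨a, b, ha, hb, hab⟩ := dihedral_nonneg (h.unit s hs) (h.unit t ht)
    (h.angle s hs t ht hst) hvP (by
      by_contra hlt'
      rw [← hP] at hlt'
      have h2 : w * refl s = v * (v⁻¹ * w * refl s) := by group
      have h3 : v⁻¹ * w * refl s ∈ Subgroup.closure P :=
        mul_mem hvP (Subgroup.subset_closure hsP)
      have h4 := h.len_mul_le hv (hPle h3)
      have h5 := hPlen _ h3
      rw [← h2] at h4
      omega)
  have : w s = a • v s + b • v t := by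
    rw [← map_smul, ← map_smul, ← map_add, ← hab, ← LinearEquiv.mul_apply]
    congr 1
    group
  rw [this]
  exact add_mem_cone (smul_mem_cone ha (hpos s hs hsP)) (smul_mem_cone hb (hpos t ht htP))

theorem neg_map_mem_cone_of_len_le (h : IsBase Δ) (hw : w ∈ reflGroup Δ) (hs : s ∈ Δ)
    (hl : len Δ (w * refl s) ≤ len Δ w) : -w s ∈ cone Δ := by
  have := h.map_mem_cone_of_len_le (h.mul_refl_mem hw hs) hs (by
    rwa [mul_assoc, refl_mul_self (h.unit s hs), mul_one])
  rwa [LinearEquiv.mul_apply, refl_self (h.unit s hs), map_neg] at this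

theorem map_mem_cone_or (h : IsBase Δ) (hw : w ∈ reflGroup Δ) (hs : s ∈ Δ) :
    w s ∈ cone Δ ∨ -w s ∈ cone Δ :=
  (le_total (len Δ w) (len Δ (w * refl s))).imp (h.map_mem_cone_of_len_le hw hs)
    (h.neg_map_mem_cone_of_len_le hw hs)

/-- Equal lengths are excluded without a sign character: they would make `w s` both positive and
negative. -/
theorem len_mul_refl_of_mem (h : IsBase Δ) (hw : w ∈ reflGroup Δ) (hs : s ∈ Δ)
    (hws : w s ∈ cone Δ) : len Δ (w * refl s) = len Δ w + 1 := by
  refine le_antisymm (h.len_mul_refl_le hw hs) ?_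
  by_contra hlt
  exact h.not_mem_cone_neg hs hws (h.neg_map_mem_cone_of_len_le hw hs (by omega))

theorem len_mul_refl_of_neg_mem (h : IsBase Δ) (hw : w ∈ reflGroup Δ) (hs : s ∈ Δ)
    (hws : -w s ∈ cone Δ) : len Δ (w * refl s) + 1 = len Δ w := by
  refine le_antisymm ?_ (h.len_le_mul_refl hw hs)
  by_contra hlt
  exact h.not_mem_cone_neg hs (h.map_mem_cone_of_len_le hw hs (by omega)) hws

theorem len_one (Δ : Finset LorentzSpace) : len Δ 1 = 0 := wordLength_one

theorem eq_one_of_len_eq_zero (h : IsBase Δ) (hw : w ∈ reflGroup Δ) (h0 : len Δ w = 0) : w = 1 :=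
  eq_one_of_wordLength_eq_zero h.involutive hw h0

theorem exists_neg_of_ne_one (h : IsBase Δ) (hw : w ∈ reflGroup Δ) (h1 : w ≠ 1) :
    ∃ s ∈ Δ, -w s ∈ cone Δ := by
  obtain ⟨s, hs, hl⟩ := h.exists_descent hw h1
  exact ⟨s, hs, h.neg_map_mem_cone_of_len_le hw hs (by omega)⟩

/-- Minimal representatives of left cosets of a parabolic subgroup: lengths add. -/
theorem len_mul_of_minimal (h : IsBase Δ) (hI : I ⊆ Δ) (hu : u ∈ reflGroup Δ)
    (hmin : ∀ s ∈ I, u s ∈ cone Δ) (hx : x ∈ reflGroup I) :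
    len Δ (u * x) = len Δ u + len I x := by
  have hb := h.mono hI
  induction hn : len I x generalizing x with
  | zero => rw [hb.eq_one_of_len_eq_zero hx hn, mul_one, add_zero]
  | succ n ih =>
    have hx1 : x ≠ 1 := by rintro rfl; rw [len_one] at hn; omega
    obtain ⟨s, hs, hl⟩ := hb.exists_descent hx hx1
    have hx' := hb.mul_refl_mem hx hs
    have h1 := ih hx' (by omega)
    have hss := refl_mul_self (hb.unit s hs)
    have h2 : (x * refl s) s ∈ cone I := hb.map_mem_cone_of_len_le hx' hs (by
      rw [mul_assoc, hss, mul_one]; omega)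
    have h3 : (u * (x * refl s)) s ∈ cone Δ := by
      rw [LinearEquiv.mul_apply]
      exact map_mem_cone u hmin h2
    have h4 := h.len_mul_refl_of_mem (mul_mem hu (group_mono hI hx')) (hI hs) h3
    rw [mul_assoc, mul_assoc, hss, mul_one, h1] at h4
    rw [h4, add_assoc]

/-- As long as some `s ∈ I` is sent to a negative root, `refl s` can be split off on the right, and
the length drops. -/
theorem exists_minimal_mul (h : IsBase Δ) (hI : I ⊆ Δ) (hw : w ∈ reflGroup Δ) :
    ∃ u ∈ reflGroup Δ, (∀ s ∈ I, u s ∈ cone Δ) ∧ ∃ x ∈ reflGroup I, w = u * x := by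
  induction hn : len Δ w using Nat.strong_induction_on generalizing w with
  | _ n ih =>
  by_cases hmin : ∀ s ∈ I, w s ∈ cone Δ
  · exact ⟨w, hw, hmin, 1, one_mem _, (mul_one w).symm⟩
  · push Not at hmin
    obtain ⟨s, hs, hws⟩ := hmin
    have hneg := (h.map_mem_cone_or hw (hI hs)).resolve_left hws
    have hl := h.len_mul_refl_of_neg_mem hw (hI hs) hneg
    obtain ⟨u, hu, hu', x, hx, hwx⟩ := ih _ (by omega) (h.mul_refl_mem hw (hI hs)) rfl
    refine ⟨u, hu, hu', x * refl s, (h.mono hI).mul_refl_mem hx hs, ?_⟩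
    rw [← mul_assoc, ← hwx, mul_assoc, refl_mul_self (h.unit s (hI hs)), mul_one]

/-- Two such `u` differ by an element of the subgroup of `I`. If it is nontrivial it makes some `s ∈
I` negative within `I`, and `u'` keeps it negative, although `u s` is positive. -/
theorem minimal_unique (h : IsBase Δ) (hI : I ⊆ Δ)
    {u u' x x' : LorentzSpace ≃ₗ[ℝ] LorentzSpace}
    (hmin : ∀ s ∈ I, u s ∈ cone Δ) (hmin' : ∀ s ∈ I, u' s ∈ cone Δ)
    (hx : x ∈ reflGroup I) (hx' : x' ∈ reflGroup I) (he : u * x = u' * x') : u = u' ∧ x = x' := by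
  have hu : u = u' * (x' * x⁻¹) := by rw [← mul_assoc, ← he, mul_assoc, mul_inv_cancel, mul_one]
  have h1 : x' * x⁻¹ = 1 := by
    by_contra hne
    obtain ⟨s, hs, hneg⟩ := (h.mono hI).exists_neg_of_ne_one (mul_mem hx' (inv_mem hx)) hne
    refine h.not_mem_cone_neg (hI hs) (hmin s hs) ?_
    have := map_mem_cone u' hmin' hneg
    rwa [map_neg, ← LinearEquiv.mul_apply, ← hu] at this
  rw [h1, mul_one] at hu
  exact ⟨hu, by rw [hu] at he; exact mul_left_cancel he⟩

end IsBase

end CoxeterDomino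

end

/-! ### Growth series by inclusion–exclusion over descents -/

noncomputable section

namespace CoxeterDomino

/-! ## Growth series of subsets of a reflection group -/

/-- The generating function of a set of elements by length. -/
def lenSeries (Δ : Finset LorentzSpace) (P : Set (LorentzSpace ≃ₗ[ℝ] LorentzSpace)) :
    PowerSeries ℤ :=
  PowerSeries.mk fun k => ({w | w ∈ P ∧ len Δ w = k}.ncard : ℤ)

/-- The growth series of the reflection group of `Δ`. -/
def growth (Δ : Finset LorentzSpace) : PowerSeries ℤ :=
  lenSeries Δ (reflGroup Δ)

theorem growthSeries_reflections (Δ : Finset LorentzSpace) :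
    growthSeries (reflections ↑Δ) = growth Δ := rfl

/-- Elements that send all of `I` to positive roots. -/
def minReps (Δ I : Finset LorentzSpace) : Set (LorentzSpace ≃ₗ[ℝ] LorentzSpace) :=
  {w | w ∈ reflGroup Δ ∧ ∀ s ∈ I, w s ∈ cone Δ}

/-- Elements that send all of `I` to negative roots. -/
def descSet (Δ I : Finset LorentzSpace) : Set (LorentzSpace ≃ₗ[ℝ] LorentzSpace) :=
  {w | w ∈ reflGroup Δ ∧ ∀ s ∈ I, -w s ∈ cone Δ}

namespace IsBase

variable {Δ I : Finset LorentzSpace}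

theorem finite_len (h : IsBase Δ) {P : Set (LorentzSpace ≃ₗ[ℝ] LorentzSpace)}
    (hP : P ⊆ reflGroup Δ) (k : ℕ) : {w | w ∈ P ∧ len Δ w = k}.Finite := by
  have hf : (reflections (↑Δ : Set LorentzSpace)).Finite := by
    rw [reflections_eq_image h.unit]
    exact Δ.finite_toSet.image _
  exact (finite_wordLength_eq h.involutive hf k).subset fun w hw => ⟨hP hw.1, hw.2⟩

/-- Factorizations are unique and lengths add, so counting by length is a convolution. A subset `X`
is allowed in order to cover both the whole parabolic subgroup and its descent set. -/
theorem lenSeries_mul (h : IsBase Δ) (hI : I ⊆ Δ) {X : Set (LorentzSpace ≃ₗ[ℝ] LorentzSpace)}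
    (hX : X ⊆ reflGroup I) :
    lenSeries Δ {w | ∃ u ∈ minReps Δ I, ∃ x ∈ X, w = u * x} =
      lenSeries Δ (minReps Δ I) * lenSeries I X := by
  classical
  have hU : minReps Δ I ⊆ reflGroup Δ := fun w hw => hw.1
  ext k
  rw [PowerSeries.coeff_mul]
  simp only [lenSeries, PowerSeries.coeff_mk]
  set U : ℕ → Finset (LorentzSpace ≃ₗ[ℝ] LorentzSpace) := fun i => (h.finite_len hU i).toFinset
    with hUdef
  set Y : ℕ → Finset (LorentzSpace ≃ₗ[ℝ] LorentzSpace) :=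
    fun i => ((h.mono hI).finite_len hX i).toFinset with hYdef
  have hUi : ∀ i, {w | w ∈ minReps Δ I ∧ len Δ w = i}.ncard = (U i).card := fun i =>
    Set.ncard_eq_toFinset_card _ _
  have hYi : ∀ i, {w | w ∈ X ∧ len I w = i}.ncard = (Y i).card := fun i =>
    Set.ncard_eq_toFinset_card _ _
  have memU : ∀ i w, w ∈ U i ↔ w ∈ minReps Δ I ∧ len Δ w = i := fun i w => by simp [hUdef]
  have memY : ∀ i w, w ∈ Y i ↔ w ∈ X ∧ len I w = i := fun i w => by simp [hYdef]
  have hset : {w | w ∈ {w | ∃ u ∈ minReps Δ I, ∃ x ∈ X, w = u * x} ∧ len Δ w = k} =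
      ↑(((Finset.HasAntidiagonal.antidiagonal k).biUnion fun p => U p.1 ×ˢ Y p.2).image
        fun q => q.1 * q.2) := by
    ext w
    simp only [Set.mem_ofPred_eq, Finset.coe_image, Set.mem_image, Finset.mem_coe,
      Finset.mem_biUnion, Finset.HasAntidiagonal.mem_antidiagonal, Finset.mem_product, memU, memY, Prod.exists]
    constructor
    · rintro ⟨⟨u, hu, x, hx, rfl⟩, hk⟩
      rw [h.len_mul_of_minimal hI hu.1 hu.2 (hX hx)] at hk
      exact ⟨u, x, ⟨_, _, hk, ⟨hu, rfl⟩, hx, rfl⟩, rfl⟩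
    · rintro ⟨u, x, ⟨i, j, hk, ⟨hu, rfl⟩, hx, rfl⟩, rfl⟩
      exact ⟨⟨u, hu, x, hx, rfl⟩, by rw [h.len_mul_of_minimal hI hu.1 hu.2 (hX hx), hk]⟩
  rw [hset, Set.ncard_coe_finset, Finset.card_image_of_injOn, Finset.card_biUnion]
  · push_cast
    refine Finset.sum_congr rfl fun p _ => ?_
    rw [Finset.card_product, hUi, hYi]
    push_cast
    rfl
  · intro p _ q _ hpq
    rw [Function.onFun, Finset.disjoint_left]
    intro z hz hz'
    rw [Finset.mem_product, memU, memY] at hz hz'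
    exact hpq (Prod.ext (hz.1.2.symm.trans hz'.1.2) (hz.2.2.symm.trans hz'.2.2))
  · intro z hz z' hz' he
    simp only [Finset.coe_biUnion, Set.mem_iUnion, Finset.mem_coe, Finset.mem_product, memU,
      memY] at hz hz'
    obtain ⟨_, _, hz, hzx⟩ := hz
    obtain ⟨_, _, hz', hzx'⟩ := hz'
    obtain ⟨h1, h2⟩ := h.minimal_unique hI hz.1.2 hz'.1.2 (hX hzx.1) (hX hzx'.1) he
    exact Prod.ext h1 h2

theorem growth_eq_mul (h : IsBase Δ) (hI : I ⊆ Δ) :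
    growth Δ = lenSeries Δ (minReps Δ I) * growth I := by
  rw [growth, growth, ← h.lenSeries_mul hI le_rfl]
  congr 1
  ext w
  constructor
  · intro hw
    obtain ⟨u, hu, hu', x, hx, rfl⟩ := h.exists_minimal_mul hI hw
    exact ⟨u, ⟨hu, hu'⟩, x, hx, rfl⟩
  · rintro ⟨u, hu, x, hx, rfl⟩
    exact mul_mem hu.1 (group_mono hI hx)

/-- A minimal `u` preserves the signs of the roots of `I`, so the descents of `u * x` within `I` are
those of `x`. -/
theorem lenSeries_descSet (h : IsBase Δ) (hI : I ⊆ Δ) :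
    lenSeries Δ (descSet Δ I) = lenSeries Δ (minReps Δ I) * lenSeries I (descSet I I) := by
  rw [← h.lenSeries_mul hI fun w hw => hw.1]
  congr 1
  ext w
  constructor
  · rintro ⟨hw, hneg⟩
    obtain ⟨u, hu, hu', x, hx, rfl⟩ := h.exists_minimal_mul hI hw
    refine ⟨u, ⟨hu, hu'⟩, x, ⟨hx, fun s hs => ?_⟩, rfl⟩
    refine ((h.mono hI).map_mem_cone_or hx hs).resolve_left fun hpos => ?_
    exact h.not_mem_cone_neg (hI hs) (w := u * x) (map_mem_cone u hu' hpos) (hneg s hs)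
  · rintro ⟨u, hu, x, hx, rfl⟩
    refine ⟨mul_mem hu.1 (group_mono hI hx.1), fun s hs => ?_⟩
    have := map_mem_cone u hu.2 (hx.2 s hs)
    rwa [map_neg] at this

theorem minReps_self (h : IsBase Δ) : minReps Δ Δ = {1} := by
  ext w
  constructor
  · rintro ⟨hw, hpos⟩
    by_contra hne
    obtain ⟨s, hs, hneg⟩ := h.exists_neg_of_ne_one hw hne
    exact h.not_mem_cone_neg hs (hpos s hs) hneg
  · rintro rfl
    exact ⟨one_mem _, fun s hs => subset_cone hs⟩

/-- An element with descent set `D` is counted with weight the sum of `(-1) ^ |I|` over `I ⊆ D`.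
This vanishes unless `D` is empty, and only the identity has no descents. -/
theorem sum_lenSeries_descSet (h : IsBase Δ) :
    ∑ I ∈ Δ.powerset, (-1 : PowerSeries ℤ) ^ I.card * lenSeries Δ (descSet Δ I) = 1 := by
  classical
  ext k
  set A : Finset (LorentzSpace ≃ₗ[ℝ] LorentzSpace) := (h.finite_len le_rfl k).toFinset with hA
  have memA : ∀ w, w ∈ A ↔ w ∈ reflGroup Δ ∧ len Δ w = k := fun w => by simp [hA]
  set D : (LorentzSpace ≃ₗ[ℝ] LorentzSpace) → Finset LorentzSpace :=
    fun w => Δ.filter fun s => -w s ∈ cone Δ with hD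
  have hcoeff : ∀ I ∈ Δ.powerset,
      PowerSeries.coeff k ((-1 : PowerSeries ℤ) ^ I.card * lenSeries Δ (descSet Δ I)) =
      ∑ w ∈ A, if I ⊆ D w then (-1 : ℤ) ^ I.card else 0 := by
    intro I hI
    rw [Finset.mem_powerset] at hI
    have h1 : ((-1 : PowerSeries ℤ) ^ I.card) = PowerSeries.C ((-1 : ℤ) ^ I.card) := by simp
    rw [h1, PowerSeries.coeff_C_mul, ← Finset.sum_filter, Finset.sum_const, nsmul_eq_mul,
      mul_comm, lenSeries, PowerSeries.coeff_mk]
    congr 2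
    rw [← Set.ncard_coe_finset]
    congr 1
    ext w
    simp only [descSet, Set.mem_ofPred_eq, Finset.coe_filter, memA, hD, Finset.subset_iff,
      Finset.mem_filter]
    constructor
    · rintro ⟨⟨h1, h2⟩, h3⟩
      exact ⟨⟨h1, h3⟩, fun s hs => ⟨hI hs, h2 s hs⟩⟩
    · rintro ⟨⟨h1, h3⟩, h2⟩
      exact ⟨⟨h1, fun s hs => (h2 hs).2⟩, h3⟩
  rw [map_sum, Finset.sum_congr rfl hcoeff, Finset.sum_comm]
  have hD' : ∀ w ∈ A, (∑ I ∈ Δ.powerset, if I ⊆ D w then (-1 : ℤ) ^ I.card else 0) =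
      if w = 1 then 1 else 0 := by
    intro w hw
    have h1 : Δ.powerset.filter (fun I => I ⊆ D w) = (D w).powerset := by
      ext I
      simp only [Finset.mem_filter, Finset.mem_powerset]
      exact ⟨fun h => h.2, fun h => ⟨h.trans (Finset.filter_subset _ _), h⟩⟩
    rw [← Finset.sum_filter, h1, Finset.sum_powerset_neg_one_pow_card]
    have h2 : D w = ∅ ↔ w = 1 := by
      constructor
      · intro he
        by_contra hne
        obtain ⟨s, hs, hneg⟩ := h.exists_neg_of_ne_one ((memA w).1 hw).1 hne
        have : s ∈ D w := Finset.mem_filter.2 ⟨hs, hneg⟩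
        simp [he] at this
      · rintro rfl
        refine Finset.filter_eq_empty_iff.2 fun s hs hneg => ?_
        exact h.not_mem_cone_neg (w := 1) hs (subset_cone hs) hneg
    simp only [h2]
  rw [Finset.sum_congr rfl hD', PowerSeries.coeff_one, Finset.sum_ite_eq']
  congr 1
  rw [memA, len_one]
  exact propext ⟨fun h => h.2.symm, fun h => ⟨one_mem _, h.symm⟩⟩

theorem coeff_zero_growth (h : IsBase Δ) : PowerSeries.coeff 0 (growth Δ) = 1 := by
  rw [growth, lenSeries, PowerSeries.coeff_mk]
  have : {w | w ∈ (reflGroup Δ : Set (LorentzSpace ≃ₗ[ℝ] LorentzSpace)) ∧ len Δ w = 0} = {1} := by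
    ext w
    constructor
    · rintro ⟨hw, h0⟩
      exact h.eq_one_of_len_eq_zero hw h0
    · rintro rfl
      exact ⟨one_mem _, len_one Δ⟩
  rw [this, Set.ncard_singleton, Nat.cast_one]

theorem growth_ne_zero (h : IsBase Δ) : growth Δ ≠ 0 := fun h0 => by
  have := h.coeff_zero_growth
  rw [h0, map_zero] at this
  exact zero_ne_one this

end IsBase

/-! ## The inverse of the growth series as an alternating sum -/

/-- The field of fractions of the ring of integral power series. -/
abbrev SeriesField : Type := FractionRing (PowerSeries ℤ)

/-- The inclusion of power series into their field of fractions. -/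
abbrev toField : PowerSeries ℤ →+* SeriesField := algebraMap (PowerSeries ℤ) SeriesField

theorem toField_injective : Function.Injective toField := IsFractionRing.injective _ _

/-- The inverse of the growth series. -/
def invGrowth (Δ : Finset LorentzSpace) : SeriesField := (toField (growth Δ))⁻¹

/-- The contribution of the parabolic subgroup of `I` to the inverse of the growth series. -/
def invTerm (I : Finset LorentzSpace) : SeriesField :=
  (-1) ^ I.card * toField (lenSeries I (descSet I I)) * invGrowth I

namespace IsBase

variable {Δ I : Finset LorentzSpace}

theorem toField_growth_ne_zero (h : IsBase Δ) : toField (growth Δ) ≠ 0 := by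
  rw [Ne, map_eq_zero_iff _ toField_injective]
  exact h.growth_ne_zero

/-- Dividing inclusion–exclusion by `growth Δ` leaves terms depending on `I` alone, so the
expansions of different bases can be compared term by term. -/
theorem invGrowth_eq_sum (h : IsBase Δ) : invGrowth Δ = ∑ I ∈ Δ.powerset, invTerm I := by
  have h1 : ∀ I ∈ Δ.powerset,
      toField ((-1 : PowerSeries ℤ) ^ I.card * lenSeries Δ (descSet Δ I)) =
        toField (growth Δ) * invTerm I := by
    intro I hI
    rw [Finset.mem_powerset] at hI
    have h0 := (h.mono hI).toField_growth_ne_zero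
    rw [h.lenSeries_descSet hI, h.growth_eq_mul hI, invTerm, invGrowth]
    simp only [map_mul, map_pow, map_neg, map_one]
    field_simp
  have h2 := congrArg toField h.sum_lenSeries_descSet
  rw [map_sum, Finset.sum_congr rfl h1, ← Finset.mul_sum, map_one] at h2
  rw [invGrowth]
  exact inv_eq_of_mul_eq_one_right h2

/-- The parabolic subgroup of `I` does not contribute if its form is not positive definite. -/
theorem invTerm_eq_zero (h : IsBase I) {z : LorentzSpace} (hz : z ∈ cone I) (h0 : z ≠ 0)
    (hzz : lor z z ≤ 0) : invTerm I = 0 := by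
  have : descSet I I = ∅ := by
    rw [Set.eq_empty_iff_forall_notMem]
    rintro w ⟨hw, hneg⟩
    obtain ⟨x, hx, hxI⟩ := h.interior
    -- The group preserves the future cone, so `w z` stays future. An element making all of `I`
    -- negative would put `-w z` into the cone of `I`, hence `w z` on the wrong side of the interior
    -- point.
    have h1 : IsFuture z := future_of_lor_neg hx hzz (lor_cone_neg hxI hz h0)
    have h2 := lor_neg_of_future hx ((h.isOrtho hw).2 z h1)
    have h3 := lor_cone_nonpos (fun u hu => (hxI u hu).le) (neg_map_mem_cone w hneg hz)
    rw [lor_neg_right] at h3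
    linarith
  have h2 : lenSeries I (descSet I I) = 0 := by
    ext k
    simp [lenSeries, this]
  rw [invTerm, h2, map_zero, mul_zero, zero_mul]

/-- The sum `u + v` has square `2 + 2 * lor u v ≤ 0` and is therefore causal. -/
theorem invTerm_eq_zero_of_pair (h : IsBase I) {u v : LorentzSpace} (hu : u ∈ I) (hv : v ∈ I)
    (huv : lor u v ≤ -1) : invTerm I = 0 := by
  refine h.invTerm_eq_zero (add_mem_cone (subset_cone hu) (subset_cone hv)) ?_ ?_
  · intro h0
    obtain ⟨x, -, hxI⟩ := h.interior
    have h1 := hxI u hu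
    have h2 := hxI v hv
    have h3 := lor_add_right x u v
    rw [h0, lor_zero_right] at h3
    linarith
  · rw [lor_add_left, lor_add_right, lor_add_right, h.unit u hu, h.unit v hv, lor_comm v u]
    linarith

/-- Growth of an amalgamated product. -/
theorem invGrowth_union {Δ₁ Δ₂ : Finset LorentzSpace} (h : IsBase (Δ₁ ∪ Δ₂))
    (hc : ∀ u ∈ Δ₁, u ∉ Δ₂ → ∀ v ∈ Δ₂, v ∉ Δ₁ → lor u v ≤ -1) :
    invGrowth (Δ₁ ∪ Δ₂) = invGrowth Δ₁ + invGrowth Δ₂ - invGrowth (Δ₁ ∩ Δ₂) := by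
  classical
  have h1 : Δ₁ ⊆ Δ₁ ∪ Δ₂ := Finset.subset_union_left
  have h2 : Δ₂ ⊆ Δ₁ ∪ Δ₂ := Finset.subset_union_right
  rw [h.invGrowth_eq_sum, (h.mono h1).invGrowth_eq_sum, (h.mono h2).invGrowth_eq_sum,
    (h.mono (Finset.inter_subset_left.trans h1)).invGrowth_eq_sum, eq_sub_iff_add_eq]
  have h3 : (Δ₁ ∩ Δ₂).powerset = Δ₁.powerset ∩ Δ₂.powerset := by
    ext I; simp only [Finset.mem_inter, Finset.mem_powerset, Finset.subset_inter_iff]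
  rw [h3, ← Finset.sum_union_inter (s₁ := Δ₁.powerset)]
  congr 1
  symm
  refine Finset.sum_subset (fun I hI => ?_) fun I hI hI' => ?_
  · rw [Finset.mem_union, Finset.mem_powerset, Finset.mem_powerset] at hI
    rw [Finset.mem_powerset]
    exact hI.elim (fun h => h.trans h1) fun h => h.trans h2
  -- A subset contained in neither part has an element exclusive to each, and this pair makes its
  -- term vanish.
  · rw [Finset.mem_powerset] at hI
    rw [Finset.mem_union, Finset.mem_powerset, Finset.mem_powerset, not_or] at hI'
    obtain ⟨hI1, hI2⟩ := hI'
    rw [Finset.not_subset] at hI1 hI2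
    obtain ⟨v, hv, hv1⟩ := hI1
    obtain ⟨u, hu, hu2⟩ := hI2
    have hu1 : u ∈ Δ₁ := (Finset.mem_union.1 (hI hu)).resolve_right hu2
    have hv2 : v ∈ Δ₂ := (Finset.mem_union.1 (hI hv)).resolve_left hv1
    exact (h.mono hI).invTerm_eq_zero_of_pair hu hv (hc u hu1 hu2 v hv2 hv1)

/-- Growth of the direct product with a group of order two. -/
theorem invGrowth_insert [DecidableEq LorentzSpace] {v : LorentzSpace}
    (h : IsBase (insert v I)) (hv : v ∉ I)
    (ho : ∀ u ∈ I, lor u v = 0) :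
    invGrowth I = (1 + toField PowerSeries.X) * invGrowth (insert v I) := by
  have hI : I ⊆ insert v I := Finset.subset_insert v I
  have hb := h.mono hI
  have hvm : v ∈ insert v I := Finset.mem_insert_self v I
  have hvv := refl_mul_self (h.unit v hvm)
  have hfix : ∀ u ∈ I, refl v u = u := fun u hu => by
    rw [refl_apply (h.unit v hvm), ho u hu]; module
  have hcomm : ∀ u ∈ I, refl v * refl u = refl u * refl v := fun u hu => by
    rw [refl_conj (isLorentz_refl (h.unit v hvm)) (hb.unit u hu), hfix u hu]
  have hdecomp : ∀ w ∈ reflGroup (insert v I), w ∈ reflGroup I ∨ w * refl v ∈ reflGroup I := by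
    intro w hw
    obtain ⟨l, hl, rfl⟩ := exists_list_of_mem_closure h.involutive hw
    clear hw
    induction l using List.reverseRecOn with
    | nil => exact Or.inl (one_mem _)
    | append_singleton l r ih =>
      have ih' := ih fun s hs => hl s (by simp [hs])
      obtain ⟨u, hu, rfl⟩ := h.exists_refl (hl r (by simp))
      rw [List.prod_append, List.prod_singleton]
      rcases Finset.mem_insert.1 hu with rfl | hu
      · rcases ih' with h' | h'
        · exact Or.inr (by rwa [mul_assoc, hvv, mul_one])
        · exact Or.inl h'
      · rcases ih' with h' | h'
        · exact Or.inl (mul_mem h' (hb.refl_mem_group hu))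
        · refine Or.inr ?_
          rw [mul_assoc, ← hcomm u hu, ← mul_assoc]
          exact mul_mem h' (hb.refl_mem_group hu)
  -- The factor `refl v` fixes every root of `I`, so positivity is decided by the component in the
  -- subgroup of `I`, which must be trivial.
  have hmin : minReps (insert v I) I = {1, refl v} := by
    have key : ∀ w ∈ reflGroup I, (∀ s ∈ I, w s ∈ cone (insert v I)) → w = 1 := by
      intro w hw hpos
      by_contra hne
      obtain ⟨s, hs, hneg⟩ := hb.exists_neg_of_ne_one hw hne
      exact h.not_mem_cone_neg (hI hs) (hpos s hs) (cone_mono hI hneg)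
    ext w
    constructor
    · rintro ⟨hw, hpos⟩
      rcases hdecomp w hw with hw' | hw'
      · exact Or.inl (key w hw' hpos)
      · refine Or.inr ?_
        have := key _ hw' fun s hs => by
          rw [LinearEquiv.mul_apply, hfix s hs]; exact hpos s hs
        rw [mul_eq_one_iff_eq_inv, inv_eq_of_mul_eq_one_right hvv] at this
        exact this
    · rintro (rfl | rfl)
      · exact ⟨one_mem _, fun s hs => subset_cone (hI hs)⟩
      · exact ⟨h.refl_mem_group hvm, fun s hs => by rw [hfix s hs]; exact subset_cone (hI hs)⟩
  have hlen : len (insert v I) (refl v) = 1 := by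
    have := h.len_mul_refl_of_mem (one_mem _) hvm (subset_cone hvm)
    rwa [one_mul, len_one] at this
  have hser : lenSeries (insert v I) (minReps (insert v I) I) = 1 + PowerSeries.X := by
    ext k
    rw [lenSeries, PowerSeries.coeff_mk, hmin, map_add, PowerSeries.coeff_one,
      PowerSeries.coeff_X]
    rcases k with _ | _ | k
    · have : {w | w ∈ ({1, refl v} : Set (LorentzSpace ≃ₗ[ℝ] LorentzSpace)) ∧
          len (insert v I) w = 0} = {1} := by
        ext w
        constructor
        · rintro ⟨rfl | rfl, h0⟩
          · rfl
          · omega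
        · rintro rfl
          exact ⟨Or.inl rfl, len_one _⟩
      rw [this]; simp
    · have : {w | w ∈ ({1, refl v} : Set (LorentzSpace ≃ₗ[ℝ] LorentzSpace)) ∧
          len (insert v I) w = 0 + 1} = {refl v} := by
        ext w
        constructor
        · rintro ⟨rfl | rfl, h0⟩
          · rw [len_one] at h0; omega
          · rfl
        · rintro rfl
          exact ⟨Or.inr rfl, hlen⟩
      rw [this]; simp
    · have : {w | w ∈ ({1, refl v} : Set (LorentzSpace ≃ₗ[ℝ] LorentzSpace)) ∧
          len (insert v I) w = k + 1 + 1} = ∅ := by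
        rw [Set.eq_empty_iff_forall_notMem]
        rintro w ⟨rfl | rfl, h0⟩
        · rw [len_one] at h0; omega
        · omega
      rw [this]; simp
  have hg := congrArg toField (h.growth_eq_mul hI)
  rw [hser, map_mul, map_add, map_one] at hg
  have h1 := hb.toField_growth_ne_zero
  have h2 := h.toField_growth_ne_zero
  rw [invGrowth, invGrowth, inv_eq_iff_eq_inv, mul_inv, inv_inv, hg]
  rw [hg] at h2
  have h3 := left_ne_zero_of_mul h2
  field_simp

/-- A parabolic subgroup with a longest element. -/
theorem lenSeries_descSet_self (h : IsBase I) {w : LorentzSpace ≃ₗ[ℝ] LorentzSpace}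
    (hw : w ∈ descSet I I) : lenSeries I (descSet I I) = PowerSeries.X ^ len I w := by
  -- If `w` and `w'` both make all of `I` negative, then `w' * w⁻¹` keeps all of `I` positive, hence
  -- is trivial.
  have huniq : ∀ w' ∈ descSet I I, w' = w := by
    intro w' hw'
    have hinv : ∀ s ∈ I, -w⁻¹ s ∈ cone I := by
      intro s hs
      refine (h.map_mem_cone_or (inv_mem hw.1) hs).resolve_left fun hpos => ?_
      have := neg_map_mem_cone w hw.2 hpos
      rw [← LinearEquiv.mul_apply, mul_inv_cancel] at this
      exact h.not_mem_cone_neg (w := 1) hs (subset_cone hs) this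
    have h1 : w' * w⁻¹ ∈ minReps I I := by
      refine ⟨mul_mem hw'.1 (inv_mem hw.1), fun s hs => ?_⟩
      have := neg_map_mem_cone w' hw'.2 (hinv s hs)
      rwa [map_neg, neg_neg] at this
    rw [h.minReps_self] at h1
    exact mul_inv_eq_one.1 h1
  have hset : descSet I I = {w} := Set.eq_singleton_iff_unique_mem.2 ⟨hw, huniq⟩
  ext k
  rw [lenSeries, PowerSeries.coeff_mk, hset, PowerSeries.coeff_X_pow]
  split_ifs with hk
  · have : {x | x ∈ ({w} : Set (LorentzSpace ≃ₗ[ℝ] LorentzSpace)) ∧ len I x = k} = {w} := by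
      ext x
      constructor
      · exact fun h => h.1
      · rintro rfl
        exact ⟨rfl, hk.symm⟩
    rw [this]; simp
  · have : {x | x ∈ ({w} : Set (LorentzSpace ≃ₗ[ℝ] LorentzSpace)) ∧ len I x = k} = ∅ := by
      rw [Set.eq_empty_iff_forall_notMem]
      rintro x ⟨rfl, h0⟩
      exact hk h0.symm
    rw [this]; simp

end IsBase

end CoxeterDomino

end

/-! ### Explicit terms of the finite parabolic subgroups -/

noncomputable section

namespace CoxeterDomino

/-! ## Longest elements of finite parabolic subgroups -/

/-- Twice the cosine of `π / 5`, the golden ratio. -/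
def phi : ℝ := 2 * Real.cos (Real.pi / 5)

theorem phi_sq : phi ^ 2 = phi + 1 := by
  have h5 : Real.sqrt 5 ^ 2 = 5 := Real.sq_sqrt (by norm_num)
  rw [phi, Real.cos_pi_div_five]
  linear_combination h5 / 4

theorem phi_pos : 0 < phi := by
  rw [phi, Real.cos_pi_div_five]; positivity

/-- The real number represented by a pair of integers in the basis `1, phi`. -/
def golden (p : ℤ × ℤ) : ℝ := p.1 + p.2 * phi

/-- Multiplication of golden integers. -/
def goldenMul (p q : ℤ × ℤ) : ℤ × ℤ :=
  (p.1 * q.1 + p.2 * q.2, p.1 * q.2 + p.2 * q.1 + p.2 * q.2)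

theorem golden_mul (p q : ℤ × ℤ) : golden (goldenMul p q) = golden p * golden q := by
  simp only [golden, goldenMul]
  push_cast
  linear_combination -(p.2 * q.2 : ℝ) * phi_sq

theorem golden_add (p q : ℤ × ℤ) : golden (p + q) = golden p + golden q := by
  simp only [golden, Prod.fst_add, Prod.snd_add]
  push_cast
  ring

theorem golden_neg (p : ℤ × ℤ) : golden (-p) = -golden p := by
  simp only [golden, Prod.fst_neg, Prod.snd_neg]
  push_cast
  ring

/-- Nonnegative coordinates are only sufficient, but they reduce the positivity of roots to integer
comparisons that `decide` can evaluate. -/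
theorem golden_nonneg {p : ℤ × ℤ} (h1 : 0 ≤ p.1) (h2 : 0 ≤ p.2) : 0 ≤ golden p := by
  have h1' : (0 : ℝ) ≤ p.1 := by exact_mod_cast h1
  have h2' : (0 : ℝ) ≤ p.2 := by exact_mod_cast h2
  have := phi_pos
  rw [golden]; positivity

section Words

variable {r : ℕ}

/-- The coordinates of the images of the simple roots under `w * s`, computed from those under
`w`; the matrix `m` holds the negatives of the doubled inner products. -/
def stepCoord (m : Fin r → Fin r → ℤ × ℤ) (s : Fin r) (S : Fin r → Fin r → ℤ × ℤ) :
    Fin r → Fin r → ℤ × ℤ :=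
  fun j k => if j = s then -S s k else S j k + goldenMul (m s j) (S s k)

/-- The coordinates of the images of the simple roots under a word, read from right to left. -/
def wordCoord (m : Fin r → Fin r → ℤ × ℤ) : List (Fin r) → Fin r → Fin r → ℤ × ℤ
  | [] => fun j k => if j = k then (1, 0) else (0, 0)
  | s :: l => stepCoord m s (wordCoord m l)

/-- A sufficient condition for a word to be reduced. -/
def IsReducedWord (m : Fin r → Fin r → ℤ × ℤ) : List (Fin r) → Prop
  | [] => True
  | s :: l => IsReducedWord m l ∧ ∀ k, 0 ≤ (wordCoord m l s k).1 ∧ 0 ≤ (wordCoord m l s k).2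

instance decidableIsReducedWord (m : Fin r → Fin r → ℤ × ℤ) :
    (l : List (Fin r)) → Decidable (IsReducedWord m l)
  | [] => isTrue trivial
  | _ :: l =>
    have := decidableIsReducedWord m l
    inferInstanceAs (Decidable (_ ∧ _))

/-- A reduced word whose element sends all simple roots to negative roots. -/
def IsLongestWord (m : Fin r → Fin r → ℤ × ℤ) (l : List (Fin r)) : Prop :=
  IsReducedWord m l ∧ ∀ j k, (wordCoord m l j k).1 ≤ 0 ∧ (wordCoord m l j k).2 ≤ 0

instance (m : Fin r → Fin r → ℤ × ℤ) (l : List (Fin r)) : Decidable (IsLongestWord m l) :=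
  inferInstanceAs (Decidable (_ ∧ _))

theorem sum_golden_mem_cone {I : Finset LorentzSpace} {α : Fin r → LorentzSpace}
    (hα : ∀ i, α i ∈ I) {c : Fin r → ℤ × ℤ} (hc : ∀ k, 0 ≤ (c k).1 ∧ 0 ≤ (c k).2) :
    ∑ k, golden (c k) • α k ∈ cone I :=
  sum_mem_cone _ _ fun k _ => smul_mem_cone (golden_nonneg (hc k).1 (hc k).2) (subset_cone (hα k))

/-- Each new letter meets a root that is still positive, so the length grows by exactly one. The
roots `α` may be linearly dependent: the coordinates are merely one valid expression. -/
theorem IsBase.exists_of_isReducedWord {I : Finset LorentzSpace} (h : IsBase I)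
    {α : Fin r → LorentzSpace} (hα : ∀ i, α i ∈ I) {m : Fin r → Fin r → ℤ × ℤ}
    (hm : ∀ i j, i ≠ j → -2 * lor (α i) (α j) = golden (m i j)) (l : List (Fin r))
    (hl : IsReducedWord m l) : ∃ w ∈ reflGroup I, len I w = l.length ∧
      ∀ j, w (α j) = ∑ k, golden (wordCoord m l j k) • α k := by
  induction l with
  | nil =>
    refine ⟨1, one_mem _, len_one I, fun j => ?_⟩
    have : ∀ k, golden (wordCoord m [] j k) • α k = if j = k then α k else 0 := by
      intro k
      by_cases hjk : j = k <;> simp [wordCoord, hjk, golden]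
    simp [this]
  | cons s l ih =>
    obtain ⟨w, hw, hlen, hcoord⟩ := ih hl.1
    refine ⟨w * refl (α s), h.mul_refl_mem hw (hα s), ?_, fun j => ?_⟩
    · rw [h.len_mul_refl_of_mem hw (hα s), hlen, List.length_cons]
      rw [hcoord]
      exact sum_golden_mem_cone hα hl.2
    · have hu := h.unit _ (hα s)
      rw [LinearEquiv.mul_apply]
      by_cases hjs : j = s
      · subst hjs
        rw [refl_self hu, map_neg, hcoord, ← Finset.sum_neg_distrib]
        refine Finset.sum_congr rfl fun k _ => ?_
        simp [wordCoord, stepCoord, golden_neg]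
      · rw [refl_apply hu, map_sub, map_smul, hcoord, hcoord, Finset.smul_sum,
          ← Finset.sum_sub_distrib]
        refine Finset.sum_congr rfl fun k _ => ?_
        simp only [wordCoord, stepCoord, if_neg hjs, golden_add, golden_mul,
          ← hm s j (Ne.symm hjs), lor_comm (α s)]
        module

theorem IsBase.exists_longest {I : Finset LorentzSpace} (h : IsBase I)
    {α : Fin r → LorentzSpace} (hα : ∀ i, α i ∈ I) (hI : ∀ u ∈ I, ∃ i, α i = u)
    (m : Fin r → Fin r → ℤ × ℤ)
    (hm : ∀ i j, i ≠ j → -2 * lor (α i) (α j) = golden (m i j)) (l : List (Fin r))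
    (hl : IsLongestWord m l) : ∃ w ∈ descSet I I, len I w = l.length := by
  obtain ⟨w, hw, hlen, hcoord⟩ := h.exists_of_isReducedWord hα hm l hl.1
  refine ⟨w, ⟨hw, fun s hs => ?_⟩, hlen⟩
  obtain ⟨j, rfl⟩ := hI s hs
  rw [hcoord, ← Finset.sum_neg_distrib]
  have : ∑ k, golden (-wordCoord m l j k) • α k ∈ cone I :=
    sum_golden_mem_cone hα fun k => by simpa using hl.2 j k
  simpa [golden_neg] using this

end Words

/-! ## Parabolic subgroups of rank at most three -/

/-- The variable of the growth series. -/
abbrev tt : SeriesField := toField PowerSeries.X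

theorem toField_ne_zero {f : PowerSeries ℤ} (h : PowerSeries.constantCoeff f = 1) :
    toField f ≠ 0 := by
  rw [Ne, map_eq_zero_iff _ toField_injective]
  rintro rfl
  simp at h

theorem IsBase.mul_invGrowth_eq {I : Finset LorentzSpace} (h : IsBase I)
    {w : LorentzSpace ≃ₗ[ℝ] LorentzSpace} (hw : w ∈ descSet I I) :
    invTerm I = (-1) ^ I.card * tt ^ len I w * invGrowth I := by
  rw [invTerm, h.lenSeries_descSet_self hw, map_pow]

theorem cyc2_ne_zero : (1 + tt) ≠ 0 := by
  have := toField_ne_zero (f := 1 + PowerSeries.X) (by simp)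
  simpa using this

theorem cyc3_ne_zero : (1 + tt + tt ^ 2) ≠ 0 := by
  have := toField_ne_zero (f := 1 + PowerSeries.X + PowerSeries.X ^ 2) (by simp)
  simpa using this

theorem cyc4_ne_zero : (1 + tt ^ 2) ≠ 0 := by
  have := toField_ne_zero (f := 1 + PowerSeries.X ^ 2) (by simp)
  simpa using this

theorem cyc5_ne_zero : (1 + tt + tt ^ 2 + tt ^ 3 + tt ^ 4) ≠ 0 := by
  have := toField_ne_zero
    (f := 1 + PowerSeries.X + PowerSeries.X ^ 2 + PowerSeries.X ^ 3 + PowerSeries.X ^ 4) (by simp)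
  simpa using this

theorem cyc6_ne_zero : (1 - tt + tt ^ 2) ≠ 0 := by
  have := toField_ne_zero (f := 1 - PowerSeries.X + PowerSeries.X ^ 2) (by simp)
  simpa using this

theorem cyc10_ne_zero : (1 - tt + tt ^ 2 - tt ^ 3 + tt ^ 4) ≠ 0 := by
  have := toField_ne_zero
    (f := 1 - PowerSeries.X + PowerSeries.X ^ 2 - PowerSeries.X ^ 3 + PowerSeries.X ^ 4) (by simp)
  simpa using this

theorem one_sub_tt_pow_ne_zero {m : ℕ} (hm : m ≠ 0) : (1 - tt ^ m) ≠ 0 := by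
  have := toField_ne_zero (f := 1 - PowerSeries.X ^ m) (by simp [hm])
  simpa using this

theorem one_add_tt_pow_ne_zero {m : ℕ} (hm : m ≠ 0) : (1 + tt ^ m) ≠ 0 := by
  have := toField_ne_zero (f := 1 + PowerSeries.X ^ m) (by simp [hm])
  simpa using this

namespace IsBase

theorem invTerm_empty (h : IsBase ∅) : invTerm ∅ = 1 := by
  have h1 : (1 : LorentzSpace ≃ₗ[ℝ] LorentzSpace) ∈ descSet ∅ ∅ := ⟨one_mem _, by simp⟩
  have h2 := h.lenSeries_descSet_self h1
  have h3 : descSet ∅ ∅ = (reflGroup ∅ : Set (LorentzSpace ≃ₗ[ℝ] LorentzSpace)) := by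
    ext w; simp [descSet]
  have h4 : growth ∅ = 1 := by rw [growth, ← h3, h2, len_one, pow_zero]
  rw [invTerm, invGrowth, h4, h2, len_one]
  simp

variable {u v w : LorentzSpace}

theorem powerset_singleton (u : LorentzSpace) :
    ({u} : Finset LorentzSpace).powerset = {∅, {u}} := by
  ext I; simp [Finset.subset_singleton_iff]

theorem invTerm_singleton (h : IsBase {u}) : invTerm {u} = -tt / (1 + tt) := by
  obtain ⟨x, hx, hl⟩ := h.exists_longest (α := ![u]) (by simp) (by simp)
    (fun _ _ => (0, 0)) (by intro i j hij; exact absurd (Subsingleton.elim i j) hij) [0] (by decide)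
  have h1 := h.mul_invGrowth_eq hx
  have h2 := h.invGrowth_eq_sum
  rw [powerset_singleton, Finset.sum_pair (Finset.singleton_ne_empty _).symm, (h.mono (by simp)).invTerm_empty] at h2
  rw [hl] at h1
  have := cyc2_ne_zero
  simp only [Finset.card_singleton, List.length_singleton, pow_one] at h1
  rw [eq_div_iff this]
  linear_combination h1 + tt * (-h2)

theorem sum_powerset_pair {f : Finset LorentzSpace → SeriesField} (huv : u ≠ v) :
    ∑ I ∈ ({u, v} : Finset LorentzSpace).powerset, f I = f ∅ + f {u} + f {v} + f {u, v} := by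
  rw [Finset.sum_powerset_insert (by simpa using huv), powerset_singleton,
    Finset.sum_pair (Finset.singleton_ne_empty _).symm, Finset.sum_pair (Finset.singleton_ne_empty _).symm]
  simp only [insert_empty_eq]
  ring

theorem sum_powerset_triple {f : Finset LorentzSpace → SeriesField} (huv : u ≠ v) (huw : u ≠ w)
    (hvw : v ≠ w) :
    ∑ I ∈ ({u, v, w} : Finset LorentzSpace).powerset, f I =
      f ∅ + f {u} + f {v} + f {w} + f {u, v} + f {u, w} + f {v, w} + f {u, v, w} := by
  rw [Finset.sum_powerset_insert (by simpa using ⟨huv, huw⟩), sum_powerset_pair hvw,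
    sum_powerset_pair hvw]
  simp only [insert_empty_eq]
  ring

/-- The longest element gives the top term as `t ^ m` times the inverse growth series, which is
itself the sum of the lower terms and this top term. Solving this linear equation determines it; no
enumeration of the group is needed. -/
theorem invTerm_pair_of_longest (h : IsBase {u, v}) (huv : u ≠ v) {m : ℕ} (hm : m ≠ 0)
    (hl : ∃ x ∈ descSet {u, v} {u, v}, len {u, v} x = m) :
    invTerm {u, v} = tt ^ m * (1 - tt) / ((1 + tt) * (1 - tt ^ m)) := by
  obtain ⟨x, hx, hl⟩ := hl
  have h1 := h.mul_invGrowth_eq hx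
  have h2 := h.invGrowth_eq_sum
  rw [sum_powerset_pair huv, (h.mono (by simp)).invTerm_empty,
    (h.mono (by simp)).invTerm_singleton, (h.mono (by simp)).invTerm_singleton] at h2
  rw [hl, Finset.card_pair huv] at h1
  have h3 := cyc2_ne_zero
  have h4 := one_sub_tt_pow_ne_zero hm
  rw [eq_div_iff (mul_ne_zero h3 h4)]
  field_simp at h2
  linear_combination (1 + tt) * h1 + tt ^ m * h2

/-- The same linear equation as in rank two; the sign `(-1) ^ 3` turns the factor `1 - t ^ m` into
`1 + t ^ m`. -/
theorem invTerm_triple_of_longest (h : IsBase {u, v, w}) (huv : u ≠ v) (huw : u ≠ w)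
    (hvw : v ≠ w) {m : ℕ} (hm : m ≠ 0)
    (hl : ∃ x ∈ descSet {u, v, w} {u, v, w}, len {u, v, w} x = m) :
    invTerm {u, v, w} = -tt ^ m * (1 - 3 * tt / (1 + tt) + invTerm {u, v} + invTerm {u, w} +
      invTerm {v, w}) / (1 + tt ^ m) := by
  obtain ⟨x, hx, hl⟩ := hl
  have h1 := h.mul_invGrowth_eq hx
  have h2 := h.invGrowth_eq_sum
  rw [sum_powerset_triple huv huw hvw, (h.mono (by simp)).invTerm_empty,
    (h.mono (by simp)).invTerm_singleton, (h.mono (by simp)).invTerm_singleton,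
    (h.mono (by simp)).invTerm_singleton] at h2
  rw [hl, Finset.card_eq_three.2 ⟨u, v, w, huv, huw, hvw, rfl⟩] at h1
  have h3 := cyc2_ne_zero
  have h4 := one_add_tt_pow_ne_zero hm
  rw [eq_div_iff h4]
  linear_combination h1 + -tt ^ m * h2

theorem longest_pair (h : IsBase {u, v}) (c : ℤ × ℤ) (hc : -2 * lor u v = golden c)
    (l : List (Fin 2))
    (hl : IsLongestWord (r := 2) (fun _ _ => c) l) :
    ∃ x ∈ descSet {u, v} {u, v}, len {u, v} x = l.length := by
  refine h.exists_longest (α := ![u, v]) ?_ ?_ _ ?_ l hl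
  · intro i; fin_cases i <;> simp
  · intro x hx
    rcases Finset.mem_insert.1 hx with rfl | hx
    · exact ⟨0, rfl⟩
    · exact ⟨1, (Finset.mem_singleton.1 hx).symm⟩
  · intro i j hij
    fin_cases i <;> fin_cases j
    · exact absurd rfl hij
    · exact hc
    · change -2 * lor v u = _
      rw [lor_comm]; exact hc
    · exact absurd rfl hij

theorem longest_triple (h : IsBase {u, v, w}) (a b c : ℤ × ℤ) (ha : -2 * lor u v = golden a)
    (hb : -2 * lor u w = golden b) (hc : -2 * lor v w = golden c) (l : List (Fin 3))
    (hl : IsLongestWord (r := 3) ![![0, a, b], ![a, 0, c], ![b, c, 0]] l) :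
    ∃ x ∈ descSet {u, v, w} {u, v, w}, len {u, v, w} x = l.length := by
  refine h.exists_longest (α := ![u, v, w]) ?_ ?_ _ ?_ l hl
  · intro i; fin_cases i <;> simp
  · intro x hx
    rcases Finset.mem_insert.1 hx with rfl | hx
    · exact ⟨0, rfl⟩
    rcases Finset.mem_insert.1 hx with rfl | hx
    · exact ⟨1, rfl⟩
    · exact ⟨2, (Finset.mem_singleton.1 hx).symm⟩
  · intro i j hij
    fin_cases i <;> fin_cases j
    · exact absurd rfl hij
    · exact ha
    · exact hb
    · change -2 * lor v u = _
      rw [lor_comm]; exact ha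
    · exact absurd rfl hij
    · exact hc
    · change -2 * lor w u = _
      rw [lor_comm]; exact hb
    · change -2 * lor w v = _
      rw [lor_comm]; exact hc
    · exact absurd rfl hij

theorem ne_of_lor_ne_one (h : IsBase {u, v}) (huv : lor u v ≠ 1) : u ≠ v := by
  rintro rfl
  exact huv (h.unit u (by simp))

theorem invTerm_pair_two (h : IsBase {u, v}) (huv : lor u v = 0) :
    invTerm {u, v} = tt ^ 2 / (1 + tt) ^ 2 := by
  have hl := h.longest_pair (0, 0) (by simp [golden, huv]) [0, 1] (by decide)
  rw [h.invTerm_pair_of_longest (h.ne_of_lor_ne_one (by rw [huv]; norm_num)) (by simp) hl]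
  have h1 := cyc2_ne_zero
  have h2 := one_sub_tt_pow_ne_zero (m := 2) two_ne_zero
  simp only [List.length_cons, List.length_nil]
  rw [div_eq_div_iff (by positivity) (by positivity)]
  ring

theorem invTerm_pair_three (h : IsBase {u, v}) (huv : lor u v = -(1 / 2)) :
    invTerm {u, v} = tt ^ 3 / ((1 + tt) * (1 + tt + tt ^ 2)) := by
  have hl := h.longest_pair (1, 0) (by simp [golden, huv]) [0, 1, 0] (by decide)
  rw [h.invTerm_pair_of_longest (h.ne_of_lor_ne_one (by rw [huv]; norm_num)) (by simp) hl]
  have h1 := cyc2_ne_zero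
  have h3 := cyc3_ne_zero
  have h2 := one_sub_tt_pow_ne_zero (m := 3) three_ne_zero
  simp only [List.length_cons, List.length_nil]
  rw [div_eq_div_iff (mul_ne_zero h1 h2) (mul_ne_zero h1 h3)]
  ring

theorem invTerm_pair_five (h : IsBase {u, v}) (huv : lor u v = -Real.cos (Real.pi / 5)) :
    invTerm {u, v} = tt ^ 5 / ((1 + tt) * (1 + tt + tt ^ 2 + tt ^ 3 + tt ^ 4)) := by
  have hl := h.longest_pair (0, 1) (by simp [golden, huv, phi]) [0, 1, 0, 1, 0] (by decide)
  have hne : lor u v ≠ 1 := by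
    have := phi_pos
    rw [phi] at this
    rw [huv]; intro h; linarith
  rw [h.invTerm_pair_of_longest (h.ne_of_lor_ne_one hne) (by simp) hl]
  have h1 := cyc2_ne_zero
  have h3 := cyc5_ne_zero
  have h2 := one_sub_tt_pow_ne_zero (m := 5) (by norm_num)
  simp only [List.length_cons, List.length_nil]
  rw [div_eq_div_iff (mul_ne_zero h1 h2) (mul_ne_zero h1 h3)]
  ring

theorem invTerm_triple_orthogonal (h : IsBase {u, v, w}) (huv : lor u v = 0) (huw : lor u w = 0)
    (hvw : lor v w = 0) : invTerm {u, v, w} = -tt ^ 3 / (1 + tt) ^ 3 := by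
  have huv' : IsBase {u, v} := h.mono (by intro x; simp; tauto)
  have huw' : IsBase {u, w} := h.mono (by intro x; simp; tauto)
  have hvw' : IsBase {v, w} := h.mono (by intro x; simp; tauto)
  have hl := h.longest_triple (0, 0) (0, 0) (0, 0) (by simp [golden, huv]) (by simp [golden, huw])
    (by simp [golden, hvw]) [0, 1, 2] (by decide)
  rw [h.invTerm_triple_of_longest (huv'.ne_of_lor_ne_one (by rw [huv]; norm_num))
    (huw'.ne_of_lor_ne_one (by rw [huw]; norm_num)) (hvw'.ne_of_lor_ne_one (by rw [hvw]; norm_num))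
    (by simp) hl, huv'.invTerm_pair_two huv, huw'.invTerm_pair_two huw, hvw'.invTerm_pair_two hvw]
  have h1 := cyc2_ne_zero
  have h2 := one_add_tt_pow_ne_zero (m := 3) three_ne_zero
  simp only [List.length_cons, List.length_nil, zero_add, Nat.reduceAdd]
  field_simp
  ring

/-- The group of type `A₃`. -/
theorem invTerm_triple_A (h : IsBase {u, v, w}) (huv : lor u v = -(1 / 2))
    (huw : lor u w = 0) (hvw : lor v w = -(1 / 2)) :
    invTerm {u, v, w} = -tt ^ 6 / ((1 + tt) ^ 2 * (1 + tt + tt ^ 2) * (1 + tt ^ 2)) := by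
  have huv' : IsBase {u, v} := h.mono (by intro x; simp; tauto)
  have huw' : IsBase {u, w} := h.mono (by intro x; simp; tauto)
  have hvw' : IsBase {v, w} := h.mono (by intro x; simp; tauto)
  have hl := h.longest_triple (1, 0) (0, 0) (1, 0) (by simp [golden, huv]) (by simp [golden, huw])
    (by simp [golden, hvw]) [0, 1, 2, 0, 1, 0] (by decide)
  rw [h.invTerm_triple_of_longest (huv'.ne_of_lor_ne_one (by rw [huv]; norm_num))
    (huw'.ne_of_lor_ne_one (by rw [huw]; norm_num)) (hvw'.ne_of_lor_ne_one (by rw [hvw]; norm_num))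
    (by simp) hl, huv'.invTerm_pair_three huv, huw'.invTerm_pair_two huw,
    hvw'.invTerm_pair_three hvw]
  have h1 := cyc2_ne_zero
  have h3 := cyc3_ne_zero
  have h4 := cyc4_ne_zero
  have h2 := one_add_tt_pow_ne_zero (m := 6) (by norm_num)
  simp only [List.length_cons, List.length_nil, zero_add, Nat.reduceAdd]
  field_simp
  ring

/-- The group of type `H₃`. -/
theorem invTerm_triple_H (h : IsBase {u, v, w}) (huv : lor u v = -Real.cos (Real.pi / 5))
    (huw : lor u w = 0) (hvw : lor v w = -(1 / 2)) :
    invTerm {u, v, w} = -tt ^ 15 / ((1 + tt) ^ 3 * (1 + tt + tt ^ 2) * (1 - tt + tt ^ 2) *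
      (1 + tt + tt ^ 2 + tt ^ 3 + tt ^ 4) * (1 - tt + tt ^ 2 - tt ^ 3 + tt ^ 4)) := by
  have huv' : IsBase {u, v} := h.mono (by intro x; simp; tauto)
  have huw' : IsBase {u, w} := h.mono (by intro x; simp; tauto)
  have hvw' : IsBase {v, w} := h.mono (by intro x; simp; tauto)
  have hne : lor u v ≠ 1 := by
    have := phi_pos
    rw [phi] at this
    rw [huv]; intro h; linarith
  -- The longest element of `H₃` is the fifth power of a Coxeter element, of length 15.
  have hl := h.longest_triple (0, 1) (0, 0) (1, 0) (by simp [golden, huv, phi])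
    (by simp [golden, huw]) (by simp [golden, hvw])
    [0, 1, 2, 0, 1, 2, 0, 1, 2, 0, 1, 2, 0, 1, 2] (by decide +kernel)
  rw [h.invTerm_triple_of_longest (huv'.ne_of_lor_ne_one hne)
    (huw'.ne_of_lor_ne_one (by rw [huw]; norm_num)) (hvw'.ne_of_lor_ne_one (by rw [hvw]; norm_num))
    (by simp) hl, huv'.invTerm_pair_five huv, huw'.invTerm_pair_two huw,
    hvw'.invTerm_pair_three hvw]
  have h1 := cyc2_ne_zero
  have h3 := cyc3_ne_zero
  have h5 := cyc5_ne_zero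
  have h6 := cyc6_ne_zero
  have h10 := cyc10_ne_zero
  have h2 := one_add_tt_pow_ne_zero (m := 15) (by norm_num)
  simp only [List.length_cons, List.length_nil, zero_add, Nat.reduceAdd]
  field_simp
  ring

end IsBase

end CoxeterDomino

end

/-! ### Facets of hyperbolic polyhedra, and the determinant and cofactors of the Gram matrix -/

noncomputable section

namespace CoxeterDomino

/-! ## Timelike vectors and perturbation -/

/-- Timelike vectors in the open future cone. -/
def IsTime (z : LorentzSpace) : Prop :=
  lor z z < 0 ∧ 0 < z 4

theorem IsTime.future {z : LorentzSpace} (hz : IsTime z) : IsFuture z := ⟨hz.1.le, hz.2⟩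

theorem IsTime.of_mem {x : LorentzSpace} (hx : x ∈ hyperbolicSpace) : IsTime x :=
  ⟨by rw [hx.1]; norm_num, hx.2⟩

theorem IsTime.add_future {x z : LorentzSpace} (hx : IsTime x) (hz : IsFuture z) :
    IsTime (x + z) := by
  refine ⟨?_, by rw [Pi.add_apply]; exact add_pos hx.2 hz.2⟩
  have := lor_nonpos_of_future hx.future hz
  rw [lor_add_left, lor_add_right, lor_add_right, lor_comm z x]
  linarith [hx.1, hz.1]

theorem IsTime.add {x z : LorentzSpace} (hx : IsTime x) (hz : IsTime z) : IsTime (x + z) :=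
  hx.add_future hz.future

theorem IsTime.sum {ι : Type*} {s : Finset ι} (hs : s.Nonempty) {f : ι → LorentzSpace}
    (h : ∀ i ∈ s, IsTime (f i)) : IsTime (∑ i ∈ s, f i) :=
  Finset.sum_induction_nonempty f IsTime (fun _ _ => IsTime.add) hs h

theorem IsTime.exists_smul_mem {z : LorentzSpace} (hz : IsTime z) :
    ∃ a : ℝ, 0 < a ∧ a • z ∈ hyperbolicSpace := by
  have h1 : 0 < -lor z z := by linarith [hz.1]
  have h2 := Real.sq_sqrt h1.le
  have h3 := Real.sqrt_pos.2 h1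
  refine ⟨(Real.sqrt (-lor z z))⁻¹, inv_pos.2 h3, ?_, ?_⟩
  · rw [lor_smul_left, lor_smul_right]
    field_simp
    linarith
  · rw [Pi.smul_apply, smul_eq_mul]
    exact mul_pos (inv_pos.2 h3) hz.2

/-- Points at which strict linear inequalities hold can be moved in every direction. -/
theorem IsTime.perturb {y : LorentzSpace} (hy : IsTime y) {Φ : Finset LorentzSpace}
    (h : ∀ w ∈ Φ, lor y w < 0) (u : LorentzSpace) :
    ∃ ε : ℝ, 0 < ε ∧ IsTime (y + ε • u) ∧ ∀ w ∈ Φ, lor (y + ε • u) w < 0 := by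
  have hlin : ∀ w, lor y w < 0 → ∀ᶠ ε : ℝ in nhds 0, lor (y + ε • u) w < 0 := by
    intro w hw
    have hc : Continuous fun ε : ℝ => lor (y + ε • u) w := by
      simp only [lor_add_left, lor_smul_left]; fun_prop
    exact hc.continuousAt.eventually_lt continuousAt_const (by simpa using hw)
  have h1 : ∀ᶠ ε : ℝ in nhds 0, ∀ w ∈ Φ, lor (y + ε • u) w < 0 :=
    (Filter.eventually_all_finset Φ).2 fun w hw => hlin w (h w hw)
  have h2 : ∀ᶠ ε : ℝ in nhds 0, lor (y + ε • u) (y + ε • u) < 0 := by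
    have hc : Continuous fun ε : ℝ => lor (y + ε • u) (y + ε • u) := by
      simp only [lor_add_left, lor_smul_left, lor_add_right, lor_smul_right]; fun_prop
    exact hc.continuousAt.eventually_lt continuousAt_const (by simpa using hy.1)
  have h3 : ∀ᶠ ε : ℝ in nhds 0, 0 < (y + ε • u) 4 := by
    have hc : Continuous fun ε : ℝ => (y + ε • u) 4 := by
      simp only [Pi.add_apply, Pi.smul_apply]; fun_prop
    exact continuousAt_const.eventually_lt hc.continuousAt (by simpa using hy.2)
  obtain ⟨δ, hδ, hball⟩ := Metric.eventually_nhds_iff.1 (h1.and (h2.and h3))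
  have := @hball (δ / 2) (by
    rw [Real.dist_eq, sub_zero, abs_of_pos (half_pos hδ)]; linarith)
  exact ⟨δ / 2, half_pos hδ, ⟨this.2.1, this.2.2⟩, this.1⟩

theorem lor_smul_nonpos {a : ℝ} (ha : 0 < a) {x u : LorentzSpace} :
    lor (a • x) u ≤ 0 ↔ lor x u ≤ 0 := by
  rw [lor_smul_left, mul_nonpos_iff_pos_imp_nonpos]
  constructor
  · exact fun h => h.1 ha
  · exact fun h => ⟨fun _ => h, fun h' => ha.le⟩

theorem lor_smul_eq_zero {a : ℝ} (ha : 0 < a) {x u : LorentzSpace} :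
    lor (a • x) u = 0 ↔ lor x u = 0 := by
  rw [lor_smul_left, mul_eq_zero]
  exact ⟨fun h => h.resolve_left ha.ne', Or.inr⟩

/-! ## Facets of polyhedra -/

theorem lorForm_nondegenerate : lorForm.Nondegenerate :=
  ⟨fun _ h => eq_zero_of_lor_eq_zero h,
    fun x h => eq_zero_of_lor_eq_zero fun y => by rw [lor_comm]; exact h y⟩

/-- The form is nondegenerate on a space of dimension 5, so the span has dimension 4 exactly if its
orthogonal complement is a line, and `u` already lies in this complement. -/
theorem finrank_span_eq_four_iff {S : Set LorentzSpace} {u : LorentzSpace} (hu : u ≠ 0)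
    (hS : ∀ x ∈ S, lor x u = 0) : Module.finrank ℝ (Submodule.span ℝ S) = 4 ↔
      ∀ y, (∀ x ∈ S, lor x y = 0) → ∃ a : ℝ, y = a • u := by
  have h1 := LinearMap.BilinForm.finrank_orthogonal lorForm_nondegenerate
    (Submodule.span ℝ S)
  have h2 : Module.finrank ℝ LorentzSpace = 5 := by simp
  have h3 := Submodule.finrank_le (Submodule.span ℝ S)
  have hmem : ∀ y, y ∈ LinearMap.BilinForm.orthogonal lorForm (Submodule.span ℝ S) ↔ ∀ x ∈ S, lor x y = 0 := by
    intro y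
    rw [LinearMap.BilinForm.mem_orthogonal_iff]
    constructor
    · exact fun h x hx => h x (Submodule.subset_span hx)
    · intro h x hx
      refine Submodule.span_induction (p := fun x _ => lorForm x y = 0) h ?_ ?_ ?_ hx
      · simp
      · intro a b _ _ ha hb; rw [map_add, LinearMap.add_apply, ha, hb, add_zero]
      · intro c a _ ha; rw [map_smul, LinearMap.smul_apply, ha, smul_zero]
  have h4 : Module.finrank ℝ (Submodule.span ℝ S) = 4 ↔
      Module.finrank ℝ (LinearMap.BilinForm.orthogonal lorForm (Submodule.span ℝ S)) = 1 := by omega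
  rw [h4]
  have huo : u ∈ LinearMap.BilinForm.orthogonal lorForm (Submodule.span ℝ S) := (hmem u).2 hS
  constructor
  · intro h y hy
    obtain ⟨c, hc⟩ := (finrank_eq_one_iff_of_nonzero' (⟨u, huo⟩ :
      LinearMap.BilinForm.orthogonal lorForm (Submodule.span ℝ S)) (by simpa [Subtype.ext_iff] using hu)).1 h
      ⟨y, (hmem y).2 hy⟩
    exact ⟨c, by simpa [Subtype.ext_iff] using hc.symm⟩
  · intro h
    refine (finrank_eq_one_iff_of_nonzero' (⟨u, huo⟩ :
      LinearMap.BilinForm.orthogonal lorForm (Submodule.span ℝ S)) (by simpa [Subtype.ext_iff] using hu)).2 ?_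
    rintro ⟨y, hy⟩
    obtain ⟨a, rfl⟩ := h y ((hmem y).1 hy)
    exact ⟨a, rfl⟩

theorem ne_zero_of_unit {u : LorentzSpace} (hu : lor u u = 1) : u ≠ 0 := by
  rintro rfl
  rw [lor_zero_left] at hu
  exact zero_ne_one hu

theorem mem_facetNormals_iff {D : Set LorentzSpace} {u : LorentzSpace} :
    u ∈ facetNormals D ↔ lor u u = 1 ∧ (∀ x ∈ D, lor x u ≤ 0) ∧
      ∀ y, (∀ x ∈ D, lor x u = 0 → lor x y = 0) → ∃ a : ℝ, y = a • u := by
  refine and_congr_right fun hu => and_congr_right fun _ => ?_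
  rw [finrank_span_eq_four_iff (ne_zero_of_unit hu) fun x hx => hx.2]
  simp only [Set.mem_ofPred_eq, and_imp]

/-- The facet normals of a polyhedron are among its defining normals. -/
theorem facetNormals_polyhedron_subset {Φ : Finset LorentzSpace} (hΦ : IsBase Φ)
    (hne : Φ.Nonempty) : facetNormals (polyhedron ↑Φ) ⊆ ↑Φ := by
  intro u hu
  obtain ⟨hu1, hu2, hu3⟩ := mem_facetNormals_iff.1 hu
  obtain ⟨x₀, hx₀, hint⟩ := hΦ.interior
  by_contra hnot
  -- Otherwise `w` vanishes on the whole facet of `u`, so `w = ±u`; both signs are impossible. The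
  -- sum of the points found lies on the wall of `u` and strictly inside all walls of `Φ`.
  have hex : ∀ w ∈ Φ, ∃ x ∈ polyhedron ↑Φ, lor x u = 0 ∧ lor x w < 0 := by
    intro w hw
    by_contra hcon
    push Not at hcon
    obtain ⟨a, rfl⟩ := hu3 w fun x hx hxu => le_antisymm (hx.2 w hw) (hcon x hx hxu)
    have h1 := hΦ.unit _ hw
    rw [lor_smul_left, lor_smul_right, hu1, mul_one] at h1
    rcases mul_self_eq_one_iff.1 h1 with rfl | rfl
    · rw [one_smul] at hw; exact hnot hw
    · have h2 := hint _ hw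
      have h3 := hu2 x₀ ⟨hx₀, fun w hw => (hint w hw).le⟩
      rw [lor_smul_right] at h2
      linarith
  choose! f hf using hex
  have hy : IsTime (∑ w ∈ Φ, f w) := IsTime.sum hne fun w hw => IsTime.of_mem (hf w hw).1.1
  have hyw : ∀ w ∈ Φ, lor (∑ w ∈ Φ, f w) w < 0 := by
    intro w hw
    rw [lor_sum_left]
    exact Finset.sum_neg' (fun v hv => (hf v hv).1.2 w hw) ⟨w, hw, (hf w hw).2.2⟩
  have hyu : lor (∑ w ∈ Φ, f w) u = 0 := by
    rw [lor_sum_left]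
    exact Finset.sum_eq_zero fun w hw => (hf w hw).2.1
  -- A small push across the wall of `u` stays inside all walls of `Φ`, although the polyhedron lies
  -- on one side of `u`.
  obtain ⟨ε, hε, ht, hw⟩ := hy.perturb hyw u
  obtain ⟨a, ha, hmem⟩ := ht.exists_smul_mem
  have := hu2 _ ⟨hmem, fun w hw' => (lor_smul_nonpos ha).2 (hw w hw').le⟩
  rw [lor_smul_nonpos ha, lor_add_left, lor_smul_left, hyu, hu1] at this
  linarith

/-! ## The Gram matrix of the simplex -/

theorem gram_eq : gram = !![1, -(phi / 2), 0, -(1 / 2), 0;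
     -(phi / 2), 1, -(1 / 2), 0, -(1 / 2);
     0, -(1 / 2), 1, -(phi / 2), 0;
     -(1 / 2), 0, -(phi / 2), 1, -(1 / 2);
     0, -(1 / 2), 0, -(1 / 2), 1] := by
  have : phi / 2 = Real.cos (Real.pi / 5) := by rw [phi]; ring
  rw [gram, this]

/-- The adjugate of the Gram matrix. -/
def cofactors : Matrix (Fin 5) (Fin 5) ℝ :=
  (1 / 16 : ℝ) • !![2 - 5 * phi, 4 * phi, 2 + 7 * phi, 6 + 4 * phi, 3 + 4 * phi;
    4 * phi, 4 - 4 * phi, 6 + 4 * phi, 4 + 8 * phi, 4 + 2 * phi;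
    2 + 7 * phi, 6 + 4 * phi, 2 - 5 * phi, 4 * phi, 3 + 4 * phi;
    6 + 4 * phi, 4 + 8 * phi, 4 * phi, 4 - 4 * phi, 4 + 2 * phi;
    3 + 4 * phi, 4 + 2 * phi, 3 + 4 * phi, 4 + 2 * phi, 1 - 7 * phi]

theorem gram_det : gram.det = -(3 + 9 * phi) / 16 := by
  rw [gram_eq]
  simp [Matrix.det_succ_row_zero, Fin.sum_univ_succ, Fin.succAbove]
  linear_combination (1 / 16 * phi ^ 2 - 6 / 16 + 1 / 16 * phi) * phi_sq

theorem gram_mul_cofactors : gram * cofactors = gram.det • 1 := by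
  rw [gram_det, gram_eq, cofactors]
  ext i j
  fin_cases i <;> fin_cases j <;>
    simp [Matrix.mul_apply, Fin.sum_univ_succ] <;> nlinarith [phi_sq]

theorem phi_gt : (1.618 : ℝ) < phi := by
  nlinarith [phi_sq, phi_pos]

theorem phi_lt : phi < 1.619 := by
  nlinarith [phi_sq, phi_pos]

theorem gram_det_neg : gram.det < 0 := by
  rw [gram_det]; linarith [phi_pos]

theorem gram_adjugate : gram.adjugate = cofactors := by
  have h := congrArg (fun M => gram.adjugate * M) gram_mul_cofactors
  simp only [← Matrix.mul_assoc, Matrix.adjugate_mul, Matrix.smul_mul, Matrix.one_mul,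
    Matrix.mul_smul, Matrix.mul_one] at h
  exact (smul_right_injective _ gram_det_neg.ne h).symm

/-- Negative diagonal cofactors make the vertices ultraideal. The lower bound says that a truncating
hyperplane does not cross the opposite facet, since `lor (vertex e i) (e i)` is minus the square
root of `det / cofactors i i`. -/
theorem cofactors_diag (i : Fin 5) : gram.det < cofactors i i ∧ cofactors i i < 0 := by
  have h1 := phi_gt
  have h2 := phi_lt
  rw [gram_det, cofactors]
  fin_cases i <;> simp <;> constructor <;> linarith

/-- These inequalities say that distinct truncating hyperplanes are disjoint: their normals have
product below `-1`. -/
theorem cofactors_off {i j : Fin 5} (h : i ≠ j) : 0 < cofactors i j ∧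
    cofactors i i * cofactors j j < cofactors i j ^ 2 := by
  have h1 := phi_gt
  have h2 := phi_lt
  have h3 := phi_sq
  have h4 := phi_pos
  rw [cofactors]
  fin_cases i <;> fin_cases j <;> first | exact absurd rfl h | skip
  all_goals
    simp
    constructor
    · positivity
    · nlinarith

theorem cofactors_symm (i j : Fin 5) : cofactors i j = cofactors j i := by
  rw [cofactors]
  fin_cases i <;> fin_cases j <;> rfl

end CoxeterDomino

end

/-! ### The truncated simplex and its facets -/

noncomputable section

namespace CoxeterDomino

/-! ## Simplices with the prescribed Gram matrix -/

/-- The vectors `e` have the prescribed Gram matrix. -/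
def HasGram (e : Fin 5 → LorentzSpace) : Prop :=
  ∀ i j, lor (e i) (e j) = gram i j

/-- The point of the edge through the ultraideal vertices `i` and `k` on the hyperplane truncating
the vertex `i`, up to normalization. -/
def edgePt (e : Fin 5 → LorentzSpace) (i k : Fin 5) : LorentzSpace :=
  vertex e k - lor (vertex e i) (vertex e k) • vertex e i

namespace HasGram

variable {e : Fin 5 → LorentzSpace} {i j k : Fin 5}

theorem vertexScale_sq (i : Fin 5) : 0 < Real.sqrt (gram.adjugate i i * gram.det) ∧
    Real.sqrt (gram.adjugate i i * gram.det) ^ 2 = cofactors i i * gram.det := by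
  have h : 0 < gram.adjugate i i * gram.det := by
    rw [gram_adjugate]
    exact mul_pos_of_neg_of_neg (cofactors_diag i).2 gram_det_neg
  exact ⟨Real.sqrt_pos.2 h, by rw [Real.sq_sqrt h.le, gram_adjugate]⟩

theorem lor_vertex_left (e : Fin 5 → LorentzSpace) (i : Fin 5) (x : LorentzSpace) :
    lor (vertex e i) x =
      (Real.sqrt (gram.adjugate i i * gram.det))⁻¹ * ∑ k, cofactors i k * lor (e k) x := by
  rw [vertex, lor_smul_left, lor_sum_left, gram_adjugate]
  simp only [lor_smul_left]

theorem lor_vertex_e' (h : HasGram e) (i j : Fin 5) : lor (vertex e i) (e j) =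
    (Real.sqrt (gram.adjugate i i * gram.det))⁻¹ * if i = j then gram.det else 0 := by
  have h1 : cofactors * gram = gram.det • 1 := by rw [← gram_adjugate, Matrix.adjugate_mul]
  have h2 := congrFun (congrFun h1 i) j
  rw [Matrix.mul_apply, Matrix.smul_apply, Matrix.one_apply, smul_eq_mul, mul_ite, mul_one,
    mul_zero] at h2
  rw [lor_vertex_left, ← h2]
  simp only [h _ _]

theorem lor_vertex_e (h : HasGram e) (hij : i ≠ j) : lor (vertex e i) (e j) = 0 := by
  rw [h.lor_vertex_e', if_neg hij, mul_zero]

theorem lor_vertex_e_self (h : HasGram e) (i : Fin 5) : lor (vertex e i) (e i) ≤ -1 := by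
  rw [h.lor_vertex_e', if_pos rfl]
  obtain ⟨h1, h2⟩ := vertexScale_sq i
  obtain ⟨h3, -⟩ := cofactors_diag i
  have h4 := gram_det_neg
  rw [inv_mul_le_iff₀ h1]
  have h5 : Real.sqrt (gram.adjugate i i * gram.det) ≤ -gram.det :=
    abs_le_of_sq_le_sq (by rw [h2]; nlinarith) (by linarith)
      |> le_trans (le_abs_self _)
  linarith

theorem lor_vertex_vertex (h : HasGram e) (i j : Fin 5) : lor (vertex e i) (vertex e j) =
    (Real.sqrt (gram.adjugate i i * gram.det))⁻¹ * (Real.sqrt (gram.adjugate j j * gram.det))⁻¹ *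
      (cofactors i j * gram.det) := by
  rw [lor_comm, lor_vertex_left, Finset.sum_eq_single i]
  · rw [lor_comm, h.lor_vertex_e', if_pos rfl, cofactors_symm j i]
    ring
  · intro k _ hk
    rw [lor_comm, h.lor_vertex_e (Ne.symm hk), mul_zero]
  · simp

theorem lor_vertex_self (h : HasGram e) (i : Fin 5) : lor (vertex e i) (vertex e i) = 1 := by
  obtain ⟨h1, h2⟩ := vertexScale_sq i
  rw [h.lor_vertex_vertex, ← h2]
  field_simp

theorem lor_vertex_lt (h : HasGram e) (hij : i ≠ j) :
    lor (vertex e i) (vertex e j) < -1 := by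
  obtain ⟨h1, h2⟩ := vertexScale_sq i
  obtain ⟨h3, h4⟩ := vertexScale_sq j
  obtain ⟨h5, h6⟩ := cofactors_off hij
  have h7 := gram_det_neg
  rw [h.lor_vertex_vertex, ← mul_inv, inv_mul_lt_iff₀ (mul_pos h1 h3)]
  have h8 : Real.sqrt (gram.adjugate i i * gram.det) * Real.sqrt (gram.adjugate j j * gram.det) <
      -(cofactors i j * gram.det) := by
    refine lt_of_pow_lt_pow_left₀ 2 (by nlinarith) ?_
    rw [mul_pow, h2, h4]
    have h9 : 0 < gram.det ^ 2 := sq_pos_of_ne_zero h7.ne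
    calc _ = (cofactors i i * cofactors j j) * gram.det ^ 2 := by ring
      _ < cofactors i j ^ 2 * gram.det ^ 2 := by gcongr
      _ = _ := by ring
  linarith

theorem unit (h : HasGram e) (i : Fin 5) : lor (e i) (e i) = 1 := by
  rw [h, gram]
  fin_cases i <;> rfl

theorem lor_e_e (h : HasGram e) (hij : i ≠ j) :
    lor (e i) (e j) = 0 ∨ lor (e i) (e j) = -(1 / 2) ∨
      lor (e i) (e j) = -Real.cos (Real.pi / 5) := by
  rw [h, gram]
  fin_cases i <;> fin_cases j <;> first | exact absurd rfl hij | simp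

theorem lor_e_e_gt (h : HasGram e) (i j : Fin 5) : -1 < lor (e i) (e j) := by
  have h1 := phi_lt
  rw [phi] at h1
  by_cases hij : i = j
  · rw [hij, h.unit]; norm_num
  · rcases h.lor_e_e hij with h' | h' | h' <;> rw [h'] <;> linarith

theorem e_injective (h : HasGram e) : Function.Injective e := by
  intro i j hij
  by_contra hne
  have h1 := h.unit i
  nth_rewrite 2 [hij] at h1
  have h2 := phi_pos
  rw [phi] at h2
  rcases h.lor_e_e hne with h' | h' | h' <;> rw [h'] at h1 <;> linarith

theorem vertex_injective (h : HasGram e) : Function.Injective (vertex e) := by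
  intro i j hij
  by_contra hne
  have h1 := h.lor_vertex_self i
  nth_rewrite 2 [hij] at h1
  linarith [h.lor_vertex_lt hne]

theorem vertex_ne_e (h : HasGram e) (i j : Fin 5) : vertex e i ≠ e j := by
  intro he
  have h1 := h.unit j
  nth_rewrite 1 [← he] at h1
  by_cases hij : i = j
  · subst hij; linarith [h.lor_vertex_e_self i]
  · rw [h.lor_vertex_e hij] at h1; exact zero_ne_one h1

/-- Coordinates with respect to the ultraideal vertices. -/
theorem eq_sum_vertex (h : HasGram e) (x : LorentzSpace) :
    x = ∑ k, (lor x (e k) / lor (vertex e k) (e k)) • vertex e k := by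
  have hneg : ∀ k, lor (vertex e k) (e k) ≠ 0 := fun k hk => by
    linarith [h.lor_vertex_e_self k]
  have hsum : ∀ (c : Fin 5 → ℝ) (j : Fin 5), lor (∑ k, c k • vertex e k) (e j) =
      c j * lor (vertex e j) (e j) := by
    intro c j
    rw [lor_sum_left, Finset.sum_eq_single j, lor_smul_left]
    · intro k _ hk
      rw [lor_smul_left, h.lor_vertex_e hk, mul_zero]
    · simp
  have hli : LinearIndependent ℝ (vertex e) := by
    rw [Fintype.linearIndependent_iff]
    intro c hc j
    have := hsum c j
    rw [hc, lor_zero_left] at this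
    exact (mul_eq_zero.1 this.symm).resolve_right (hneg j)
  have hspan := hli.span_eq_top_of_card_eq_finrank' (by simp)
  have hx : x ∈ Submodule.span ℝ (Set.range (vertex e)) := by rw [hspan]; trivial
  obtain ⟨c, rfl⟩ := (Submodule.mem_span_range_iff_exists_fun ℝ).1 hx
  refine Finset.sum_congr rfl fun k _ => ?_
  rw [hsum, mul_div_cancel_right₀ _ (hneg k)]

theorem eq_zero_of_lor_e (h : HasGram e) {x : LorentzSpace} (hx : ∀ j, lor x (e j) = 0) :
    x = 0 := by
  rw [h.eq_sum_vertex x]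
  simp [hx]

theorem eq_zero_of_lor_vertex (h : HasGram e) {x : LorentzSpace}
    (hx : ∀ j, lor x (vertex e j) = 0) : x = 0 :=
  eq_zero_of_lor_eq_zero fun y => by
    rw [h.eq_sum_vertex y, lor_sum_right]
    simp [lor_smul_right, hx]

/-! ### Points on edges -/

theorem lor_edgePt_left (i k : Fin 5) (x : LorentzSpace) : lor (edgePt e i k) x =
    lor (vertex e k) x - lor (vertex e i) (vertex e k) * lor (vertex e i) x := by
  rw [edgePt, lor_sub_left, lor_smul_left]

theorem lor_edgePt_vertex_self (h : HasGram e) (i k : Fin 5) :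
    lor (edgePt e i k) (vertex e i) = 0 := by
  rw [lor_edgePt_left, h.lor_vertex_self, lor_comm (vertex e k)]; ring

theorem lor_edgePt_vertex (h : HasGram e) (hik : i ≠ k) (hij : i ≠ j) :
    lor (edgePt e i k) (vertex e j) < 0 := by
  rw [lor_edgePt_left]
  have h1 := h.lor_vertex_lt hik
  have h2 := h.lor_vertex_lt hij
  by_cases hkj : k = j
  · subst hkj
    rw [h.lor_vertex_self]; nlinarith
  · have h3 := h.lor_vertex_lt hkj
    nlinarith

theorem lor_edgePt_e (h : HasGram e) (hij : i ≠ j) (hkj : k ≠ j) :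
    lor (edgePt e i k) (e j) = 0 := by
  rw [lor_edgePt_left, h.lor_vertex_e hij, h.lor_vertex_e hkj]; ring

theorem lor_edgePt_e_self (h : HasGram e) (hik : i ≠ k) : lor (edgePt e i k) (e k) < 0 := by
  rw [lor_edgePt_left, h.lor_vertex_e hik]
  linarith [h.lor_vertex_e_self k]

theorem lor_edgePt_e_base (h : HasGram e) (hik : i ≠ k) : lor (edgePt e i k) (e i) < 0 := by
  rw [lor_edgePt_left, h.lor_vertex_e (Ne.symm hik)]
  nlinarith [h.lor_vertex_e_self i, h.lor_vertex_lt hik]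

theorem lor_edgePt_e_nonpos (h : HasGram e) (hik : i ≠ k) (j : Fin 5) :
    lor (edgePt e i k) (e j) ≤ 0 := by
  by_cases hkj : k = j
  · subst hkj; exact (h.lor_edgePt_e_self hik).le
  by_cases hij : i = j
  · subst hij; exact (h.lor_edgePt_e_base hik).le
  · exact (h.lor_edgePt_e hij hkj).le

theorem lor_edgePt_vertex_nonpos (h : HasGram e) (hik : i ≠ k) (j : Fin 5) :
    lor (edgePt e i k) (vertex e j) ≤ 0 := by
  by_cases hij : i = j
  · subst hij; exact (h.lor_edgePt_vertex_self i k).le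
  · exact (h.lor_edgePt_vertex hik hij).le

theorem lor_edgePt_self (h : HasGram e) (hik : i ≠ k) :
    lor (edgePt e i k) (edgePt e i k) < 0 := by
  nth_rewrite 2 [edgePt]
  rw [lor_sub_right, lor_smul_right, h.lor_edgePt_vertex_self, mul_zero, sub_zero]
  exact h.lor_edgePt_vertex hik hik

/-- On the hyperplane truncating a vertex the facets through the vertex suffice. -/
theorem neg_of_truncating (h : HasGram e) {x : LorentzSpace} (hx : x ≠ 0)
    (hi : lor x (vertex e i) = 0) (hj : ∀ j, j ≠ i → lor x (e j) ≤ 0) :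
    lor x (e i) < 0 ∧ ∀ k, k ≠ i → lor x (vertex e k) < 0 := by
  set c : Fin 5 → ℝ := fun k => lor x (e k) / lor (vertex e k) (e k) with hc
  have hsum : ∀ y, lor x y = ∑ k, c k * lor (vertex e k) y := by
    intro y
    conv_lhs => rw [h.eq_sum_vertex x]
    rw [lor_sum_left]
    simp only [lor_smul_left, hc]
  have hneg : ∀ k, lor (vertex e k) (e k) < 0 := fun k => by linarith [h.lor_vertex_e_self k]
  have hc0 : ∀ k, k ≠ i → 0 ≤ c k := fun k hk => div_nonneg_of_nonpos (hj k hk) (hneg k).le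
  -- If all these coefficients vanished, `x` would be a multiple of `vertex e i` orthogonal to it,
  -- hence zero.
  have hex : ∃ k, k ≠ i ∧ 0 < c k := by
    by_contra hcon
    push Not at hcon
    have hz : ∀ k, k ≠ i → c k = 0 := fun k hk => le_antisymm (hcon k hk) (hc0 k hk)
    have h1 := hsum (vertex e i)
    rw [hi, Finset.sum_eq_single i (fun k _ hk => by rw [hz k hk, zero_mul]) (by simp),
      h.lor_vertex_self, mul_one] at h1
    refine hx (h.eq_zero_of_lor_e fun j => ?_)
    have h2 : c j = 0 := by
      by_cases hji : j = i
      · rw [hji]; exact h1.symm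
      · exact hz j hji
    exact (div_eq_zero_iff.1 h2).resolve_right (hneg j).ne
  obtain ⟨k₀, hk₀, hpos⟩ := hex
  -- To be applied to the projections of `e i` and of the other vertices orthogonally to `vertex e
  -- i`; as `x` is orthogonal to `vertex e i`, projecting does not change the product with `x`.
  have key : ∀ y, lor (vertex e i) y = 0 → (∀ k, k ≠ i → lor (vertex e k) y < 0) →
      lor x y < 0 := by
    intro y hy hy'
    rw [hsum y]
    refine Finset.sum_neg' (fun k _ => ?_) ⟨k₀, Finset.mem_univ _, ?_⟩
    · by_cases hk : k = i
      · rw [hk, hy, mul_zero]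
      · exact mul_nonpos_of_nonneg_of_nonpos (hc0 k hk) (hy' k hk).le
    · exact mul_neg_of_pos_of_neg hpos (hy' k₀ hk₀)
  refine ⟨?_, fun k hk => ?_⟩
  · have h1 := key (e i - lor (vertex e i) (e i) • vertex e i)
      (by rw [lor_sub_right, lor_smul_right, h.lor_vertex_self]; ring)
      (fun k hk => by
        rw [lor_sub_right, lor_smul_right, h.lor_vertex_e hk]
        nlinarith [h.lor_vertex_lt hk, h.lor_vertex_e_self i])
    rw [lor_sub_right, lor_smul_right, hi, mul_zero, sub_zero] at h1
    exact h1
  · have h1 := key (edgePt e i k) (by rw [lor_comm, h.lor_edgePt_vertex_self])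
      (fun j hj => by rw [lor_comm]; exact h.lor_edgePt_vertex (Ne.symm hk) (Ne.symm hj))
    rw [edgePt, lor_sub_right, lor_smul_right, hi, mul_zero, sub_zero] at h1
    exact h1

end HasGram

/-! ## Copies of the truncated simplex -/

/-- The normal vectors of the facets of the truncated simplex. -/
def facetVectors (e : Fin 5 → LorentzSpace) : Finset LorentzSpace :=
  Finset.univ.image e ∪ Finset.univ.image (vertex e)

theorem mem_facetVectors {e : Fin 5 → LorentzSpace} {w : LorentzSpace} :
    w ∈ facetVectors e ↔ (∃ i, e i = w) ∨ ∃ i, vertex e i = w := by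
  simp [facetVectors]

theorem truncSimplex_eq (e : Fin 5 → LorentzSpace) :
    truncSimplex e = polyhedron ↑(facetVectors e) := by
  rw [truncSimplex, facetVectors]
  simp

theorem mem_truncSimplex {e : Fin 5 → LorentzSpace} {x : LorentzSpace} :
    x ∈ truncSimplex e ↔
      x ∈ hyperbolicSpace ∧ (∀ i, lor x (e i) ≤ 0) ∧ ∀ i, lor x (vertex e i) ≤ 0 := by
  rw [truncSimplex_eq]
  refine and_congr_right fun _ => ?_
  simp only [Finset.mem_coe, mem_facetVectors]
  constructor
  · exact fun h => ⟨fun i => h _ (Or.inl ⟨i, rfl⟩), fun i => h _ (Or.inr ⟨i, rfl⟩)⟩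
  · rintro ⟨h1, h2⟩ u (⟨i, rfl⟩ | ⟨i, rfl⟩)
    exacts [h1 i, h2 i]

namespace IsCopy

variable {e : Fin 5 → LorentzSpace} {i j k : Fin 5}

theorem hasGram (h : IsCopy e) : HasGram e := h.1

/-- A point of `T` is a nonnegative combination of the ultraideal vertices, so its product with the
edge point is not positive. This puts the edge point on the future sheet. -/
theorem isTime_edgePt (h : IsCopy e) (hik : i ≠ k) : IsTime (edgePt e i k) := by
  obtain ⟨x, hx⟩ := h.2
  rw [mem_truncSimplex] at hx
  have hg := h.hasGram
  have h1 := hg.lor_edgePt_self hik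
  have h2 : lor x (edgePt e i k) ≤ 0 := by
    rw [hg.eq_sum_vertex x, lor_sum_left]
    refine Finset.sum_nonpos fun j _ => ?_
    rw [lor_smul_left, lor_comm (vertex e j) (edgePt e i k)]
    exact mul_nonpos_of_nonneg_of_nonpos
      (div_nonneg_of_nonpos (hx.2.1 j) (by linarith [hg.lor_vertex_e_self j]))
      (hg.lor_edgePt_vertex_nonpos hik j)
  rcases causal_trichotomy h1.le with h' | h' | h'
  · rw [h', lor_zero_left] at h1; exact absurd h1 (lt_irrefl _)
  · exact ⟨h1, h'.2⟩
  · have h3 := lor_neg_of_future hx.1 h'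
    rw [lor_neg_right] at h3
    linarith

/-- The normalization of the edge points are points of the polytope. -/
theorem exists_smul_edgePt_mem (h : IsCopy e) (hik : i ≠ k) :
    ∃ a : ℝ, 0 < a ∧ a • edgePt e i k ∈ truncSimplex e := by
  obtain ⟨a, ha, hmem⟩ := (h.isTime_edgePt hik).exists_smul_mem
  refine ⟨a, ha, mem_truncSimplex.2 ⟨hmem, fun j => ?_, fun j => ?_⟩⟩
  · exact (lor_smul_nonpos ha).2 (h.hasGram.lor_edgePt_e_nonpos hik j)
  · exact (lor_smul_nonpos ha).2 (h.hasGram.lor_edgePt_vertex_nonpos hik j)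

theorem exists_interior (h : IsCopy e) :
    ∃ x ∈ hyperbolicSpace, ∀ w ∈ facetVectors e, lor x w < 0 := by
  have hg := h.hasGram
  -- Every wall is avoided by some summand: that of `e j` by the summands with `i = j`, and the
  -- truncating wall at `j` by those with `i = j + 1`.
  set z := ∑ i : Fin 5, (edgePt e i (i + 1) + edgePt e i (i + 2)) with hz
  have hne : ∀ i : Fin 5, i ≠ i + 1 ∧ i ≠ i + 2 := by decide
  have ht : IsTime z := IsTime.sum Finset.univ_nonempty fun i _ =>
    (h.isTime_edgePt (hne i).1).add (h.isTime_edgePt (hne i).2)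
  obtain ⟨a, ha, hmem⟩ := ht.exists_smul_mem
  refine ⟨a • z, hmem, fun w hw => ?_⟩
  rw [lor_smul_left]
  refine mul_neg_of_pos_of_neg ha ?_
  rw [hz, lor_sum_left]
  simp only [lor_add_left]
  rcases mem_facetVectors.1 hw with ⟨j, rfl⟩ | ⟨j, rfl⟩
  · refine Finset.sum_neg' (fun i _ => add_nonpos (hg.lor_edgePt_e_nonpos (hne i).1 j)
      (hg.lor_edgePt_e_nonpos (hne i).2 j)) ⟨j, Finset.mem_univ _, ?_⟩
    exact add_neg (hg.lor_edgePt_e_base (hne j).1) (hg.lor_edgePt_e_base (hne j).2)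
  · refine Finset.sum_neg' (fun i _ => add_nonpos (hg.lor_edgePt_vertex_nonpos (hne i).1 j)
      (hg.lor_edgePt_vertex_nonpos (hne i).2 j)) ⟨j + 1, Finset.mem_univ _, ?_⟩
    have : j + 1 ≠ j := (hne j).1.symm
    exact add_neg (hg.lor_edgePt_vertex (hne _).1 this) (hg.lor_edgePt_vertex (hne _).2 this)

theorem isBase (h : IsCopy e) : IsBase (facetVectors e) where
  unit u hu := by
    rcases mem_facetVectors.1 hu with ⟨i, rfl⟩ | ⟨i, rfl⟩
    exacts [h.hasGram.unit i, h.hasGram.lor_vertex_self i]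
  angle u hu v hv huv := by
    have hg := h.hasGram
    have key : ∀ i j, (∃ m : ℕ, 2 ≤ m ∧ lor (vertex e i) (e j) = -Real.cos (Real.pi / m)) ∨
        lor (vertex e i) (e j) ≤ -1 := by
      intro i j
      by_cases hij : i = j
      · subst hij; exact Or.inr (hg.lor_vertex_e_self i)
      · exact Or.inl ⟨2, le_refl _, by rw [hg.lor_vertex_e hij]; simp⟩
    rcases mem_facetVectors.1 hu with ⟨i, rfl⟩ | ⟨i, rfl⟩ <;>
      rcases mem_facetVectors.1 hv with ⟨j, rfl⟩ | ⟨j, rfl⟩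
    · have hij : i ≠ j := by rintro rfl; exact huv rfl
      refine Or.inl ?_
      rcases hg.lor_e_e hij with h' | h' | h' <;> rw [h']
      · exact ⟨2, le_refl _, by simp⟩
      · exact ⟨3, by norm_num, by norm_num⟩
      · exact ⟨5, by norm_num, by norm_num⟩
    · rw [lor_comm]; exact key j i
    · exact key i j
    · have hij : i ≠ j := by rintro rfl; exact huv rfl
      exact Or.inr (hg.lor_vertex_lt hij).le
  interior := h.exists_interior

/-- Each facet contains enough edge points: a vector orthogonal to all those on the facet is a
multiple of its normal. -/
theorem facetVectors_subset (h : IsCopy e) :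
    ↑(facetVectors e) ⊆ facetNormals (truncSimplex e) := by
  intro u hu
  have hg := h.hasGram
  rw [mem_facetNormals_iff]
  refine ⟨h.isBase.unit u hu, fun x hx => ?_, fun y hy => ?_⟩
  · rw [truncSimplex_eq] at hx; exact hx.2 u hu
  · have hy' : ∀ i k, i ≠ k → lor (edgePt e i k) u = 0 → lor (edgePt e i k) y = 0 := by
      intro i k hik h0
      obtain ⟨a, ha, hmem⟩ := h.exists_smul_edgePt_mem hik
      exact (lor_smul_eq_zero ha).1 (hy _ hmem ((lor_smul_eq_zero ha).2 h0))
    rcases mem_facetVectors.1 hu with ⟨j, rfl⟩ | ⟨j, rfl⟩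
    · have hex : ∀ k j : Fin 5, ∃ i, i ≠ k ∧ i ≠ j := by decide
      refine ⟨lor (vertex e j) y / lor (vertex e j) (e j), ?_⟩
      refine sub_eq_zero.1 (hg.eq_zero_of_lor_vertex fun k => ?_)
      have hne : lor (vertex e j) (e j) ≠ 0 := by linarith [hg.lor_vertex_e_self j]
      rw [lor_comm, lor_sub_right, lor_smul_right]
      by_cases hk : k = j
      · subst hk; field_simp; ring
      · rw [hg.lor_vertex_e hk, mul_zero, sub_zero]
        obtain ⟨i, hik, hij⟩ := hex k j
        -- Both ends of the edge between `i` and `k` lie on the wall of `e j`. The two equations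
        -- have determinant `1 - g ^ 2` with `g < -1`, so `y` is orthogonal to `vertex e k`.
        have h1 := hy' i k hik (hg.lor_edgePt_e hij hk)
        have h2 := hy' k i hik.symm (hg.lor_edgePt_e hk hij)
        rw [HasGram.lor_edgePt_left] at h1 h2
        rw [lor_comm (vertex e k) (vertex e i)] at h2
        have h3 := hg.lor_vertex_lt hik
        have h4 : lor (vertex e k) y * (1 - lor (vertex e i) (vertex e k) ^ 2) = 0 := by
          linear_combination h1 + lor (vertex e i) (vertex e k) * h2
        refine (mul_eq_zero.1 h4).resolve_right ?_
        nlinarith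
    · refine ⟨lor (vertex e j) y, ?_⟩
      refine sub_eq_zero.1 (hg.eq_zero_of_lor_vertex fun k => ?_)
      rw [lor_comm, lor_sub_right, lor_smul_right]
      by_cases hk : k = j
      · subst hk; rw [hg.lor_vertex_self]; ring
      · have h1 := hy' j k (Ne.symm hk) (hg.lor_edgePt_vertex_self j k)
        rw [HasGram.lor_edgePt_left] at h1
        rw [lor_comm (vertex e k) (vertex e j)]
        linarith

end IsCopy

end CoxeterDomino

end

/-! ### Orthogonal facets and the gluing of copies along them -/

noncomputable section

namespace CoxeterDomino

/-! ## Orthogonal facets -/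

/-- The normal vectors of the facets adjacent to the `i`-th orthogonal facet. -/
def sideNormals (e : Fin 5 → LorentzSpace) (i : Fin 5) : Finset LorentzSpace :=
  (Finset.univ.erase i).image e

theorem mem_sideNormals {e : Fin 5 → LorentzSpace} {i : Fin 5} {u : LorentzSpace} :
    u ∈ sideNormals e i ↔ ∃ j, j ≠ i ∧ e j = u := by
  simp [sideNormals]

theorem sideNormals_subset (e : Fin 5 → LorentzSpace) (i : Fin 5) :
    sideNormals e i ⊆ facetVectors e := by
  intro u hu
  obtain ⟨j, -, rfl⟩ := mem_sideNormals.1 hu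
  exact mem_facetVectors.2 (Or.inl ⟨j, rfl⟩)

theorem vertex_mem (e : Fin 5 → LorentzSpace) (i : Fin 5) : vertex e i ∈ facetVectors e :=
  mem_facetVectors.2 (Or.inr ⟨i, rfl⟩)

namespace HasGram

variable {e : Fin 5 → LorentzSpace} {i j k : Fin 5}

theorem lor_sideNormals (h : HasGram e) {u : LorentzSpace} (hu : u ∈ sideNormals e i) :
    lor u (vertex e i) = 0 := by
  obtain ⟨j, hj, rfl⟩ := mem_sideNormals.1 hu
  rw [lor_comm, h.lor_vertex_e hj.symm]

theorem mem_sideNormals_or (h : HasGram e) {u : LorentzSpace} (hu : u ∈ facetVectors e)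
    (hne : u ≠ vertex e i) : u ∈ sideNormals e i ∨ lor u (vertex e i) ≤ -1 := by
  rcases mem_facetVectors.1 hu with ⟨j, rfl⟩ | ⟨j, rfl⟩
  · by_cases hji : j = i
    · subst hji
      rw [lor_comm]
      exact Or.inr (h.lor_vertex_e_self j)
    · exact Or.inl (mem_sideNormals.2 ⟨j, hji, rfl⟩)
  · refine Or.inr (h.lor_vertex_lt ?_).le
    rintro rfl
    exact hne rfl

/-- Every node of the graph of an orthogonal facet has a neighbour. -/
theorem exists_neighbour (h : HasGram e) {u : LorentzSpace} (hu : u ∈ sideNormals e i) :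
    ∃ w ∈ sideNormals e i, -1 < lor u w ∧ lor u w < 0 := by
  obtain ⟨j, hj, rfl⟩ := mem_sideNormals.1 hu
  have key : ∃ k, k ≠ i ∧ lor (e j) (e k) < 0 := by
    have h1 := phi_pos
    have hn : ∀ i j : Fin 5, j ≠ i → ∃ k, k ≠ i ∧
        ((j, k) = (0, 1) ∨ (j, k) = (0, 3) ∨ (j, k) = (1, 0) ∨ (j, k) = (1, 2) ∨ (j, k) = (2, 1) ∨
          (j, k) = (2, 3) ∨ (j, k) = (3, 2) ∨ (j, k) = (3, 0) ∨ (j, k) = (4, 1) ∨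
            (j, k) = (4, 3)) := by decide
    obtain ⟨k, hk, hjk⟩ := hn i j hj
    refine ⟨k, hk, ?_⟩
    rw [h j k, gram_eq]
    rcases hjk with hjk | hjk | hjk | hjk | hjk | hjk | hjk | hjk | hjk | hjk <;>
      obtain ⟨rfl, rfl⟩ := Prod.mk.inj hjk <;> simp <;> linarith
  obtain ⟨k, hk, hneg⟩ := key
  exact ⟨e k, mem_sideNormals.2 ⟨k, hk, rfl⟩, h.lor_e_e_gt j k, hneg⟩

theorem eq_smul_vertex (h : HasGram e) {y : LorentzSpace}
    (hy : ∀ k, k ≠ i → lor (edgePt e i k) y = 0) : y = lor (vertex e i) y • vertex e i := by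
  refine sub_eq_zero.1 (h.eq_zero_of_lor_vertex fun k => ?_)
  rw [lor_comm, lor_sub_right, lor_smul_right]
  by_cases hk : k = i
  · subst hk; rw [h.lor_vertex_self]; ring
  · have h1 := hy k hk
    rw [lor_edgePt_left] at h1
    rw [lor_comm (vertex e k) (vertex e i)]
    linarith

end HasGram

namespace IsCopy

variable {e e' : Fin 5 → LorentzSpace} {i i' j k : Fin 5}

theorem exists_smul_edgePt_mem_orthFacet (h : IsCopy e) (hik : i ≠ k) :
    ∃ a : ℝ, 0 < a ∧ a • edgePt e i k ∈ orthFacet e i := by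
  obtain ⟨a, ha, hmem⟩ := h.exists_smul_edgePt_mem hik
  exact ⟨a, ha, hmem, (lor_smul_eq_zero ha).2 (h.hasGram.lor_edgePt_vertex_self i k)⟩

theorem lor_edgePt_nonpos_of_orthFacet (h : IsCopy e) {n : LorentzSpace}
    (hn : ∀ x ∈ orthFacet e i, lor x n ≤ 0) (hik : i ≠ k) : lor (edgePt e i k) n ≤ 0 := by
  obtain ⟨a, ha, hmem⟩ := h.exists_smul_edgePt_mem_orthFacet hik
  exact (lor_smul_nonpos ha).1 (hn _ hmem)

/-- The orthogonal facet spans the simplicial cone cut out by the adjacent facets. -/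
theorem nonpos_of_orthFacet (h : IsCopy e) {n x : LorentzSpace}
    (hn : ∀ x ∈ orthFacet e i, lor x n ≤ 0) (hxi : lor x (vertex e i) = 0)
    (hx : ∀ j, j ≠ i → lor x (e j) ≤ 0) : lor x n ≤ 0 := by
  have hg := h.hasGram
  set c : Fin 5 → ℝ := fun k => lor x (e k) / lor (edgePt e i k) (e k) with hc
  set z := x - ∑ k ∈ Finset.univ.erase i, c k • edgePt e i k with hz
  have hzi : lor z (vertex e i) = 0 := by
    rw [hz, lor_sub_left, lor_sum_left, hxi]
    simp [lor_smul_left, hg.lor_edgePt_vertex_self]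
  have hzj : ∀ j, j ≠ i → lor z (e j) = 0 := by
    intro j hj
    have h1 := (hg.lor_edgePt_e_self hj.symm).ne
    rw [hz, lor_sub_left, lor_sum_left, Finset.sum_eq_single j, lor_smul_left, hc]
    · field_simp; ring
    · intro k hk hkj
      rw [lor_smul_left, hg.lor_edgePt_e hj.symm hkj, mul_zero]
    · intro hj'; simp [hj] at hj'
  -- Both `z` and `-z` satisfy the hypotheses of `neg_of_truncating`, so a nonzero `z` would have
  -- products of both signs with `e i`.
  have hz0 : z = 0 := by
    by_contra hne
    have h1 := (hg.neg_of_truncating hne hzi fun j hj => (hzj j hj).le).1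
    have h2 := (hg.neg_of_truncating (neg_ne_zero.2 hne) (by rw [lor_neg_left, hzi, neg_zero])
      fun j hj => by rw [lor_neg_left, hzj j hj, neg_zero]).1
    rw [lor_neg_left] at h2
    linarith
  rw [sub_eq_zero.1 hz0, lor_sum_left]
  refine Finset.sum_nonpos fun k hk => ?_
  have hk' : k ≠ i := Finset.ne_of_mem_erase hk
  rw [lor_smul_left]
  exact mul_nonpos_of_nonneg_of_nonpos
    (div_nonneg_of_nonpos (hx k hk') (hg.lor_edgePt_e_self hk'.symm).le)
    (h.lor_edgePt_nonpos_of_orthFacet hn hk'.symm)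

theorem vertex_eq_or (h : IsCopy e) (h' : IsCopy e') (heq : orthFacet e i = orthFacet e' i') :
    vertex e' i' = vertex e i ∨ vertex e' i' = -vertex e i := by
  have h1 : vertex e' i' = lor (vertex e i) (vertex e' i') • vertex e i := by
    refine h.hasGram.eq_smul_vertex fun k hk => ?_
    obtain ⟨a, ha, hmem⟩ := h.exists_smul_edgePt_mem_orthFacet hk.symm
    rw [heq] at hmem
    exact (lor_smul_eq_zero ha).1 hmem.2
  have h2 := h'.hasGram.lor_vertex_self i'
  rw [h1] at h2
  rw [lor_smul_left, lor_smul_right, h.hasGram.lor_vertex_self, mul_one] at h2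
  rcases mul_self_eq_one_iff.1 h2 with h3 | h3 <;> rw [h3] at h1
  · exact Or.inl (by rw [h1, one_smul])
  · exact Or.inr (by rw [h1, neg_one_smul])

/-- A 3-simplex determines its faces. If the normal `e' j'` were not among those of `e`, the face it
cuts out would contain a point strictly inside all side walls of `e`, and a small move would cross
`e' j'` without leaving the cone over the facet. -/
theorem sideNormals_subset_of_eq (h : IsCopy e) (h' : IsCopy e')
    (heq : orthFacet e i = orthFacet e' i') : sideNormals e' i' ⊆ sideNormals e i := by
  have hg := h.hasGram
  have hg' := h'.hasGram
  intro n hn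
  obtain ⟨j', hj', rfl⟩ := mem_sideNormals.1 hn
  by_contra hnot
  have hperp : ∀ y, lor y (vertex e' i') = 0 → lor y (vertex e i) = 0 := by
    intro y hy
    rcases h.vertex_eq_or h' heq with h1 | h1 <;> rw [h1] at hy
    · exact hy
    · rwa [lor_neg_right, neg_eq_zero] at hy
  have hperp' : ∀ y, lor y (vertex e i) = 0 → lor y (vertex e' i') = 0 := by
    intro y hy
    rcases h.vertex_eq_or h' heq with h1 | h1 <;> rw [h1]
    · exact hy
    · rw [lor_neg_right, hy, neg_zero]
  have hle : ∀ k', i' ≠ k' → ∀ j, lor (edgePt e' i' k') (e j) ≤ 0 := by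
    intro k' hk' j
    refine h'.lor_edgePt_nonpos_of_orthFacet (fun x hx => ?_) hk'
    rw [← heq] at hx
    exact (mem_truncSimplex.1 hx.1).2.1 j
  -- If `e j` vanished at all corners of the face opposite `j'`, it would be a nonnegative multiple
  -- of the unit vector `e' j'`, hence equal to it.
  have hex : ∀ j, j ≠ i → ∃ k', k' ≠ i' ∧ k' ≠ j' ∧ lor (edgePt e' i' k') (e j) < 0 := by
    intro j hj
    by_contra hcon
    push Not at hcon
    have hneg := hg'.lor_edgePt_e_self hj'.symm
    set b := lor (edgePt e' i' j') (e j) / lor (edgePt e' i' j') (e' j') with hb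
    have hz : e j - b • e' j' = lor (vertex e' i') (e j - b • e' j') • vertex e' i' := by
      refine hg'.eq_smul_vertex fun k' hk' => ?_
      rw [lor_sub_right, lor_smul_right]
      by_cases hkj : k' = j'
      · subst hkj
        rw [hb, div_mul_cancel₀ _ hneg.ne, sub_self]
      · rw [hg'.lor_edgePt_e hj'.symm hkj, mul_zero, sub_zero]
        exact le_antisymm (hle k' hk'.symm j) (hcon k' hk' hkj)
    have h0 : lor (vertex e' i') (e j - b • e' j') = 0 := by
      rw [lor_sub_right, lor_smul_right, hg'.lor_vertex_e hj'.symm, mul_zero, sub_zero, lor_comm]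
      exact hperp' _ (by rw [lor_comm, hg.lor_vertex_e hj.symm])
    rw [h0, zero_smul, sub_eq_zero] at hz
    have hb0 : 0 ≤ b := div_nonneg_of_nonpos (hle j' hj'.symm j) hneg.le
    have h1 := hg.unit j
    rw [hz, lor_smul_left, lor_smul_right, hg'.unit, mul_one] at h1
    have h2 : b = 1 := by nlinarith
    rw [h2, one_smul] at hz
    exact hnot (mem_sideNormals.2 ⟨j, hj, hz⟩)
  have hK : ((Finset.univ.erase i').erase j').Nonempty := by
    have : ∀ i j : Fin 5, ((Finset.univ.erase i).erase j).Nonempty := by decide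
    exact this i' j'
  set y := ∑ k' ∈ (Finset.univ.erase i').erase j', edgePt e' i' k' with hy
  have hmem : ∀ k' ∈ (Finset.univ.erase i').erase j', k' ≠ i' ∧ k' ≠ j' := fun k' hk' =>
    ⟨Finset.ne_of_mem_erase (Finset.mem_of_mem_erase hk'), Finset.ne_of_mem_erase hk'⟩
  have hyt : IsTime y := IsTime.sum hK fun k' hk' => h'.isTime_edgePt (hmem k' hk').1.symm
  have hyj : ∀ w ∈ sideNormals e i, lor y w < 0 := by
    intro w hw
    obtain ⟨j, hj, rfl⟩ := mem_sideNormals.1 hw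
    obtain ⟨k', hk1, hk2, hk3⟩ := hex j hj
    rw [hy, lor_sum_left]
    exact Finset.sum_neg' (fun k' hk' => hle k' (hmem k' hk').1.symm j)
      ⟨k', by simp [hk1, hk2], hk3⟩
  have hyi : lor y (vertex e' i') = 0 := by
    rw [hy, lor_sum_left]
    exact Finset.sum_eq_zero fun k' _ => hg'.lor_edgePt_vertex_self i' k'
  have hyj' : lor y (e' j') = 0 := by
    rw [hy, lor_sum_left]
    exact Finset.sum_eq_zero fun k' hk' => hg'.lor_edgePt_e hj'.symm (hmem k' hk').2
  obtain ⟨ε, hε, -, hlt⟩ := hyt.perturb hyj (e' j')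
  have := h.nonpos_of_orthFacet (n := e' j') (x := y + ε • e' j') (i := i)
    (fun x hx => by rw [heq] at hx; exact (mem_truncSimplex.1 hx.1).2.1 j')
    (hperp _ (by rw [lor_add_left, lor_smul_left, hyi, lor_comm (e' j'),
      hg'.lor_vertex_e hj'.symm]; ring))
    (fun j hj => (hlt _ (mem_sideNormals.2 ⟨j, hj, rfl⟩)).le)
  rw [lor_add_left, lor_smul_left, hyj', hg'.unit] at this
  linarith

theorem sideNormals_eq (h : IsCopy e) (h' : IsCopy e') (heq : orthFacet e i = orthFacet e' i') :
    sideNormals e' i' = sideNormals e i :=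
  (h.sideNormals_subset_of_eq h' heq).antisymm (h'.sideNormals_subset_of_eq h heq.symm)

/-- Two copies on the same side of a common orthogonal facet overlap. -/
theorem exists_mem_inter (h : IsCopy e) (h' : IsCopy e') (hv : vertex e i = vertex e' i')
    (hN : sideNormals e i = sideNormals e' i') :
    ∃ x ∈ truncSimplex e ∩ truncSimplex e', lor x (vertex e' i') < 0 := by
  have hg := h.hasGram
  have hg' := h'.hasGram
  set y := ∑ k ∈ Finset.univ.erase i, edgePt e i k with hy
  have hyt : IsTime y := IsTime.sum (by
    have : ∀ i : Fin 5, (Finset.univ.erase i).Nonempty := by decide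
    exact this i) fun k hk => h.isTime_edgePt (Finset.ne_of_mem_erase hk).symm
  have hyv : lor y (vertex e i) = 0 := by
    rw [hy, lor_sum_left]
    exact Finset.sum_eq_zero fun k _ => hg.lor_edgePt_vertex_self i k
  have hyN : ∀ w ∈ sideNormals e i, lor y w < 0 := by
    intro w hw
    obtain ⟨j, hj, rfl⟩ := mem_sideNormals.1 hw
    rw [hy, lor_sum_left]
    refine Finset.sum_neg' (fun k hk =>
      hg.lor_edgePt_e_nonpos (Finset.ne_of_mem_erase hk).symm j) ⟨j, by simp [hj], ?_⟩
    exact hg.lor_edgePt_e_self hj.symm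
  have hy0 : y ≠ 0 := by
    rintro h0
    have := hyt.1
    rw [h0, lor_zero_left] at this
    exact lt_irrefl _ this
  have key : ∀ {f : Fin 5 → LorentzSpace} {l : Fin 5}, HasGram f → vertex f l = vertex e i →
      sideNormals f l = sideNormals e i → ∀ w ∈ (facetVectors f).erase (vertex e i),
        lor y w < 0 := by
    intro f l hf hvf hNf w hw
    have h1 := hf.neg_of_truncating (i := l) hy0 (by rw [hvf, hyv]) fun j hj =>
      (hyN _ (hNf ▸ mem_sideNormals.2 ⟨j, hj, rfl⟩)).le
    have hwv := Finset.ne_of_mem_erase hw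
    rcases mem_facetVectors.1 (Finset.mem_of_mem_erase hw) with ⟨j, rfl⟩ | ⟨j, rfl⟩
    · by_cases hj : j = l
      · rw [hj]; exact h1.1
      · exact hyN _ (hNf ▸ mem_sideNormals.2 ⟨j, hj, rfl⟩)
    · refine h1.2 j ?_
      rintro rfl
      exact hwv hvf
  -- The point `y` of the common facet is strictly inside all other walls of both copies, so moving
  -- it along `-vertex e i` enters both.
  obtain ⟨ε, hε, ht, hlt⟩ := hyt.perturb (Φ := (facetVectors e).erase (vertex e i) ∪
    (facetVectors e').erase (vertex e i)) (fun w hw => by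
      rcases Finset.mem_union.1 hw with hw | hw
      · exact key hg rfl rfl w hw
      · exact key hg' hv.symm hN.symm w hw) (-vertex e i)
  have hlv : lor (y + ε • -vertex e i) (vertex e i) < 0 := by
    rw [lor_add_left, hyv, lor_smul_left, lor_neg_left, hg.lor_vertex_self]
    linarith
  obtain ⟨a, ha, hmem⟩ := ht.exists_smul_mem
  refine ⟨a • (y + ε • -vertex e i), ⟨?_, ?_⟩, ?_⟩
  · rw [truncSimplex_eq]
    refine ⟨hmem, fun w hw => (lor_smul_nonpos ha).2 ?_⟩
    by_cases hwv : w = vertex e i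
    · rw [hwv]; exact hlv.le
    · exact (hlt w (Finset.mem_union_left _ (Finset.mem_erase.2 ⟨hwv, hw⟩))).le
  · rw [truncSimplex_eq]
    refine ⟨hmem, fun w hw => (lor_smul_nonpos ha).2 ?_⟩
    by_cases hwv : w = vertex e i
    · rw [hwv]; exact hlv.le
    · exact (hlt w (Finset.mem_union_right _ (Finset.mem_erase.2 ⟨hwv, hw⟩))).le
  · rw [← hv, lor_smul_left]
    exact mul_neg_of_pos_of_neg ha hlv

end IsCopy

/-! ## Polytopes composed of copies -/

/-- The `i`-th orthogonal facet of the copy `e` is a facet of the polytope with normals `Φ`, and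
it is orthogonal to the adjacent facets and disjoint from the others. -/
def IsExposed (Φ : Finset LorentzSpace) (e : Fin 5 → LorentzSpace) (i : Fin 5) : Prop :=
  vertex e i ∈ Φ ∧ sideNormals e i ⊆ Φ ∧
    ∀ u ∈ Φ, u ≠ vertex e i → u ∈ sideNormals e i ∨ lor u (vertex e i) ≤ -1

/-- Another copy in `L` lies on the other side of the `i`-th orthogonal facet of `e`. -/
def IsCovered (L : List (Fin 5 → LorentzSpace)) (e : Fin 5 → LorentzSpace) (i : Fin 5) : Prop :=
  ∃ e₂ ∈ L, ∃ i₂, vertex e₂ i₂ = -vertex e i ∧ sideNormals e₂ i₂ = sideNormals e i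

/-- The copies of the truncated simplex in `L` form a polytope with facet normals `Φ`. -/
structure IsTiling (L : List (Fin 5 → LorentzSpace)) (Φ : Finset LorentzSpace) : Prop where
  copy : ∀ e ∈ L, IsCopy e
  nonempty : Φ.Nonempty
  base : IsBase Φ
  body_eq : body L = polyhedron ↑Φ
  facet : ↑Φ ⊆ facetNormals (body L)
  ortho : ∀ e ∈ L, ∀ i, IsExposed Φ e i ∨ IsCovered L e i

theorem IsTiling.facetNormals_eq {L : List (Fin 5 → LorentzSpace)} {Φ : Finset LorentzSpace}
    (h : IsTiling L Φ) : facetNormals (body L) = ↑Φ := by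
  refine Set.Subset.antisymm ?_ h.facet
  rw [h.body_eq]
  exact facetNormals_polyhedron_subset h.base h.nonempty

theorem IsCopy.isExposed {e : Fin 5 → LorentzSpace} (h : IsCopy e) (i : Fin 5) :
    IsExposed (facetVectors e) e i :=
  ⟨vertex_mem e i, sideNormals_subset e i, fun _ hu hne => h.hasGram.mem_sideNormals_or hu hne⟩

theorem body_cons (e : Fin 5 → LorentzSpace) (L : List (Fin 5 → LorentzSpace)) :
    body (e :: L) = truncSimplex e ∪ body L := by
  ext x; simp [body]

theorem body_singleton (e : Fin 5 → LorentzSpace) : body [e] = truncSimplex e := by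
  ext x; simp [body]

theorem IsCopy.isTiling {e : Fin 5 → LorentzSpace} (h : IsCopy e) :
    IsTiling [e] (facetVectors e) where
  copy f hf := by rw [List.mem_singleton.1 hf]; exact h
  nonempty := ⟨_, vertex_mem e 0⟩
  base := h.isBase
  body_eq := by rw [body_singleton, truncSimplex_eq]
  facet := by rw [body_singleton]; exact h.facetVectors_subset
  ortho f hf i := by rw [List.mem_singleton.1 hf]; exact Or.inl (h.isExposed i)

/-- When `u + v` is future, `lor x u + lor x v < 0` on all of hyperbolic space. So a point beyond
one wall is strictly inside the other; gluing rests on this nesting. -/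
theorem future_add {Φ : Finset LorentzSpace} (h : IsBase Φ) {u v : LorentzSpace} (hu : u ∈ Φ)
    (hv : v ∈ Φ) (huv : lor u v ≤ -1) : IsFuture (u + v) := by
  obtain ⟨x, hx, hint⟩ := h.interior
  refine future_of_lor_neg hx ?_ ?_
  · rw [lor_add_left, lor_add_right, lor_add_right, h.unit u hu, h.unit v hv, lor_comm v u]
    linarith
  · rw [lor_add_right]
    exact add_neg (hint u hu) (hint v hv)

/-- Removing a facet that is orthogonal to the adjacent facets. -/
theorem IsBase.invGrowth_erase {Φ N : Finset LorentzSpace} (h : IsBase Φ) {v : LorentzSpace}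
    (hv : v ∈ Φ) (hN : N ⊆ Φ) (ho : ∀ u ∈ N, lor u v = 0)
    (hc : ∀ u ∈ Φ, u ≠ v → u ∈ N ∨ lor u v ≤ -1) :
    invGrowth Φ = invGrowth (Φ.erase v) - tt / (1 + tt) * invGrowth N := by
  have hvN : v ∉ N := fun hvN => by
    have := h.unit v hv
    rw [ho v hvN] at this
    exact zero_ne_one this
  have hNe : N ⊆ Φ.erase v := fun u hu =>
    Finset.mem_erase.2 ⟨fun huv => hvN (huv ▸ hu), hN hu⟩
  have hins : insert v N ⊆ Φ := Finset.insert_subset hv hN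
  have hunion : Φ.erase v ∪ insert v N = Φ := by
    refine Finset.Subset.antisymm (Finset.union_subset (Finset.erase_subset _ _) hins) fun u hu => ?_
    by_cases huv : u = v
    · simp [huv]
    · exact Finset.mem_union_left _ (Finset.mem_erase.2 ⟨huv, hu⟩)
  have hinter : Φ.erase v ∩ insert v N = N := by
    ext u
    simp only [Finset.mem_inter, Finset.mem_erase, Finset.mem_insert]
    constructor
    · rintro ⟨⟨h1, -⟩, h2 | h2⟩
      exacts [absurd h2 h1, h2]
    · exact fun hu => ⟨Finset.mem_erase.1 (hNe hu), Or.inr hu⟩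
  -- The group is an amalgam of those without `v` and around `v`, over that of `N`. The group around
  -- `v` is a direct product, and `1 / (1 + t) - 1 = -t / (1 + t)`.
  have h1 := IsBase.invGrowth_union (Δ₁ := Φ.erase v) (Δ₂ := insert v N) (by rwa [hunion])
    (by
      intro u hu hu' w hw hw'
      rw [Finset.mem_erase] at hu
      rw [Finset.mem_insert, not_or] at hu'
      have hwv : w = v := by
        rcases Finset.mem_insert.1 hw with hw | hw
        · exact hw
        · exact absurd (hNe hw) hw'
      rw [hwv]
      exact (hc u hu.2 hu.1).resolve_left hu'.2)
  have h2 := IsBase.invGrowth_insert (h.mono hins) hvN ho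
  have h3 := cyc2_ne_zero
  rw [hunion, hinter, h2] at h1
  rw [h1, h2]
  field_simp
  ring

/-- Gluing a copy to a polytope. -/
theorem IsTiling.glue {L : List (Fin 5 → LorentzSpace)} {Φ : Finset LorentzSpace}
    (h : IsTiling L Φ) {τ : FacetType} {e' : Fin 5 → LorentzSpace} (hG : Glues τ L e') :
    ∃ Φ' : Finset LorentzSpace, IsTiling (e' :: L) Φ' ∧ ∃ i', facetType i' = τ ∧
      invGrowth Φ' = invGrowth Φ + invGrowth (facetVectors e') +
        (tt - 1) / (1 + tt) * invGrowth (sideNormals e' i') ∧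
      ∀ l, l ≠ i' → IsExposed Φ' e' l := by
  obtain ⟨h', e, he, i, i', -, hτ, heq, hint⟩ := hG
  have hcop := h.copy e he
  have hg := hcop.hasGram
  have hg' := h'.hasGram
  -- A copy in `L` on the same side of the common facet would overlap the new copy away from that
  -- facet.
  have hno : ∀ e₂ ∈ L, ∀ i₂, vertex e₂ i₂ = vertex e' i' →
      sideNormals e₂ i₂ = sideNormals e' i' → False := by
    intro e₂ he₂ i₂ hv hN
    obtain ⟨x, ⟨hx1, hx2⟩, hlt⟩ := (h.copy e₂ he₂).exists_mem_inter h' hv hN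
    have : x ∈ body L ∩ truncSimplex e' := ⟨⟨e₂, he₂, hx1⟩, hx2⟩
    rw [hint] at this
    exact hlt.ne this.2
  have hN : sideNormals e' i' = sideNormals e i := hcop.sideNormals_eq h' heq
  have hv' : vertex e' i' = -vertex e i :=
    (hcop.vertex_eq_or h' heq).resolve_left fun hv => hno e he i hv.symm hN.symm
  have hexp : IsExposed Φ e i := by
    refine (h.ortho e he i).resolve_right ?_
    rintro ⟨e₂, he₂, i₂, hv₂, hN₂⟩
    exact hno e₂ he₂ i₂ (hv₂.trans hv'.symm) (hN₂.trans hN.symm)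
  set v := vertex e i with hv
  set N := sideNormals e i with hNdef
  set Ψ := facetVectors e' with hΨ
  have hb := h.base
  have hb' : IsBase Ψ := h'.isBase
  have hexp' := h'.isExposed i'
  rw [IsExposed, hN, hv', ← hΨ] at hexp'
  obtain ⟨hvΦ, hNΦ, hcΦ⟩ := hexp
  obtain ⟨hvΨ, hNΨ, hcΨ⟩ := hexp'
  have hNv : ∀ u ∈ N, lor u v = 0 := fun u hu => hg.lor_sideNormals hu
  have hNv' : ∀ u ∈ N, lor u (-v) = 0 := fun u hu => by rw [lor_neg_right, hNv u hu, neg_zero]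
  have hvv : lor v v = 1 := hb.unit v hvΦ
  have hfut₁ : ∀ u ∈ Φ, u ≠ v → u ∉ N → IsFuture (u + v) := fun u hu huv huN =>
    future_add hb hu hvΦ ((hcΦ u hu huv).resolve_left huN)
  have hfut₂ : ∀ u ∈ Ψ, u ≠ -v → u ∉ N → IsFuture (u + -v) := fun u hu huv huN =>
    future_add hb' hu hvΨ ((hcΨ u hu huv).resolve_left huN)
  -- Both `u₁ + v` and `u₂ - v` are future, so their product is not positive; with `lor u₁ v ≤ -1`
  -- and `lor u₂ v ≥ 1` this yields the bound.
  have hcross : ∀ u₁ ∈ Φ, u₁ ≠ v → u₁ ∉ N → ∀ u₂ ∈ Ψ, u₂ ≠ -v → u₂ ∉ N → lor u₁ u₂ ≤ -1 := by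
    intro u₁ h1 h2 h3 u₂ h4 h5 h6
    have h7 := lor_nonpos_of_future (hfut₁ u₁ h1 h2 h3) (hfut₂ u₂ h4 h5 h6)
    have h8 := (hcΦ u₁ h1 h2).resolve_left h3
    have h9 := (hcΨ u₂ h4 h5).resolve_left h6
    rw [lor_neg_right] at h9
    rw [lor_add_left, lor_add_right, lor_add_right, lor_neg_right, lor_neg_right, hvv,
      lor_comm v u₂] at h7
    linarith
  have hNne : ∀ u ∈ N, u ≠ v ∧ u ≠ -v := by
    intro u hu
    refine ⟨?_, ?_⟩ <;> rintro rfl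
    · have := hNv _ hu; rw [hvv] at this; exact one_ne_zero this
    · have := hNv _ hu; rw [lor_neg_left, hvv] at this; norm_num at this
  have hN₁ : N ⊆ Φ.erase v := fun u hu => Finset.mem_erase.2 ⟨(hNne u hu).1, hNΦ hu⟩
  have hN₂ : N ⊆ Ψ.erase (-v) := fun u hu => Finset.mem_erase.2 ⟨(hNne u hu).2, hNΨ hu⟩
  have hinter : Φ.erase v ∩ Ψ.erase (-v) = N := by
    refine Finset.Subset.antisymm (fun u hu => ?_) (Finset.subset_inter hN₁ hN₂)
    by_contra huN
    rw [Finset.mem_inter, Finset.mem_erase, Finset.mem_erase] at hu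
    have h1 := hcross u hu.1.2 hu.1.1 huN u hu.2.2 hu.2.1 huN
    rw [hb.unit u hu.1.2] at h1
    norm_num at h1
  set Φ' := Φ.erase v ∪ Ψ.erase (-v) with hΦ'
  have hmem' : ∀ u ∈ Φ', (u ∈ Φ ∧ u ≠ v) ∨ (u ∈ Ψ ∧ u ≠ -v ∧ u ∉ N) := by
    intro u hu
    by_cases huN : u ∈ N
    · exact Or.inl ⟨hNΦ huN, (hNne u huN).1⟩
    · rcases Finset.mem_union.1 hu with hu | hu <;> rw [Finset.mem_erase] at hu
      · exact Or.inl ⟨hu.2, hu.1⟩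
      · exact Or.inr ⟨hu.2, hu.1, huN⟩
  have hbase : IsBase Φ' := by
    have hmix : ∀ u ∈ Φ, u ≠ v → ∀ w ∈ Ψ, w ≠ -v → w ∉ N → u ≠ w →
        (∃ m : ℕ, 2 ≤ m ∧ lor u w = -Real.cos (Real.pi / m)) ∨ lor u w ≤ -1 := by
      intro u hu huv w hw hwv hwN huw
      by_cases huN : u ∈ N
      · exact hb'.angle u (hNΨ huN) w hw huw
      · exact Or.inr (hcross u hu huv huN w hw hwv hwN)
    refine ⟨fun u hu => ?_, fun u hu w hw huw => ?_, ?_⟩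
    · rcases hmem' u hu with hu | hu
      exacts [hb.unit u hu.1, hb'.unit u hu.1]
    · rcases hmem' u hu with ⟨h1, h2⟩ | ⟨h1, h2, h3⟩ <;>
        rcases hmem' w hw with ⟨h4, h5⟩ | ⟨h4, h5, h6⟩
      · exact hb.angle u h1 w h4 huw
      · exact hmix u h1 h2 w h4 h5 h6 huw
      · rw [lor_comm]; exact hmix w h4 h5 u h1 h2 h3 huw.symm
      · exact hb'.angle u h1 w h4 huw
    · obtain ⟨x, hx, hxi⟩ := hb.interior
      refine ⟨x, hx, fun u hu => ?_⟩
      rcases hmem' u hu with ⟨h1, h2⟩ | ⟨h1, h2, h3⟩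
      · exact hxi u h1
      · have := lor_neg_of_future hx (hfut₂ u h1 h2 h3)
        rw [lor_add_right, lor_neg_right] at this
        linarith [hxi v hvΦ]
  -- The hyperplane of `v` cuts the new polyhedron into the two pieces: walls from one side hold
  -- automatically on the other, by the nesting of half-spaces.
  have hbody : body (e' :: L) = polyhedron ↑Φ' := by
    rw [body_cons, h.body_eq, truncSimplex_eq]
    ext x
    constructor
    · rintro (hx | hx)
      · refine ⟨hx.1, fun u hu => ?_⟩
        rcases hmem' u hu with ⟨h1, h2⟩ | ⟨h1, h2, h3⟩
        · by_cases huN : u ∈ N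
          · exact hx.2 u (hNΨ huN)
          · have := lor_neg_of_future hx.1 (hfut₁ u h1 h2 huN)
            have h4 := hx.2 (-v) hvΨ
            rw [lor_neg_right] at h4
            rw [lor_add_right] at this
            linarith
        · exact hx.2 u h1
      · refine ⟨hx.1, fun u hu => ?_⟩
        rcases hmem' u hu with ⟨h1, h2⟩ | ⟨h1, h2, h3⟩
        · exact hx.2 u h1
        · have := lor_neg_of_future hx.1 (hfut₂ u h1 h2 h3)
          have h4 := hx.2 v hvΦ
          rw [lor_add_right, lor_neg_right] at this
          linarith
    · rintro ⟨hx, hxΦ⟩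
      rcases le_total (lor x v) 0 with hxv | hxv
      · refine Or.inr ⟨hx, fun u hu => ?_⟩
        by_cases huv : u = v
        · rw [huv]; exact hxv
        · exact hxΦ u (Finset.mem_union_left _ (Finset.mem_erase.2 ⟨huv, hu⟩))
      · refine Or.inl ⟨hx, fun u hu => ?_⟩
        by_cases huv : u = -v
        · rw [huv, lor_neg_right]; linarith
        · exact hxΦ u (Finset.mem_union_right _ (Finset.mem_erase.2 ⟨huv, hu⟩))
  have hnew : ∀ l, l ≠ i' → IsExposed Φ' e' l := by
    intro l hl
    have hlv : vertex e' l ≠ -v := by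
      rw [← hv']; exact fun h0 => hl (hg'.vertex_injective h0)
    have hlN : vertex e' l ∉ N := by
      rw [← hN]
      intro hmem
      obtain ⟨j, -, hj⟩ := mem_sideNormals.1 hmem
      exact hg'.vertex_ne_e l j hj.symm
    refine ⟨Finset.mem_union_right _ (Finset.mem_erase.2 ⟨hlv, vertex_mem e' l⟩),
      fun u hu => ?_, fun u hu hul => ?_⟩
    · refine Finset.mem_union_right _ (Finset.mem_erase.2 ⟨?_, sideNormals_subset e' l hu⟩)
      obtain ⟨j, -, rfl⟩ := mem_sideNormals.1 hu
      rw [← hv']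
      exact (hg'.vertex_ne_e i' j).symm
    · rcases hmem' u hu with ⟨h1, h2⟩ | ⟨h1, h2, h3⟩
      · by_cases huN : u ∈ N
        · exact hg'.mem_sideNormals_or (hNΨ huN) hul
        · exact Or.inr (hcross u h1 h2 huN _ (vertex_mem e' l) hlv hlN)
      · exact hg'.mem_sideNormals_or h1 hul
  refine ⟨Φ', ⟨?_, ?_, hbase, hbody, ?_, ?_⟩, i', hτ, ?_, hnew⟩
  · intro f hf
    rcases List.mem_cons.1 hf with rfl | hf
    exacts [h', h.copy f hf]
  · obtain ⟨u, hu⟩ : N.Nonempty := by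
      have : ∀ i : Fin 5, ∃ j, j ≠ i := by decide
      obtain ⟨j, hj⟩ := this i
      exact ⟨e j, mem_sideNormals.2 ⟨j, hj, rfl⟩⟩
    exact ⟨u, Finset.mem_union_left _ (hN₁ hu)⟩
  · intro u hu
    have hle : ∀ x ∈ body (e' :: L), lor x u ≤ 0 := fun x hx => by
      rw [hbody] at hx; exact hx.2 u hu
    rw [mem_facetNormals_iff]
    refine ⟨hbase.unit u hu, hle, fun y hy => ?_⟩
    rw [body_cons] at hy
    rcases Finset.mem_union.1 hu with hu | hu
    · exact (mem_facetNormals_iff.1 (h.facet (Finset.mem_of_mem_erase hu))).2.2 y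
        fun x hx => hy x (Or.inr hx)
    · exact (mem_facetNormals_iff.1 (h'.facetVectors_subset (Finset.mem_of_mem_erase hu))).2.2 y
        fun x hx => hy x (Or.inl hx)
  -- A side normal has a neighbour with product strictly between `-1` and `0`, whereas an exposed
  -- truncating normal has only products `0` or at most `-1` with the other walls.
  · have hnotside : ∀ {f : Fin 5 → LorentzSpace} {l : Fin 5}, HasGram f → IsExposed Φ f l →
        ∀ {g : Fin 5 → LorentzSpace} {k : Fin 5}, HasGram g →
          sideNormals g k ⊆ Φ → vertex f l ∉ sideNormals g k := by
      intro f l hgf hfl g k hgk hsub hmem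
      obtain ⟨w, hw, hw1, hw2⟩ := hgk.exists_neighbour hmem
      rw [lor_comm] at hw1 hw2
      have hne : w ≠ vertex f l := by
        rintro rfl
        rw [hgf.lor_vertex_self] at hw2
        linarith
      rcases hfl.2.2 w (hsub hw) hne with h1 | h1
      · rw [hgf.lor_sideNormals h1] at hw2
        exact lt_irrefl _ hw2
      · linarith
    intro f hf l
    rcases List.mem_cons.1 hf with rfl | hf
    · by_cases hl : l = i'
      · subst hl
        exact Or.inr ⟨e, List.mem_cons_of_mem _ he, i, by rw [hv', neg_neg], hN.symm⟩
      · exact Or.inl (hnew l hl)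
    · have hgf := (h.copy f hf).hasGram
      rcases h.ortho f hf l with hfl | ⟨e₂, he₂, i₂, hv₂, hN₂'⟩
      -- Another copy may have its own facet on the same wall `v`; its side normals are then also
      -- `N`, and the new copy covers it too.
      · by_cases hlv : vertex f l = v
        · refine Or.inr ⟨e', List.mem_cons_self, i', by rw [hv', hlv], ?_⟩
          rw [hN]
          refine Finset.Subset.antisymm (fun u hu => ?_) fun u hu => ?_
          · refine (hfl.2.2 u (hNΦ hu) (by rw [hlv]; exact (hNne u hu).1)).resolve_right ?_
            rw [hlv, hNv u hu]
            norm_num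
          · have h0 := hgf.lor_sideNormals hu
            rw [hlv] at h0
            refine (hcΦ u (hfl.2.1 hu) ?_).resolve_right (by rw [h0]; norm_num)
            rintro rfl
            rw [hvv] at h0
            exact one_ne_zero h0
        · refine Or.inl ⟨Finset.mem_union_left _ (Finset.mem_erase.2 ⟨hlv, hfl.1⟩),
            fun u hu => Finset.mem_union_left _ (Finset.mem_erase.2 ⟨?_, hfl.2.1 hu⟩),
            fun u hu hul => ?_⟩
          · rintro rfl
            exact hnotside hg ⟨hvΦ, hNΦ, hcΦ⟩ hgf hfl.2.1 hu
          · rcases hmem' u hu with ⟨h1, h2⟩ | ⟨h1, h2, h3⟩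
            · exact hfl.2.2 u h1 hul
            · rw [lor_comm]
              exact Or.inr (hcross _ hfl.1 hlv (hnotside hgf hfl hg hNΦ) u h1 h2 h3)
      · exact Or.inr ⟨e₂, List.mem_cons_of_mem _ he₂, i₂, hv₂, hN₂'⟩
  -- Restoring the deleted walls adds `t / (1 + t)` twice, and the overlap costs `1`, in units of
  -- the inverse growth series of `N`: in total `(t - 1) / (1 + t)`.
  · rw [hN, IsBase.invGrowth_union hbase fun u hu hu' w hw hw' => ?_, hinter,
      hb.invGrowth_erase hvΦ hNΦ hNv hcΦ, hb'.invGrowth_erase hvΨ hNΨ hNv' hcΨ]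
    · have := cyc2_ne_zero
      field_simp
      ring
    · rw [Finset.mem_erase] at hu hw
      exact hcross u hu.2 hu.1 (fun huN => hu' (hN₂ huN)) w hw.2 hw.1 fun hwN => hw' (hN₁ hwN)

end CoxeterDomino

end

/-! ### Evaluation of the inverse growth series of dominoes -/

noncomputable section

namespace CoxeterDomino

/-! ## Growth of the simplex and of its orthogonal facets -/

/-- The common denominator of the inverses of the growth series. -/
def cycProd : SeriesField :=
  (1 + tt) ^ 4 * (1 + tt + tt ^ 2) * (1 + tt ^ 2) * (1 + tt + tt ^ 2 + tt ^ 3 + tt ^ 4) *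
    (1 - tt + tt ^ 2) * (1 - tt + tt ^ 2 - tt ^ 3 + tt ^ 4)

theorem cycProd_ne_zero : cycProd ≠ 0 :=
  mul_ne_zero (mul_ne_zero (mul_ne_zero (mul_ne_zero (mul_ne_zero (pow_ne_zero 4 cyc2_ne_zero)
    cyc3_ne_zero) cyc4_ne_zero) cyc5_ne_zero) cyc6_ne_zero) cyc10_ne_zero

/-- The numerators belonging to the three types of orthogonal facets. -/
def sidePoly : FacetType → SeriesField
  | .A => -1 + 2 * tt - tt ^ 2 + tt ^ 3 - tt ^ 7 - tt ^ 11 + tt ^ 15 - tt ^ 16 + 2 * tt ^ 17 - tt ^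
      18
  | .B => -1 + 2 * tt - 2 * tt ^ 2 + 3 * tt ^ 3 - 3 * tt ^ 4 + 4 * tt ^ 5 - 5 * tt ^ 6 + 5 * tt ^ 7
      - 6 * tt ^ 8 + 6 * tt ^ 9 - 6 * tt ^ 10 + 5 * tt ^ 11 - 5 * tt ^ 12 + 4 * tt ^ 13 - 3 *
      tt ^ 14 + 3 * tt ^ 15 - 2 * tt ^ 16 + 2 * tt ^ 17 - tt ^ 18
  | .C => -1 + 2 * tt - tt ^ 2 + 2 * tt ^ 3 - tt ^ 6 - tt ^ 8 - tt ^ 10 - tt ^ 12 + 2 * tt ^ 15 -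
      tt ^ 16 + 2 * tt ^ 17 - tt ^ 18

namespace IsBase

variable {a b c d : LorentzSpace}

theorem sum_powerset_quad {f : Finset LorentzSpace → SeriesField} (hab : a ≠ b) (hac : a ≠ c)
    (had : a ≠ d) (hbc : b ≠ c) (hbd : b ≠ d) (hcd : c ≠ d) :
    ∑ I ∈ ({a, b, c, d} : Finset LorentzSpace).powerset, f I =
      f ∅ + f {a} + f {b} + f {c} + f {d} + f {a, b} + f {a, c} + f {a, d} + f {b, c} + f {b, d} +
        f {c, d} + f {a, b, c} + f {a, b, d} + f {a, c, d} + f {b, c, d} + f {a, b, c, d} := by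
  rw [Finset.sum_powerset_insert (by simpa using ⟨hab, hac, had⟩), sum_powerset_triple hbc hbd hcd,
    sum_powerset_triple hbc hbd hcd]
  simp only [insert_empty_eq]
  ring

/-- The witness is `a + b + c + d`, whose square is twice the left side of `hneg`. -/
theorem invTerm_eq_zero_of_cycle {I : Finset LorentzSpace} (h : IsBase I) (ha : a ∈ I) (hb : b ∈ I)
    (hc : c ∈ I) (hd : d ∈ I) (hneg : 2 + lor a b + lor a c + lor a d + lor b c + lor b d +
      lor c d ≤ 0) : invTerm I = 0 := by
  have hz : a + b + c + d ∈ cone I := add_mem_cone (add_mem_cone (add_mem_cone (subset_cone ha)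
    (subset_cone hb)) (subset_cone hc)) (subset_cone hd)
  refine h.invTerm_eq_zero hz ?_ ?_
  · intro h0
    obtain ⟨x, -, hx⟩ := h.interior
    have h1 : lor x (a + b + c + d) = 0 := by rw [h0, lor_zero_right]
    simp only [lor_add_right] at h1
    linarith [hx a ha, hx b hb, hx c hc, hx d hd]
  · simp only [lor_add_left, lor_add_right, h.unit a ha, h.unit b hb, h.unit c hc, h.unit d hd,
      lor_comm b a, lor_comm c a, lor_comm d a, lor_comm c b, lor_comm d b, lor_comm d c]
    linarith

/-- Equal weights do not suffice here. The best weight of the centre is `1 + cos (π / 5)`, and `9 /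
5` is a rational number close to it. -/
theorem invTerm_eq_zero_of_star {I : Finset LorentzSpace} (h : IsBase I) (ha : a ∈ I) (hb : b ∈ I)
    (hc : c ∈ I) (hd : d ∈ I) (hab : lor a b = -Real.cos (Real.pi / 5)) (hac : lor a c = -(1 / 2))
    (had : lor a d = -(1 / 2)) (hbc : lor b c = 0) (hbd : lor b d = 0) (hcd : lor c d = 0) :
    invTerm I = 0 := by
  have hz : (9 / 5 : ℝ) • a + b + c + d ∈ cone I := add_mem_cone (add_mem_cone (add_mem_cone
    (smul_mem_cone (by norm_num) (subset_cone ha)) (subset_cone hb)) (subset_cone hc))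
    (subset_cone hd)
  refine h.invTerm_eq_zero hz ?_ ?_
  · intro h0
    obtain ⟨x, -, hx⟩ := h.interior
    have h1 : lor x ((9 / 5 : ℝ) • a + b + c + d) = 0 := by rw [h0, lor_zero_right]
    simp only [lor_add_right, lor_smul_right] at h1
    linarith [hx a ha, hx b hb, hx c hc, hx d hd]
  · have := phi_gt
    rw [phi] at this
    simp only [lor_add_left, lor_add_right, lor_smul_left, lor_smul_right, h.unit a ha,
      h.unit b hb, h.unit c hc, h.unit d hd, lor_comm b a, lor_comm c a, lor_comm d a,
      lor_comm c b, lor_comm d b, lor_comm d c, hab, hac, had, hbc, hbd, hcd]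
    linarith

end IsBase

namespace IsCopy

variable {e : Fin 5 → LorentzSpace}

theorem isBase_of_subset (h : IsCopy e) {I : Finset LorentzSpace} (hI : I ⊆ facetVectors e) :
    IsBase I := h.isBase.mono hI

theorem e_mem (e : Fin 5 → LorentzSpace) (i : Fin 5) : e i ∈ facetVectors e :=
  mem_facetVectors.2 (Or.inl ⟨i, rfl⟩)

theorem subset_facetVectors (e : Fin 5 → LorentzSpace) (J : Finset (Fin 5)) :
    J.image e ⊆ facetVectors e := by
  intro u hu
  obtain ⟨j, -, rfl⟩ := Finset.mem_image.1 hu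
  exact e_mem e j

theorem base_pair (h : IsCopy e) (i j : Fin 5) : IsBase {e i, e j} :=
  h.isBase_of_subset (by have := subset_facetVectors e {i, j}; simpa using this)

theorem base_triple (h : IsCopy e) (i j k : Fin 5) : IsBase {e i, e j, e k} :=
  h.isBase_of_subset (by have := subset_facetVectors e {i, j, k}; simpa using this)

theorem base_quad (h : IsCopy e) (i j k l : Fin 5) : IsBase {e i, e j, e k, e l} :=
  h.isBase_of_subset (by have := subset_facetVectors e {i, j, k, l}; simpa using this)

theorem invTerm_nil (h : IsCopy e) : invTerm ∅ = 1 :=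
  IsBase.invTerm_empty (h.isBase_of_subset (Finset.empty_subset _))

theorem invTerm_one (h : IsCopy e) (i : Fin 5) : invTerm {e i} = -tt / (1 + tt) :=
  IsBase.invTerm_singleton (h.isBase_of_subset (by simpa using e_mem e i))

theorem lor_01 (h : IsCopy e) : lor (e 0) (e 1) = -Real.cos (Real.pi / 5) := by
  rw [h.1, gram]; rfl

theorem lor_02 (h : IsCopy e) : lor (e 0) (e 2) = 0 := by
  rw [h.1, gram]; rfl

theorem lor_03 (h : IsCopy e) : lor (e 0) (e 3) = -(1 / 2) := by
  rw [h.1, gram]; rfl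

theorem lor_04 (h : IsCopy e) : lor (e 0) (e 4) = 0 := by
  rw [h.1, gram]; rfl

theorem lor_12 (h : IsCopy e) : lor (e 1) (e 2) = -(1 / 2) := by
  rw [h.1, gram]; rfl

theorem lor_13 (h : IsCopy e) : lor (e 1) (e 3) = 0 := by
  rw [h.1, gram]; rfl

theorem lor_14 (h : IsCopy e) : lor (e 1) (e 4) = -(1 / 2) := by
  rw [h.1, gram]; rfl

theorem lor_23 (h : IsCopy e) : lor (e 2) (e 3) = -Real.cos (Real.pi / 5) := by
  rw [h.1, gram]; rfl

theorem lor_24 (h : IsCopy e) : lor (e 2) (e 4) = 0 := by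
  rw [h.1, gram]; rfl

theorem lor_34 (h : IsCopy e) : lor (e 3) (e 4) = -(1 / 2) := by
  rw [h.1, gram]; rfl

theorem invTerm_01 (h : IsCopy e) : invTerm {e 0, e 1} =
    tt ^ 5 / ((1 + tt) * (1 + tt + tt ^ 2 + tt ^ 3 + tt ^ 4)) :=
  (h.base_pair 0 1).invTerm_pair_five h.lor_01

theorem invTerm_02 (h : IsCopy e) : invTerm {e 0, e 2} =
    tt ^ 2 / (1 + tt) ^ 2 :=
  (h.base_pair 0 2).invTerm_pair_two h.lor_02

theorem invTerm_03 (h : IsCopy e) : invTerm {e 0, e 3} =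
    tt ^ 3 / ((1 + tt) * (1 + tt + tt ^ 2)) :=
  (h.base_pair 0 3).invTerm_pair_three h.lor_03

theorem invTerm_04 (h : IsCopy e) : invTerm {e 0, e 4} =
    tt ^ 2 / (1 + tt) ^ 2 :=
  (h.base_pair 0 4).invTerm_pair_two h.lor_04

theorem invTerm_12 (h : IsCopy e) : invTerm {e 1, e 2} =
    tt ^ 3 / ((1 + tt) * (1 + tt + tt ^ 2)) :=
  (h.base_pair 1 2).invTerm_pair_three h.lor_12

theorem invTerm_13 (h : IsCopy e) : invTerm {e 1, e 3} =
    tt ^ 2 / (1 + tt) ^ 2 :=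
  (h.base_pair 1 3).invTerm_pair_two h.lor_13

theorem invTerm_14 (h : IsCopy e) : invTerm {e 1, e 4} =
    tt ^ 3 / ((1 + tt) * (1 + tt + tt ^ 2)) :=
  (h.base_pair 1 4).invTerm_pair_three h.lor_14

theorem invTerm_23 (h : IsCopy e) : invTerm {e 2, e 3} =
    tt ^ 5 / ((1 + tt) * (1 + tt + tt ^ 2 + tt ^ 3 + tt ^ 4)) :=
  (h.base_pair 2 3).invTerm_pair_five h.lor_23

theorem invTerm_24 (h : IsCopy e) : invTerm {e 2, e 4} =
    tt ^ 2 / (1 + tt) ^ 2 :=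
  (h.base_pair 2 4).invTerm_pair_two h.lor_24

theorem invTerm_34 (h : IsCopy e) : invTerm {e 3, e 4} =
    tt ^ 3 / ((1 + tt) * (1 + tt + tt ^ 2)) :=
  (h.base_pair 3 4).invTerm_pair_three h.lor_34

theorem invTerm_012 (h : IsCopy e) : invTerm {e 0, e 1, e 2} =
    -tt ^ 15 / ((1 + tt) ^ 3 * (1 + tt + tt ^ 2) * (1 - tt + tt ^ 2) *
      (1 + tt + tt ^ 2 + tt ^ 3 + tt ^ 4) * (1 - tt + tt ^ 2 - tt ^ 3 + tt ^ 4)) := by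
  exact (h.base_triple 0 1 2).invTerm_triple_H h.lor_01 h.lor_02 h.lor_12

theorem invTerm_013 (h : IsCopy e) : invTerm {e 0, e 1, e 3} =
    -tt ^ 15 / ((1 + tt) ^ 3 * (1 + tt + tt ^ 2) * (1 - tt + tt ^ 2) *
      (1 + tt + tt ^ 2 + tt ^ 3 + tt ^ 4) * (1 - tt + tt ^ 2 - tt ^ 3 + tt ^ 4)) := by
  have hs : ({e 0, e 1, e 3} : Finset LorentzSpace) = {e 1, e 0, e 3} := by
    ext; simp; tauto
  rw [hs]
  exact (h.base_triple 1 0 3).invTerm_triple_H (by rw [lor_comm]; exact h.lor_01) h.lor_13 h.lor_03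

theorem invTerm_014 (h : IsCopy e) : invTerm {e 0, e 1, e 4} =
    -tt ^ 15 / ((1 + tt) ^ 3 * (1 + tt + tt ^ 2) * (1 - tt + tt ^ 2) *
      (1 + tt + tt ^ 2 + tt ^ 3 + tt ^ 4) * (1 - tt + tt ^ 2 - tt ^ 3 + tt ^ 4)) := by
  exact (h.base_triple 0 1 4).invTerm_triple_H h.lor_01 h.lor_04 h.lor_14

theorem invTerm_023 (h : IsCopy e) : invTerm {e 0, e 2, e 3} =
    -tt ^ 15 / ((1 + tt) ^ 3 * (1 + tt + tt ^ 2) * (1 - tt + tt ^ 2) *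
      (1 + tt + tt ^ 2 + tt ^ 3 + tt ^ 4) * (1 - tt + tt ^ 2 - tt ^ 3 + tt ^ 4)) := by
  have hs : ({e 0, e 2, e 3} : Finset LorentzSpace) = {e 2, e 3, e 0} := by
    ext; simp; tauto
  rw [hs]
  exact (h.base_triple 2 3 0).invTerm_triple_H h.lor_23 (by rw [lor_comm]; exact h.lor_02) (by rw [lor_comm]; exact h.lor_03)

theorem invTerm_024 (h : IsCopy e) : invTerm {e 0, e 2, e 4} =
    -tt ^ 3 / (1 + tt) ^ 3 := by
  exact (h.base_triple 0 2 4).invTerm_triple_orthogonal h.lor_02 h.lor_04 h.lor_24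

theorem invTerm_034 (h : IsCopy e) : invTerm {e 0, e 3, e 4} =
    -tt ^ 6 / ((1 + tt) ^ 2 * (1 + tt + tt ^ 2) * (1 + tt ^ 2)) := by
  exact (h.base_triple 0 3 4).invTerm_triple_A h.lor_03 h.lor_04 h.lor_34

theorem invTerm_123 (h : IsCopy e) : invTerm {e 1, e 2, e 3} =
    -tt ^ 15 / ((1 + tt) ^ 3 * (1 + tt + tt ^ 2) * (1 - tt + tt ^ 2) *
      (1 + tt + tt ^ 2 + tt ^ 3 + tt ^ 4) * (1 - tt + tt ^ 2 - tt ^ 3 + tt ^ 4)) := by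
  have hs : ({e 1, e 2, e 3} : Finset LorentzSpace) = {e 3, e 2, e 1} := by
    ext; simp; tauto
  rw [hs]
  exact (h.base_triple 3 2 1).invTerm_triple_H (by rw [lor_comm]; exact h.lor_23) (by rw [lor_comm]; exact h.lor_13) (by rw [lor_comm]; exact h.lor_12)

theorem invTerm_124 (h : IsCopy e) : invTerm {e 1, e 2, e 4} =
    -tt ^ 6 / ((1 + tt) ^ 2 * (1 + tt + tt ^ 2) * (1 + tt ^ 2)) := by
  have hs : ({e 1, e 2, e 4} : Finset LorentzSpace) = {e 2, e 1, e 4} := by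
    ext; simp; tauto
  rw [hs]
  exact (h.base_triple 2 1 4).invTerm_triple_A (by rw [lor_comm]; exact h.lor_12) h.lor_24 h.lor_14

theorem invTerm_134 (h : IsCopy e) : invTerm {e 1, e 3, e 4} =
    -tt ^ 6 / ((1 + tt) ^ 2 * (1 + tt + tt ^ 2) * (1 + tt ^ 2)) := by
  have hs : ({e 1, e 3, e 4} : Finset LorentzSpace) = {e 1, e 4, e 3} := by
    ext; simp; tauto
  rw [hs]
  exact (h.base_triple 1 4 3).invTerm_triple_A h.lor_14 h.lor_13 (by rw [lor_comm]; exact h.lor_34)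

theorem invTerm_234 (h : IsCopy e) : invTerm {e 2, e 3, e 4} =
    -tt ^ 15 / ((1 + tt) ^ 3 * (1 + tt + tt ^ 2) * (1 - tt + tt ^ 2) *
      (1 + tt + tt ^ 2 + tt ^ 3 + tt ^ 4) * (1 - tt + tt ^ 2 - tt ^ 3 + tt ^ 4)) := by
  exact (h.base_triple 2 3 4).invTerm_triple_H h.lor_23 h.lor_24 h.lor_34

/-- Four nodes form the graph of an orthogonal facet, a hyperbolic simplex with an infinite group.
So only subsets with at most three nodes contribute. -/
theorem invTerm_0123 (h : IsCopy e) : invTerm {e 0, e 1, e 2, e 3} = 0 :=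
  (h.base_quad 0 1 2 3).invTerm_eq_zero_of_cycle (a := e 0) (b := e 1)
    (c := e 2) (d := e 3) (by simp) (by simp) (by simp) (by simp) (by
      have := phi_gt
      rw [phi] at this
      rw [h.lor_01, h.lor_02, h.lor_03, h.lor_12, h.lor_13, h.lor_23]
      linarith)

theorem invTerm_0124 (h : IsCopy e) : invTerm {e 0, e 1, e 2, e 4} = 0 :=
  (h.base_quad 0 1 2 4).invTerm_eq_zero_of_star (a := e 1) (b := e 0)
    (c := e 2) (d := e 4) (by simp) (by simp) (by simp) (by simp)
    (by rw [lor_comm]; exact h.lor_01)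
    h.lor_12
    h.lor_14 h.lor_02 h.lor_04 h.lor_24

theorem invTerm_0134 (h : IsCopy e) : invTerm {e 0, e 1, e 3, e 4} = 0 :=
  (h.base_quad 0 1 3 4).invTerm_eq_zero_of_cycle (a := e 0) (b := e 1)
    (c := e 3) (d := e 4) (by simp) (by simp) (by simp) (by simp) (by
      have := phi_gt
      rw [phi] at this
      rw [h.lor_01, h.lor_03, h.lor_04, h.lor_13, h.lor_14, h.lor_34]
      linarith)

theorem invTerm_0234 (h : IsCopy e) : invTerm {e 0, e 2, e 3, e 4} = 0 :=
  (h.base_quad 0 2 3 4).invTerm_eq_zero_of_star (a := e 3) (b := e 2)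
    (c := e 0) (d := e 4) (by simp) (by simp) (by simp) (by simp)
    (by rw [lor_comm]; exact h.lor_23)
    (by rw [lor_comm]; exact h.lor_03)
    h.lor_34 (by rw [lor_comm]; exact h.lor_02) h.lor_24 h.lor_04

theorem invTerm_1234 (h : IsCopy e) : invTerm {e 1, e 2, e 3, e 4} = 0 :=
  (h.base_quad 1 2 3 4).invTerm_eq_zero_of_cycle (a := e 1) (b := e 2)
    (c := e 3) (d := e 4) (by simp) (by simp) (by simp) (by simp) (by
      have := phi_gt
      rw [phi] at this
      rw [h.lor_12, h.lor_13, h.lor_14, h.lor_23, h.lor_24, h.lor_34]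
      linarith)

theorem invTerm_01234 (h : IsCopy e) : invTerm {e 0, e 1, e 2, e 3, e 4} = 0 := by
  have hb : IsBase {e 0, e 1, e 2, e 3, e 4} := h.isBase_of_subset (by
    have := subset_facetVectors e {0, 1, 2, 3, 4}; simpa using this)
  refine hb.invTerm_eq_zero_of_cycle (a := e 0) (b := e 1)
    (c := e 2) (d := e 3) (by simp) (by simp) (by simp) (by simp) ?_
  have := phi_gt
  rw [phi] at this
  rw [h.lor_01, h.lor_02, h.lor_03, h.lor_12, h.lor_13, h.lor_23]
  linarith

theorem e_ne (h : IsCopy e) {i j : Fin 5} (hij : i ≠ j) : e i ≠ e j :=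
  fun h' => hij (h.hasGram.e_injective h')

theorem invGrowth_side_0 (h : IsCopy e) :
    (tt - 1) / (1 + tt) * invGrowth (sideNormals e 0) = sidePoly .A / cycProd := by
  have hs : sideNormals e 0 = {e 1, e 2, e 3, e 4} := by
    have : (Finset.univ.erase 0 : Finset (Fin 5)) = {1, 2, 3, 4} := by decide
    rw [sideNormals, this]
    simp
  rw [hs, (h.base_quad 1 2 3 4).invGrowth_eq_sum, IsBase.sum_powerset_quad (h.e_ne (by decide))
    (h.e_ne (by decide)) (h.e_ne (by decide)) (h.e_ne (by decide)) (h.e_ne (by decide))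
    (h.e_ne (by decide))]
  simp only [h.invTerm_nil, h.invTerm_one, h.invTerm_12, h.invTerm_13, h.invTerm_14, h.invTerm_23,
    h.invTerm_24, h.invTerm_34, h.invTerm_123, h.invTerm_124, h.invTerm_134, h.invTerm_234,
    h.invTerm_1234]
  rw [sidePoly, cycProd]
  have h2 := cyc2_ne_zero
  have h3 := cyc3_ne_zero
  have h4 := cyc4_ne_zero
  have h5 := cyc5_ne_zero
  have h6 := cyc6_ne_zero
  have h10 := cyc10_ne_zero
  field_simp
  ring

theorem invGrowth_side_1 (h : IsCopy e) :
    (tt - 1) / (1 + tt) * invGrowth (sideNormals e 1) = sidePoly .B / cycProd := by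
  have hs : sideNormals e 1 = {e 0, e 2, e 3, e 4} := by
    have : (Finset.univ.erase 1 : Finset (Fin 5)) = {0, 2, 3, 4} := by decide
    rw [sideNormals, this]
    simp
  rw [hs, (h.base_quad 0 2 3 4).invGrowth_eq_sum, IsBase.sum_powerset_quad (h.e_ne (by decide))
    (h.e_ne (by decide)) (h.e_ne (by decide)) (h.e_ne (by decide)) (h.e_ne (by decide))
    (h.e_ne (by decide))]
  simp only [h.invTerm_nil, h.invTerm_one, h.invTerm_02, h.invTerm_03, h.invTerm_04, h.invTerm_23,
    h.invTerm_24, h.invTerm_34, h.invTerm_023, h.invTerm_024, h.invTerm_034, h.invTerm_234,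
    h.invTerm_0234]
  rw [sidePoly, cycProd]
  have h2 := cyc2_ne_zero
  have h3 := cyc3_ne_zero
  have h4 := cyc4_ne_zero
  have h5 := cyc5_ne_zero
  have h6 := cyc6_ne_zero
  have h10 := cyc10_ne_zero
  field_simp
  ring

theorem invGrowth_side_2 (h : IsCopy e) :
    (tt - 1) / (1 + tt) * invGrowth (sideNormals e 2) = sidePoly .A / cycProd := by
  have hs : sideNormals e 2 = {e 0, e 1, e 3, e 4} := by
    have : (Finset.univ.erase 2 : Finset (Fin 5)) = {0, 1, 3, 4} := by decide
    rw [sideNormals, this]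
    simp
  rw [hs, (h.base_quad 0 1 3 4).invGrowth_eq_sum, IsBase.sum_powerset_quad (h.e_ne (by decide))
    (h.e_ne (by decide)) (h.e_ne (by decide)) (h.e_ne (by decide)) (h.e_ne (by decide))
    (h.e_ne (by decide))]
  simp only [h.invTerm_nil, h.invTerm_one, h.invTerm_01, h.invTerm_03, h.invTerm_04, h.invTerm_13,
    h.invTerm_14, h.invTerm_34, h.invTerm_013, h.invTerm_014, h.invTerm_034, h.invTerm_134,
    h.invTerm_0134]
  rw [sidePoly, cycProd]
  have h2 := cyc2_ne_zero
  have h3 := cyc3_ne_zero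
  have h4 := cyc4_ne_zero
  have h5 := cyc5_ne_zero
  have h6 := cyc6_ne_zero
  have h10 := cyc10_ne_zero
  field_simp
  ring

theorem invGrowth_side_3 (h : IsCopy e) :
    (tt - 1) / (1 + tt) * invGrowth (sideNormals e 3) = sidePoly .B / cycProd := by
  have hs : sideNormals e 3 = {e 0, e 1, e 2, e 4} := by
    have : (Finset.univ.erase 3 : Finset (Fin 5)) = {0, 1, 2, 4} := by decide
    rw [sideNormals, this]
    simp
  rw [hs, (h.base_quad 0 1 2 4).invGrowth_eq_sum, IsBase.sum_powerset_quad (h.e_ne (by decide))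
    (h.e_ne (by decide)) (h.e_ne (by decide)) (h.e_ne (by decide)) (h.e_ne (by decide))
    (h.e_ne (by decide))]
  simp only [h.invTerm_nil, h.invTerm_one, h.invTerm_01, h.invTerm_02, h.invTerm_04, h.invTerm_12,
    h.invTerm_14, h.invTerm_24, h.invTerm_012, h.invTerm_014, h.invTerm_024, h.invTerm_124,
    h.invTerm_0124]
  rw [sidePoly, cycProd]
  have h2 := cyc2_ne_zero
  have h3 := cyc3_ne_zero
  have h4 := cyc4_ne_zero
  have h5 := cyc5_ne_zero
  have h6 := cyc6_ne_zero
  have h10 := cyc10_ne_zero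
  field_simp
  ring

theorem invGrowth_side_4 (h : IsCopy e) :
    (tt - 1) / (1 + tt) * invGrowth (sideNormals e 4) = sidePoly .C / cycProd := by
  have hs : sideNormals e 4 = {e 0, e 1, e 2, e 3} := by
    have : (Finset.univ.erase 4 : Finset (Fin 5)) = {0, 1, 2, 3} := by decide
    rw [sideNormals, this]
    simp
  rw [hs, (h.base_quad 0 1 2 3).invGrowth_eq_sum, IsBase.sum_powerset_quad (h.e_ne (by decide))
    (h.e_ne (by decide)) (h.e_ne (by decide)) (h.e_ne (by decide)) (h.e_ne (by decide))
    (h.e_ne (by decide))]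
  simp only [h.invTerm_nil, h.invTerm_one, h.invTerm_01, h.invTerm_02, h.invTerm_03, h.invTerm_12,
    h.invTerm_13, h.invTerm_23, h.invTerm_012, h.invTerm_013, h.invTerm_023, h.invTerm_123,
    h.invTerm_0123]
  rw [sidePoly, cycProd]
  have h2 := cyc2_ne_zero
  have h3 := cyc3_ne_zero
  have h4 := cyc4_ne_zero
  have h5 := cyc5_ne_zero
  have h6 := cyc6_ne_zero
  have h10 := cyc10_ne_zero
  field_simp
  ring

theorem invGrowth_simplex (h : IsCopy e) : invGrowth (Finset.univ.image e) =
    (1 - tt - 2 * tt ^ 2 - 3 * tt ^ 3 - 3 * tt ^ 4 - 3 * tt ^ 5 - tt ^ 6 + tt ^ 7 + 4 * tt ^ 8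
      + 4 * tt ^ 9 + 5 * tt ^ 10 + 7 * tt ^ 11 + 8 * tt ^ 12 + 9 * tt ^ 13 + 7 * tt ^ 14 + 3 *
      tt ^ 15 + tt ^ 16 - tt ^ 17 - 4 * tt ^ 18) / cycProd := by
  have hs : Finset.univ.image e = {e 0, e 1, e 2, e 3, e 4} := by
    have : (Finset.univ : Finset (Fin 5)) = {0, 1, 2, 3, 4} := by decide
    rw [this]
    simp
  have hne : ∀ i j : Fin 5, i ≠ j → e i ≠ e j := fun i j hij => h.e_ne hij
  rw [(h.isBase_of_subset (subset_facetVectors e _)).invGrowth_eq_sum, hs,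
    Finset.sum_powerset_insert (by simp [hne]), IsBase.sum_powerset_quad (h.e_ne (by decide))
    (h.e_ne (by decide)) (h.e_ne (by decide)) (h.e_ne (by decide)) (h.e_ne (by decide))
    (h.e_ne (by decide)), IsBase.sum_powerset_quad (h.e_ne (by decide))
    (h.e_ne (by decide)) (h.e_ne (by decide)) (h.e_ne (by decide)) (h.e_ne (by decide))
    (h.e_ne (by decide))]
  simp only [insert_empty_eq, h.invTerm_nil, h.invTerm_one, h.invTerm_01, h.invTerm_02, h.invTerm_03, h.invTerm_04,
    h.invTerm_12, h.invTerm_13, h.invTerm_14, h.invTerm_23, h.invTerm_24, h.invTerm_34,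
    h.invTerm_012, h.invTerm_013, h.invTerm_014, h.invTerm_023, h.invTerm_024, h.invTerm_034,
    h.invTerm_123, h.invTerm_124, h.invTerm_134, h.invTerm_234, h.invTerm_0123, h.invTerm_0124,
    h.invTerm_0134, h.invTerm_0234, h.invTerm_1234, h.invTerm_01234]
  rw [cycProd]
  have h2 := cyc2_ne_zero
  have h3 := cyc3_ne_zero
  have h4 := cyc4_ne_zero
  have h5 := cyc5_ne_zero
  have h6 := cyc6_ne_zero
  have h10 := cyc10_ne_zero
  field_simp
  ring

theorem invGrowth_side (h : IsCopy e) (i : Fin 5) :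
    (tt - 1) / (1 + tt) * invGrowth (sideNormals e i) = sidePoly (facetType i) / cycProd := by
  fin_cases i
  exacts [h.invGrowth_side_0, h.invGrowth_side_1, h.invGrowth_side_2, h.invGrowth_side_3,
    h.invGrowth_side_4]

/-- Truncating walls are pairwise disjoint and meet only walls of the simplex, so they can be
removed one by one with independent corrections. -/
theorem invGrowth_truncations (h : IsCopy e) (S : Finset (Fin 5)) :
    invGrowth (Finset.univ.image e ∪ S.image (vertex e)) = invGrowth (Finset.univ.image e) -
      ∑ i ∈ S, tt / (1 + tt) * invGrowth (sideNormals e i) := by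
  have hg := h.hasGram
  induction S using Finset.induction_on with
  | empty => simp
  | insert a S ha ih =>
    have hsub : Finset.univ.image e ∪ (insert a S).image (vertex e) ⊆ facetVectors e :=
      Finset.union_subset_union_right (Finset.image_subset_image (Finset.subset_univ _))
    have hside : sideNormals e a ⊆ Finset.univ.image e :=
      Finset.image_subset_image (Finset.subset_univ _)
    rw [(h.isBase_of_subset hsub).invGrowth_erase (v := vertex e a) (N := sideNormals e a)
      (by simp) (hside.trans Finset.subset_union_left) (fun u hu => hg.lor_sideNormals hu)
      (fun u hu hua => hg.mem_sideNormals_or (hsub hu) hua), Finset.sum_insert ha]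
    have : (Finset.univ.image e ∪ (insert a S).image (vertex e)).erase (vertex e a) =
        Finset.univ.image e ∪ S.image (vertex e) := by
      ext u
      simp only [Finset.mem_erase, Finset.mem_union, Finset.mem_image, Finset.mem_univ, true_and,
        Finset.mem_insert]
      constructor
      · rintro ⟨h1, h2 | ⟨i, rfl | hi, rfl⟩⟩
        · exact Or.inl h2
        · exact absurd rfl h1
        · exact Or.inr ⟨i, hi, rfl⟩
      · rintro (⟨i, rfl⟩ | ⟨i, hi, rfl⟩)
        · exact ⟨(hg.vertex_ne_e a i).symm, Or.inl ⟨i, rfl⟩⟩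
        · refine ⟨fun h' => ha ?_, Or.inr ⟨i, Or.inr hi, rfl⟩⟩
          rwa [← hg.vertex_injective h']
    rw [this, ih]
    ring

/-- The inverse of the growth series of the truncated simplex. -/
theorem invGrowth_facetVectors (h : IsCopy e) : invGrowth (facetVectors e) =
    (1 - 6 * tt + 3 * tt ^ 2 - 5 * tt ^ 3 + 5 * tt ^ 4 - tt ^ 5 + 9 * tt ^ 6 + 11 * tt ^ 8 - 2
      * tt ^ 9 + 11 * tt ^ 10 + 9 * tt ^ 12 - tt ^ 13 + 5 * tt ^ 14 - 5 * tt ^ 15 + 3 * tt ^ 16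
      - 6 * tt ^ 17 + tt ^ 18) / cycProd := by
  have h1 : ∀ i, tt / (1 + tt) * invGrowth (sideNormals e i) =
      tt / (tt - 1) * (sidePoly (facetType i) / cycProd) := by
    intro i
    have h2 := cyc2_ne_zero
    have h3 : tt - 1 ≠ 0 := by
      have := one_sub_tt_pow_ne_zero (m := 1) one_ne_zero
      rw [pow_one] at this
      exact fun h => this (by linear_combination -h)
    rw [← h.invGrowth_side]
    field_simp
  have h3 : tt - 1 ≠ 0 := by
    have := one_sub_tt_pow_ne_zero (m := 1) one_ne_zero
    rw [pow_one] at this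
    exact fun h => this (by linear_combination -h)
  have h4 := cycProd_ne_zero
  rw [facetVectors, h.invGrowth_truncations, h.invGrowth_simplex]
  simp only [h1, Fin.sum_univ_five, facetType, Matrix.cons_val, sidePoly]
  field_simp
  ring

end IsCopy

/-- The inverse of the growth series of a domino. -/
theorem IsDomino.exists_tiling {ℓ m n : ℕ} {L : List (Fin 5 → LorentzSpace)}
    (h : IsDomino ℓ m n L) : ∃ Φ, IsTiling L Φ ∧ ∃ c : ℕ, n = ℓ + m + c ∧
      invGrowth Φ = ((n + 1) * (1 - 6 * tt + 3 * tt ^ 2 - 5 * tt ^ 3 + 5 * tt ^ 4 - tt ^ 5 + 9 * tt ^ 6 + 11 * tt ^ 8 -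
        2 * tt ^ 9 + 11 * tt ^ 10 + 9 * tt ^ 12 - tt ^ 13 + 5 * tt ^ 14 - 5 * tt ^ 15 + 3 * tt
        ^ 16 - 6 * tt ^ 17 + tt ^ 18) +
        ℓ * sidePoly .A + m * sidePoly .B + c * sidePoly .C) / cycProd := by
  have h4 := cycProd_ne_zero
  induction h with
  | single h => exact ⟨_, h.isTiling, 0, rfl, by rw [h.invGrowth_facetVectors]; simp⟩
  | glueA _ hG ih =>
    obtain ⟨Φ, hT, c, rfl, hΦ⟩ := ih
    obtain ⟨Φ', hT', i, hi, hg, -⟩ := hT.glue hG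
    refine ⟨Φ', hT', c, by ring, ?_⟩
    rw [hg, hΦ, hG.1.invGrowth_side, hG.1.invGrowth_facetVectors, hi]
    push_cast
    field_simp
    ring
  | glueB _ hG ih =>
    obtain ⟨Φ, hT, c, rfl, hΦ⟩ := ih
    obtain ⟨Φ', hT', i, hi, hg, -⟩ := hT.glue hG
    refine ⟨Φ', hT', c, by ring, ?_⟩
    rw [hg, hΦ, hG.1.invGrowth_side, hG.1.invGrowth_facetVectors, hi]
    push_cast
    field_simp
    ring
  | glueC _ hG ih =>
    obtain ⟨Φ, hT, c, rfl, hΦ⟩ := ih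
    obtain ⟨Φ', hT', i, hi, hg, -⟩ := hT.glue hG
    refine ⟨Φ', hT', c + 1, by ring, ?_⟩
    rw [hg, hΦ, hG.1.invGrowth_side, hG.1.invGrowth_facetVectors, hi]
    push_cast
    field_simp
    ring

end CoxeterDomino

end

/-! ### Existence of the simplex and of dominoes of every size -/

noncomputable section

namespace CoxeterDomino

/-! ## Existence of a copy -/

/-- The inner product in rescaled coordinates. -/
theorem lor_mul (a b w : LorentzSpace) : lor (a * w) (b * w) =
    a 0 * b 0 * w 0 ^ 2 + a 1 * b 1 * w 1 ^ 2 + a 2 * b 2 * w 2 ^ 2 + a 3 * b 3 * w 3 ^ 2 -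
      a 4 * b 4 * w 4 ^ 2 := by
  simp only [lor, Pi.mul_apply]
  ring

/-- Coordinates of vectors with the prescribed Gram matrix, from the decomposition of this matrix
as a product of a triangular, a diagonal and a triangular matrix. -/
def modelCoord : Matrix (Fin 5) (Fin 5) ℝ :=
  !![1, 0, 0, 0, 0;
     -(phi / 2), 1, 0, 0, 0;
     0, -(4 / 5) - 2 * phi / 5, 1, 0, 0;
     -(1 / 2), -(1 / 5) - 3 * phi / 5, -1 - 5 * phi / 2, 0, 1;
     0, -(4 / 5) - 2 * phi / 5, -1 - phi, 1, -(2 / 11) + 6 * phi / 11]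

theorem exists_hasGram : ∃ e, HasGram e := by
  have hp := phi_lt
  have hp' := phi_pos
  have h2 := phi_sq
  have h3 : phi ^ 3 = 2 * phi + 1 := by linear_combination (phi + 1) * phi_sq
  -- The entries are square roots of the absolute values of the pivots. The negative pivot is that
  -- of row 3, so this row has its leading `1` in the timelike coordinate, and row 4 has it in
  -- coordinate 3.
  set w : LorentzSpace := ![1, Real.sqrt (3 / 4 - phi / 4), Real.sqrt (3 / 5 - phi / 5),
    Real.sqrt (9 / 11 + 6 * phi / 11), Real.sqrt (3 / 2 + 13 * phi / 4)] with hw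
  have w0 : w 0 ^ 2 = 1 := by simp [hw]
  have w1 : w 1 ^ 2 = 3 / 4 - phi / 4 := Real.sq_sqrt (by linarith)
  have w2 : w 2 ^ 2 = 3 / 5 - phi / 5 := Real.sq_sqrt (by linarith)
  have w3 : w 3 ^ 2 = 9 / 11 + 6 * phi / 11 := Real.sq_sqrt (by linarith)
  have w4 : w 4 ^ 2 = 3 / 2 + 13 * phi / 4 := Real.sq_sqrt (by linarith)
  refine ⟨fun i => modelCoord i * w, fun i j => ?_⟩
  rw [lor_mul, w0, w1, w2, w3, w4, gram_eq]
  fin_cases i <;> fin_cases j <;> simp [modelCoord] <;> ring_nf <;>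
    (try simp only [h3, h2]) <;> ring_nf

theorem HasGram.neg {e : Fin 5 → LorentzSpace} (h : HasGram e) : HasGram (-e) := fun i j => by
  rw [Pi.neg_apply, Pi.neg_apply, lor_neg_left, lor_neg_right, neg_neg, h]

theorem HasGram.isCopy_of_isTime {e : Fin 5 → LorentzSpace} (h : HasGram e) {i k : Fin 5}
    (hik : i ≠ k) (ht : IsTime (edgePt e i k)) : IsCopy e := by
  obtain ⟨a, ha, hmem⟩ := ht.exists_smul_mem
  refine ⟨h, a • edgePt e i k, mem_truncSimplex.2 ⟨hmem, fun j => ?_, fun j => ?_⟩⟩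
  · exact (lor_smul_nonpos ha).2 (h.lor_edgePt_e_nonpos hik j)
  · exact (lor_smul_nonpos ha).2 (h.lor_edgePt_vertex_nonpos hik j)

theorem vertex_neg (e : Fin 5 → LorentzSpace) (i : Fin 5) : vertex (-e) i = -vertex e i := by
  simp [vertex]

theorem edgePt_neg (e : Fin 5 → LorentzSpace) (i k : Fin 5) :
    edgePt (-e) i k = -edgePt e i k := by
  rw [edgePt, edgePt, vertex_neg, vertex_neg, lor_neg_left, lor_neg_right, neg_neg]
  module

theorem exists_isCopy : ∃ e, IsCopy e := by
  obtain ⟨e, h⟩ := exists_hasGram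
  have h01 : (0 : Fin 5) ≠ 1 := by decide
  have h1 := h.lor_edgePt_self h01
  rcases causal_trichotomy h1.le with h' | h' | h'
  · rw [h', lor_zero_left] at h1; exact absurd h1 (lt_irrefl _)
  · exact ⟨e, h.isCopy_of_isTime h01 ⟨h1, h'.2⟩⟩
  · refine ⟨-e, h.neg.isCopy_of_isTime h01 ?_⟩
    rw [edgePt_neg]
    exact ⟨by rwa [lor_neg_left, lor_neg_right, neg_neg], h'.2⟩

/-! ## Reflected copies -/

theorem vertex_comp (w : LorentzSpace ≃ₗ[ℝ] LorentzSpace) (e : Fin 5 → LorentzSpace) (i : Fin 5) :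
    vertex (w ∘ e) i = w (vertex e i) := by
  simp [vertex]

theorem IsOrtho.map_mem {w : LorentzSpace ≃ₗ[ℝ] LorentzSpace} (hw : IsOrtho w) {x : LorentzSpace}
    (hx : x ∈ hyperbolicSpace) : w x ∈ hyperbolicSpace :=
  ⟨by rw [hw.1, hx.1], (hw.2 x (IsFuture.of_mem hx)).2⟩

theorem IsCopy.map {w : LorentzSpace ≃ₗ[ℝ] LorentzSpace} (hw : IsOrtho w)
    {e : Fin 5 → LorentzSpace} (h : IsCopy e) : IsCopy (w ∘ e) := by
  refine ⟨fun i j => by rw [Function.comp_apply, Function.comp_apply, hw.1, h.1], ?_⟩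
  obtain ⟨x, hx⟩ := h.2
  rw [mem_truncSimplex] at hx
  refine ⟨w x, mem_truncSimplex.2 ⟨hw.map_mem hx.1, fun i => ?_, fun i => ?_⟩⟩
  · rw [Function.comp_apply, hw.1]; exact hx.2.1 i
  · rw [vertex_comp, hw.1]; exact hx.2.2 i

/-- Dropping `e i` and the other truncations leaves only data fixed by the reflection in the facet,
up to the sign of `vertex e i`. -/
theorem HasGram.mem_orthFacet {e : Fin 5 → LorentzSpace} (h : HasGram e) {i : Fin 5}
    {x : LorentzSpace} : x ∈ orthFacet e i ↔
      x ∈ hyperbolicSpace ∧ lor x (vertex e i) = 0 ∧ ∀ j, j ≠ i → lor x (e j) ≤ 0 := by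
  constructor
  · rintro ⟨hx, hxi⟩
    rw [mem_truncSimplex] at hx
    exact ⟨hx.1, hxi, fun j _ => hx.2.1 j⟩
  · rintro ⟨hx, hxi, hxj⟩
    have hx0 : x ≠ 0 := by
      rintro rfl
      exact lt_irrefl _ hx.2
    obtain ⟨h1, h2⟩ := h.neg_of_truncating hx0 hxi hxj
    refine ⟨mem_truncSimplex.2 ⟨hx, fun j => ?_, fun j => ?_⟩, hxi⟩
    · by_cases hj : j = i
      · rw [hj]; exact h1.le
      · exact hxj j hj
    · by_cases hj : j = i
      · rw [hj, hxi]
      · exact (h2 j hj).le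

/-- A copy can be glued to every exposed orthogonal facet. -/
theorem IsTiling.exists_glues {L : List (Fin 5 → LorentzSpace)} {Φ : Finset LorentzSpace}
    (h : IsTiling L Φ) {e : Fin 5 → LorentzSpace} (he : e ∈ L) {i : Fin 5}
    (hexp : IsExposed Φ e i) : ∃ e', Glues (facetType i) L e' := by
  have hc := h.copy e he
  have hg := hc.hasGram
  have hv := hg.lor_vertex_self i
  have hc' := hc.map (isOrtho_refl hv)
  -- The new copy is the mirror image in the exposed facet: the adjacent normals are fixed and the
  -- truncating normal changes sign.
  set e' := refl (vertex e i) ∘ e with he'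
  have hvi : vertex e' i = -vertex e i := by rw [he', vertex_comp, refl_self hv]
  have hej : ∀ j, j ≠ i → e' j = e j := fun j hj => by
    rw [he', Function.comp_apply, refl_apply hv, lor_comm, hg.lor_vertex_e hj.symm]
    module
  have heq : orthFacet e i = orthFacet e' i := by
    ext x
    rw [hg.mem_orthFacet, hc'.hasGram.mem_orthFacet, hvi, lor_neg_right, neg_eq_zero]
    refine and_congr_right fun _ => and_congr_right fun _ => forall₂_congr fun j hj => ?_
    rw [hej j hj]
  refine ⟨e', hc', e, he, i, i, rfl, rfl, heq, Set.Subset.antisymm ?_ fun x hx => ⟨?_, hx.1⟩⟩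
  · rintro x ⟨hx, hx'⟩
    refine ⟨hx', ?_⟩
    rw [h.body_eq] at hx
    have h1 := hx.2 _ hexp.1
    have h2 := (mem_truncSimplex.1 hx').2.2 i
    rw [hvi, lor_neg_right] at h2 ⊢
    linarith
  · rw [← heq] at hx
    exact ⟨e, he, hx.1⟩

/-- If two orthogonal facets have the same type, then polytopes can be built by gluing along facets
of this type only. -/
theorem exists_tiling_of_step {τ : FacetType} (hτ : ∃ i, facetType i = τ)
    (hτ' : ∀ i, ∃ l, l ≠ i ∧ facetType l = τ) (P : ℕ → List (Fin 5 → LorentzSpace) → Prop)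
    (h0 : ∀ e, IsCopy e → P 0 [e]) (hstep : ∀ n L e, P n L → Glues τ L e → P (n + 1) (e :: L))
    (n : ℕ) : ∃ L, P n L := by
  -- The induction carries a free facet of type `τ`; after each gluing the new copy supplies the
  -- next one.
  suffices hs : ∃ L Φ e i, P n L ∧ IsTiling L Φ ∧ e ∈ L ∧ facetType i = τ ∧ IsExposed Φ e i by
    obtain ⟨L, -, -, -, hL, -⟩ := hs
    exact ⟨L, hL⟩
  induction n with
  | zero =>
    obtain ⟨e, he⟩ := exists_isCopy
    obtain ⟨i, hi⟩ := hτ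
    exact ⟨[e], _, e, i, h0 e he, he.isTiling, List.mem_singleton_self e, hi, he.isExposed i⟩
  | succ n ih =>
    obtain ⟨L, Φ, e, i, hP, hT, he, hi, hexp⟩ := ih
    obtain ⟨e', hG⟩ := hT.exists_glues he hexp
    rw [hi] at hG
    obtain ⟨Φ', hT', i', -, -, hnew⟩ := hT.glue hG
    obtain ⟨l, hl, hlτ⟩ := hτ' i'
    exact ⟨e' :: L, Φ', e', l, hstep n L e' hP hG, hT', List.mem_cons_self, hlτ, hnew l hl⟩

theorem facetType_pair_A (i : Fin 5) : ∃ l, l ≠ i ∧ facetType l = FacetType.A := by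
  by_cases h : i = 0
  · exact ⟨2, by rw [h]; decide, rfl⟩
  · exact ⟨0, Ne.symm h, rfl⟩

theorem facetType_pair_B (i : Fin 5) : ∃ l, l ≠ i ∧ facetType l = FacetType.B := by
  by_cases h : i = 1
  · exact ⟨3, by rw [h]; decide, rfl⟩
  · exact ⟨1, Ne.symm h, rfl⟩

theorem exists_isDomino_A (n : ℕ) : ∃ L, IsDomino n 0 n L :=
  exists_tiling_of_step ⟨0, rfl⟩ facetType_pair_A (fun n L => IsDomino n 0 n L)
    (fun _ => IsDomino.single) (fun _ _ _ => IsDomino.glueA) n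

theorem exists_isDomino_B (n : ℕ) : ∃ L, IsDomino 0 n n L :=
  exists_tiling_of_step ⟨1, rfl⟩ facetType_pair_B (fun n L => IsDomino 0 n n L)
    (fun _ => IsDomino.single) (fun _ _ _ => IsDomino.glueB) n

end CoxeterDomino

end

/-! ### Irreducibility by reduction modulo 3 -/

noncomputable section

namespace CoxeterDomino

/-! ## Computation in quotients of polynomial rings modulo 3 -/

/-- The value at `x` of the polynomial with coefficients `l`. -/
def listEval {K : Type*} [CommRing K] (x : K) : List ℕ → K
  | [] => 0
  | a :: l => a + x * listEval x l

/-- Addition of coefficient lists modulo 3. -/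
def listAdd : List ℕ → List ℕ → List ℕ
  | [], m => m
  | a :: l, [] => a :: l
  | a :: l, b :: m => (a + b) % 3 :: listAdd l m

/-- Multiplication of a coefficient list by a scalar modulo 3. -/
def listSMul (c : ℕ) : List ℕ → List ℕ
  | [] => []
  | a :: l => c * a % 3 :: listSMul c l

/-- Multiplication by `x` of a coefficient list, where `x ^ g.length` is represented by `g`. -/
def listShift (g l : List ℕ) : List ℕ :=
  -- A single overflowing coefficient `c` stands for `c * x ^ g.length` and is folded back through
  -- `g`.
  match (0 :: l).drop g.length with
  | [c] => listAdd ((0 :: l).take g.length) (listSMul c g)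
  | _ => 0 :: l

/-- Multiplication of coefficient lists, where `x ^ g.length` is represented by `g`. -/
def listMul (g : List ℕ) : List ℕ → List ℕ → List ℕ
  | [], _ => []
  | a :: l, m => listAdd (listSMul a m) (listShift g (listMul g l m))

/-- The cube of a coefficient list modulo 3, where `x ^ g.length` is represented by `g`. -/
def listCube (g : List ℕ) : List ℕ → List ℕ
  | [] => []
  | a :: l => listAdd [a] (listShift g (listShift g (listShift g (listCube g l))))

theorem listEval_take_drop {K : Type*} [CommRing K] (x : K) (n : ℕ) (l : List ℕ) :
    listEval x l = listEval x (l.take n) + x ^ n * listEval x (l.drop n) := by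
  induction n generalizing l with
  | zero => simp [listEval]
  | succ n ih =>
    cases l with
    | nil => simp [listEval]
    | cons a l =>
      rw [List.take_succ_cons, List.drop_succ_cons, listEval, listEval, ih l]
      ring

section Eval

variable {K : Type*} [CommRing K] [CharP K 3] {x : K} {g : List ℕ}

theorem natCast_mod_three (a : ℕ) : ((a % 3 : ℕ) : K) = a := by
  conv_rhs => rw [← Nat.mod_add_div a 3]
  rw [Nat.cast_add, Nat.cast_mul, CharP.cast_eq_zero K 3, zero_mul, add_zero]

theorem listEval_add (l m : List ℕ) :
    listEval x (listAdd l m) = listEval x l + listEval x m := by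
  induction l generalizing m with
  | nil => simp [listAdd, listEval]
  | cons a l ih =>
    cases m with
    | nil => simp [listAdd, listEval]
    | cons b m =>
      rw [listAdd, listEval, ih, natCast_mod_three, listEval, listEval, Nat.cast_add]
      ring

theorem listEval_smul (c : ℕ) (l : List ℕ) :
    listEval x (listSMul c l) = c * listEval x l := by
  induction l with
  | nil => simp [listSMul, listEval]
  | cons a l ih =>
    rw [listSMul, listEval, ih, natCast_mod_three, listEval, Nat.cast_mul]
    ring

theorem listEval_shift (hg : x ^ g.length = listEval x g) (l : List ℕ) :
    listEval x (listShift g l) = x * listEval x l := by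
  have h0 : listEval x (0 :: l) = x * listEval x l := by simp [listEval]
  rw [listShift]
  split
  · next c hc =>
    rw [listEval_add, listEval_smul, ← h0, listEval_take_drop x g.length (0 :: l), hc, hg]
    simp [listEval, mul_comm]
  · exact h0

theorem listEval_mul (hg : x ^ g.length = listEval x g) (l m : List ℕ) :
    listEval x (listMul g l m) = listEval x l * listEval x m := by
  induction l with
  | nil => simp [listMul, listEval]
  | cons a l ih =>
    rw [listMul, listEval_add, listEval_smul, listEval_shift hg, ih, listEval]
    ring

/-- In characteristic 3 cubing is additive and fixes the coefficients, so it only replaces `x` by `x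
^ 3`: three shifts per coefficient. -/
theorem listEval_cube (hg : x ^ g.length = listEval x g) (l : List ℕ) :
    listEval x (listCube g l) = listEval x l ^ 3 := by
  have : Fact (Nat.Prime 3) := ⟨Nat.prime_three⟩
  have : ExpChar K 3 := ExpChar.prime Nat.prime_three
  induction l with
  | nil => simp [listCube, listEval]
  | cons a l ih =>
    have ha : (a : K) ^ 3 = a := map_natCast (frobenius K 3) a
    rw [listCube, listEval_add, listEval_shift hg, listEval_shift hg, listEval_shift hg, ih,
      listEval, listEval, listEval, add_pow_char, ha]
    ring

theorem listEval_cube_iterate (hg : x ^ g.length = listEval x g) (d : ℕ) (l : List ℕ) :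
    listEval x ((listCube g)^[d] l) = listEval x l ^ 3 ^ d := by
  induction d with
  | zero => simp
  | succ d ih => rw [Function.iterate_succ_apply', listEval_cube hg, ih, ← pow_mul, pow_succ]

end Eval

/-- A certificate that no root of the polynomial belongs to a field with `3 ^ d` elements, where
`d` is at most 9. -/
def IsCertificate (g : List ℕ) (v : ℕ → List ℕ) : Prop :=
  ∀ d ∈ [5, 6, 7, 8, 9],
    -- The list `[0, 2]` is `-x` modulo 3, so `v d` is an inverse of `x ^ 3 ^ d - x` modulo the
    -- polynomial.
    listMul g (v d) (listAdd ((listCube g)^[d] [0, 1]) [0, 2]) = 1 :: List.replicate 17 0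

theorem IsCertificate.pow_ne {g : List ℕ} {v : ℕ → List ℕ} (h : IsCertificate g v) {K : Type*}
    [Field K] [CharP K 3] {x : K} (hg : x ^ g.length = listEval x g) {d : ℕ}
    (hd : d ∈ [5, 6, 7, 8, 9]) : x ^ 3 ^ d ≠ x := by
  intro hx
  have h1 := congrArg (listEval x) (h d hd)
  have h3 : (3 : K) = 0 := mod_cast CharP.cast_eq_zero K 3
  rw [listEval_mul hg, listEval_add, listEval_cube_iterate hg] at h1
  simp only [listEval, List.replicate, Nat.cast_zero, Nat.cast_one, mul_zero, add_zero, mul_one,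
    zero_add, hx, Nat.cast_ofNat] at h1
  refine one_ne_zero (α := K) ?_
  rw [← h1]
  linear_combination (listEval x (v d) * x) * h3

open Polynomial in
/-- Irreducibility over the field with three elements from a certificate. -/
theorem IsCertificate.irreducible {g : List ℕ} {v : ℕ → List ℕ} (h : IsCertificate g v)
    {f : (ZMod 3)[X]} (hf : f.Monic) (hdeg : f.natDegree ≤ 19)
    (hdeg' : f.natDegree ≠ 0)
    (hroot : ∀ (K : Type) [Field K] [Algebra (ZMod 3) K] (x : K), aeval x f = 0 →
      x ^ g.length = listEval x g) : Irreducible f := by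
  have : Fact (Nat.Prime 3) := ⟨Nat.prime_three⟩
  -- A reducible `f` has a factor of at most half its degree, hence an irreducible factor `p` of
  -- degree at most 9.
  rw [hf.irreducible_iff_lt_natDegree_lt (by rintro rfl; simp at hdeg')]
  intro q hq hqdeg hqf
  rw [Finset.mem_Ioc] at hqdeg
  obtain ⟨p, hp, hpq⟩ := Polynomial.exists_irreducible_of_natDegree_pos hqdeg.1
  have : Fact (Irreducible p) := ⟨hp⟩
  have hp0 := hp.ne_zero
  have hle : p.natDegree ≤ 9 := (natDegree_le_of_dvd hpq hq.ne_zero).trans (by omega)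
  have hpos : 0 < p.natDegree := hp.natDegree_pos
  set K := AdjoinRoot p
  let b := (AdjoinRoot.powerBasis hp0)
  have : Module.Finite (ZMod 3) K := b.finite
  have : Finite K := Module.finite_of_finite (ZMod 3)
  have : Fintype K := Fintype.ofFinite K
  have : CharP K 3 := charP_of_injective_algebraMap (algebraMap (ZMod 3) K).injective 3
  have hcard : Fintype.card K = 3 ^ p.natDegree := by
    rw [Module.card_eq_pow_finrank (K := ZMod 3), ZMod.card, b.finrank,
      AdjoinRoot.powerBasis_dim]
  have hx : aeval (AdjoinRoot.root p) f = 0 := by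
    obtain ⟨r, hr⟩ := hpq.trans hqf
    rw [hr, map_mul, AdjoinRoot.aeval_eq, AdjoinRoot.mk_self, zero_mul]
  have hg := hroot K _ hx
  -- The exponents 5 to 9 suffice because every degree from 1 to 9 divides one of them.
  have hex : ∃ d ∈ [5, 6, 7, 8, 9], p.natDegree ∣ d := by
    have : ∀ m : ℕ, m ≤ 9 → 0 < m → ∃ d ∈ [5, 6, 7, 8, 9], m ∣ d := by decide
    exact this _ hle hpos
  obtain ⟨d, hd, c, hc⟩ := hex
  refine h.pow_ne hg hd ?_
  rw [hc, pow_mul, ← hcard, FiniteField.pow_card_pow]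

/-- The first list holds the negated coefficients of `Q 1 0 1` below degree 18, modulo 3; the others
are the inverses for the exponents 5 to 9. -/
theorem isCertificate_A : IsCertificate [2, 1, 1, 0, 2, 2, 0, 1, 2, 1, 2, 1, 0, 2, 2, 0, 1, 1]
    fun d => ([[2, 0, 1, 2, 1, 2, 1, 2, 2, 0, 1, 2, 1, 0, 2, 0, 2, 2],
      [1, 1, 2, 2, 2, 1, 0, 0, 0, 1, 1, 2, 1, 2, 1, 2],
      [2, 2, 2, 2, 1, 0, 2, 2, 2, 0, 1, 0, 0, 2, 0, 0, 1],
      [1, 1, 0, 0, 1, 2, 2, 0, 0, 1, 0, 0, 1, 1, 1, 1, 1],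
      [0, 0, 1, 1, 1, 0, 0, 0, 1, 2, 2, 1, 0, 1, 2, 0, 2, 1]]).getD (d - 5) [] := by
  unfold IsCertificate
  decide +kernel

theorem isCertificate_B : IsCertificate [2, 1, 2, 1, 2, 1, 2, 1, 2, 1, 2, 1, 2, 1, 2, 1, 2, 1]
    fun d => ([[0, 2, 2, 0, 0, 2, 2, 0, 1, 2, 2, 0, 1, 1, 2, 0, 1, 1],
      [2, 1, 2, 1, 2, 1, 1, 2, 1, 2, 1, 2],
      [2, 2, 0, 1, 1, 0, 2, 2, 0, 1, 1, 0, 2, 2, 0, 1, 1],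
      [2, 2, 0, 1, 2, 2, 0, 1, 1, 2, 0, 1, 1, 0, 0, 1, 1],
      [0, 0, 1, 2, 2, 1, 0, 0, 1, 2, 2, 1, 0, 0, 1, 2, 2, 1]]).getD (d - 5) [] := by
  unfold IsCertificate
  decide +kernel

open Polynomial

theorem monic_Q (ℓ m n : ℤ) : (Q ℓ m n).Monic := by
  unfold Q
  monicity!

theorem natDegree_Q (ℓ m n : ℤ) : (Q ℓ m n).natDegree = 18 := by
  unfold Q
  compute_degree!

theorem aeval_Q {K : Type*} [CommRing K] (ℓ m n : ℤ) (x : K) : aeval x (Q ℓ m n) =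
    x ^ 18 - (4 * n + 6) * x ^ 17 + (2 * n - m + 3) * x ^ 16 - (3 * n - m + ℓ + 5) * x ^ 15 +
      (5 * n - 3 * m + 5) * x ^ 14 - (n - 4 * m + 1) * x ^ 13 +
      (8 * n - 4 * m + ℓ + 9) * x ^ 12 + (5 * m - ℓ) * x ^ 11 +
      (10 * n - 5 * m + ℓ + 11) * x ^ 10 - (2 * n - 6 * m + 2) * x ^ 9 +
      (10 * n - 5 * m + ℓ + 11) * x ^ 8 + (5 * m - ℓ) * x ^ 7 +
      (8 * n - 4 * m + ℓ + 9) * x ^ 6 - (n - 4 * m + 1) * x ^ 5 + (5 * n - 3 * m + 5) * x ^ 4 -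
      (3 * n - m + ℓ + 5) * x ^ 3 + (2 * n - m + 3) * x ^ 2 - (4 * n + 6) * x + 1 := by
  simp only [Q, map_add, map_sub, map_mul, map_pow, aeval_X, map_one, map_ofNat,
    eq_intCast, map_intCast]

theorem irreducible_Q_of_isCertificate {g : List ℕ} {v : ℕ → List ℕ} (h : IsCertificate g v)
    {ℓ m n : ℤ} (hroot : ∀ (K : Type) [Field K] [Algebra (ZMod 3) K] (x : K),
      aeval x (Q ℓ m n) = 0 → x ^ g.length = listEval x g) : Irreducible (Q ℓ m n) := by
  have hm := monic_Q ℓ m n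
  refine hm.irreducible_of_irreducible_map (algebraMap ℤ (ZMod 3)) _ ?_
  have hd : ((Q ℓ m n).map (algebraMap ℤ (ZMod 3))).natDegree = 18 := by
    rw [hm.natDegree_map, natDegree_Q]
  refine h.irreducible (hm.map _) (by omega) (by omega) fun K _ _ x hx => hroot K x ?_
  rwa [aeval_map_algebraMap] at hx

theorem cast_eq_one {K : Type} [Field K] [Algebra (ZMod 3) K] {n : ℕ} (hn : n ≡ 1 [MOD 3]) :
    (n : K) = 1 := by
  rw [← map_natCast (algebraMap (ZMod 3) K), (ZMod.natCast_eq_natCast_iff n 1 3).2 hn]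
  simp

theorem three_eq_zero {K : Type} [Field K] [Algebra (ZMod 3) K] : (3 : K) = 0 := by
  rw [← map_ofNat (algebraMap (ZMod 3) K) 3, show (OfNat.ofNat 3 : ZMod 3) = 0 from rfl, map_zero]

theorem irreducible_Q_A {n : ℕ} (hn : n ≡ 1 [MOD 3]) : Irreducible (Q n 0 n) := by
  refine irreducible_Q_of_isCertificate isCertificate_A fun K _ _ x hx => ?_
  have h3 := three_eq_zero (K := K)
  simp only [aeval_Q, Int.cast_natCast, cast_eq_one hn, Int.cast_zero] at hx
  simp only [listEval, List.length, Nat.cast_zero, Nat.cast_one, Nat.cast_ofNat]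
  linear_combination hx + ((-1) * x ^ 0 + (3) * x ^ 1 + (-2) * x ^ 2 + (3) * x ^ 3 + (-4) * x ^ 4 + (-6) * x ^ 6 + (-8) * x ^ 8 + (1) * x ^ 9 + (-8) * x ^ 10 + (-6) * x ^ 12 + (-4) * x ^ 14 + (3) * x ^ 15 + (-2) * x ^ 16 + (3) * x ^ 17) * h3

theorem irreducible_Q_B {n : ℕ} (hn : n ≡ 1 [MOD 3]) : Irreducible (Q 0 n n) := by
  refine irreducible_Q_of_isCertificate isCertificate_B fun K _ _ x hx => ?_
  have h3 := three_eq_zero (K := K)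
  simp only [aeval_Q, Int.cast_natCast, cast_eq_one hn, Int.cast_zero] at hx
  simp only [listEval, List.length, Nat.cast_one, Nat.cast_ofNat]
  linear_combination hx + ((-1) * x ^ 0 + (3) * x ^ 1 + (-2) * x ^ 2 + (2) * x ^ 3 + (-3) * x ^ 4 + (-1) * x ^ 5 + (-5) * x ^ 6 + (-2) * x ^ 7 + (-6) * x ^ 8 + (-1) * x ^ 9 + (-6) * x ^ 10 + (-2) * x ^ 11 + (-5) * x ^ 12 + (-1) * x ^ 13 + (-3) * x ^ 14 + (2) * x ^ 15 + (-2) * x ^ 16 + (3) * x ^ 17) * h3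

end CoxeterDomino

end

/-! ### Location of the roots of `Q` -/

noncomputable section

namespace CoxeterDomino

open Polynomial

/-! ## Roots of the denominator polynomials -/

/-- A monic polynomial with the maximal number of sign changes splits. -/
theorem exists_roots_of_sign_changes {N : ℕ} {p : ℝ[X]} (hp : p.Monic) (hN : p.natDegree = N)
    {t : Fin (N + 1) → ℝ} (ht : StrictMono t)
    (hs : ∀ i : Fin N, p.eval (t i.castSucc) * p.eval (t i.succ) < 0) :
    ∃ y : Fin N → ℝ, (∀ i, t i.castSucc < y i ∧ y i < t i.succ) ∧ p = ∏ i, (X - C (y i)) := by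
  have hex : ∀ i : Fin N, ∃ y, (t i.castSucc < y ∧ y < t i.succ) ∧ p.eval y = 0 := by
    intro i
    have hlt : t i.castSucc < t i.succ := ht i.castSucc_lt_succ
    have hc : ContinuousOn (fun x => p.eval x) (Set.Icc (t i.castSucc) (t i.succ)) :=
      p.continuous.continuousOn
    rcases mul_neg_iff.1 (hs i) with ⟨h1, h2⟩ | ⟨h1, h2⟩
    · obtain ⟨y, hy, h0⟩ := intermediate_value_Ioo' hlt.le hc ⟨h2, h1⟩
      exact ⟨y, hy, h0⟩
    · obtain ⟨y, hy, h0⟩ := intermediate_value_Ioo hlt.le hc ⟨h1, h2⟩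
      exact ⟨y, hy, h0⟩
  choose y hy h0 using hex
  have hmono : StrictMono y := by
    intro i j hij
    have h1 : t i.succ ≤ t j.castSucc := ht.monotone (Fin.succ_le_castSucc_iff.2 hij)
    exact (hy i).2.trans_le (h1.trans (hy j).1.le)
  refine ⟨y, hy, ?_⟩
  have hdvd : ∏ i, (X - C (y i)) ∣ p :=
    Finset.prod_dvd_of_coprime
      (fun i _ j _ hij => pairwise_coprime_X_sub_C hmono.injective hij)
      fun i _ => dvd_iff_isRoot.2 (h0 i)
  have hm : (∏ i, (X - C (y i))).Monic := monic_prod_X_sub_C _ _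
  refine (Polynomial.eq_of_monic_of_dvd_of_natDegree_le hm hp hdvd ?_)
  rw [hN, natDegree_prod_of_monic _ _ fun i _ => monic_X_sub_C _]
  simp

/-- The polynomial in `x + 1 / x` obtained from `Q`. -/
def traceQ (ℓ m n : ℝ) : ℝ[X] :=
  X ^ 9 + C (-6 - 4 * n) * X ^ 8 + C (-6 + 2 * n - m) * X ^ 7 + C (43 + 29 * n + m - ℓ) * X ^ 6 +
    C (11 - 9 * n + 4 * m) * X ^ 5 + C (-91 - 63 * n - 2 * m + 6 * ℓ) * X ^ 4 +
    C (-4 + 11 * n - 3 * m + ℓ) * X ^ 3 + C (55 + 41 * n - 2 * m - 10 * ℓ) * X ^ 2 +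
    C (-3 - 3 * n - m - 2 * ℓ) * X + C (-6 - 6 * n + 2 * m + 4 * ℓ)

theorem monic_traceQ (ℓ m n : ℝ) : (traceQ ℓ m n).Monic := by
  unfold traceQ
  monicity!

theorem natDegree_traceQ (ℓ m n : ℝ) : (traceQ ℓ m n).natDegree = 9 := by
  unfold traceQ
  compute_degree!

/-- The coefficients of `Q` are palindromic, so after division by `x ^ 9` it is a polynomial in `x +
x⁻¹`. -/
theorem aeval_Q_eq_traceQ (ℓ m n : ℤ) {x : ℂ} (hx : x ≠ 0) :
    aeval x (Q ℓ m n) = x ^ 9 * aeval (x + x⁻¹) (traceQ ℓ m n) := by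
  rw [aeval_Q]
  simp only [traceQ, map_add, map_mul, map_pow, aeval_X, aeval_C, Complex.coe_algebraMap]
  push_cast
  field_simp
  ring

/-- The points at which the signs of the polynomial in `x + 1 / x` alternate. -/
def signPoint (n : ℝ) : Fin 10 → ℝ :=
  -- Seven of the intervals fill `[-2, 2]`, whose interior corresponds to nonreal points of the unit
  -- circle. At `4 * n + 6` the two leading terms of `traceQ` cancel.
  ![-2, -(7 / 4), -1, -(1 / 2), 0, 1 / 2, 1, 2, 3, 4 * n + 6]

theorem strictMono_signPoint {n : ℝ} (hn : 1 ≤ n) : StrictMono (signPoint n) := by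
  refine Fin.strictMono_iff_lt_succ.2 fun i => ?_
  fin_cases i <;> simp [signPoint] <;> (norm_num; try linarith)

theorem eval_traceQ (ℓ m n y : ℝ) : (traceQ ℓ m n).eval y =
    y ^ 9 + (-6 - 4 * n) * y ^ 8 + (-6 + 2 * n - m) * y ^ 7 + (43 + 29 * n + m - ℓ) * y ^ 6 +
    (11 - 9 * n + 4 * m) * y ^ 5 + (-91 - 63 * n - 2 * m + 6 * ℓ) * y ^ 4 +
    (-4 + 11 * n - 3 * m + ℓ) * y ^ 3 + (55 + 41 * n - 2 * m - 10 * ℓ) * y ^ 2 +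
    (-3 - 3 * n - m - 2 * ℓ) * y + (-6 - 6 * n + 2 * m + 4 * ℓ) := by
  simp [traceQ]

theorem sign_changes_of_signs {f : ℝ → ℝ} {n : ℝ}
    (hneg : ∀ y ∈ ([-2, -1, 0, 1, 3] : List ℝ), f y < 0)
    (hpos : ∀ y ∈ ([-(7 / 4), -(1 / 2), 1 / 2, 2, 4 * n + 6] : List ℝ), 0 < f y) (i : Fin 9) :
    f (signPoint n i.castSucc) * f (signPoint n i.succ) < 0 := by
  simp only [List.forall_mem_cons, List.not_mem_nil, false_implies, implies_true, and_true]
    at hneg hpos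
  obtain ⟨h0, h2, h4, h6, h8⟩ := hneg
  obtain ⟨h1, h3, h5, h7, h9⟩ := hpos
  fin_cases i
  exacts [mul_neg_of_neg_of_pos h0 h1, mul_neg_of_pos_of_neg h1 h2, mul_neg_of_neg_of_pos h2 h3,
    mul_neg_of_pos_of_neg h3 h4, mul_neg_of_neg_of_pos h4 h5, mul_neg_of_pos_of_neg h5 h6,
    mul_neg_of_neg_of_pos h6 h7, mul_neg_of_pos_of_neg h7 h8, mul_neg_of_neg_of_pos h8 h9]

theorem sign_changes_A {n : ℝ} (hn : 1 ≤ n) (i : Fin 9) :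
    (traceQ n 0 n).eval (signPoint n i.castSucc) * (traceQ n 0 n).eval (signPoint n i.succ) < 0 := by
  refine sign_changes_of_signs (f := fun y => (traceQ n 0 n).eval y) ?_ ?_ i <;>
    simp only [List.forall_mem_cons, List.not_mem_nil, false_implies, implies_true, and_true,
      eval_traceQ]
  · refine ⟨?_, ?_, ?_, ?_, ?_⟩ <;> linarith
  -- The values at the fixed points are affine in `n`; only the one at `4 * n + 6` has to be
  -- expanded.
  · refine ⟨?_, ?_, ?_, ?_, ?_⟩ <;> try linarith
    ring_nf
    positivity

theorem sign_changes_B {n : ℝ} (hn : 1 ≤ n) (i : Fin 9) :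
    (traceQ 0 n n).eval (signPoint n i.castSucc) * (traceQ 0 n n).eval (signPoint n i.succ) < 0 := by
  refine sign_changes_of_signs (f := fun y => (traceQ 0 n n).eval y) ?_ ?_ i <;>
    simp only [List.forall_mem_cons, List.not_mem_nil, false_implies, implies_true, and_true,
      eval_traceQ]
  · refine ⟨?_, ?_, ?_, ?_, ?_⟩ <;> linarith
  · refine ⟨?_, ?_, ?_, ?_, ?_⟩ <;> try linarith
    ring_nf
    positivity

theorem exists_unit_root {y : ℝ} (h1 : -2 < y) (h2 : y < 2) :
    ∃ r : ℂ, ‖r‖ = 1 ∧ r + r⁻¹ = y := by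
  refine ⟨Complex.exp (Real.arccos (y / 2) * Complex.I), Complex.norm_exp_ofReal_mul_I _, ?_⟩
  rw [← Complex.exp_neg, ← neg_mul, ← Complex.two_cos, ← Complex.ofReal_cos,
    Real.cos_arccos (by linarith) (by linarith)]
  push_cast
  ring

theorem exists_real_root {y : ℝ} (h : 2 < y) : ∃ r : ℝ, 1 < r ∧ r + r⁻¹ = y := by
  have h1 : 0 < y ^ 2 - 4 := by nlinarith
  have h2 := Real.sq_sqrt h1.le
  have h3 := Real.sqrt_nonneg (y ^ 2 - 4)
  refine ⟨(y + Real.sqrt (y ^ 2 - 4)) / 2, by linarith, ?_⟩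
  field_simp
  nlinarith

theorem lt_of_add_inv_lt {r s : ℝ} (hr : 1 < r) (hs : 1 < s) (h : s + s⁻¹ < r + r⁻¹) : s < r := by
  by_contra hle
  push Not at hle
  have h1 : 0 ≤ (s - r) * (1 - r⁻¹ * s⁻¹) := by
    refine mul_nonneg (by linarith) ?_
    have := mul_le_one₀ (inv_le_one_of_one_le₀ hr.le) (inv_nonneg.2 (zero_le_one.trans hs.le))
      (inv_le_one_of_one_le₀ hs.le)
    linarith
  have h2 : (s - r) * (1 - r⁻¹ * s⁻¹) = s + s⁻¹ - (r + r⁻¹) := by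
    have : r ≠ 0 := by linarith
    have : s ≠ 0 := by linarith
    field_simp
    ring
  linarith

/-- The roots of a polynomial: two real pairs of reciprocal roots, and the others on the unit
circle. -/
structure HasSalemRoots (q : ℤ[X]) (α β : ℝ) (r : Fin 9 → ℂ) : Prop where
  one_lt : 1 < β
  lt : β < α
  root_large : r 8 = α
  root_second : r 7 = β
  root_unit : ∀ i, i ≠ 8 → i ≠ 7 → ‖r i‖ = 1
  eval_eq : ∀ z : ℂ, aeval z q = ∏ i, ((z - r i) * (z - (r i)⁻¹))

/-- A root `y` of `traceQ` in `(-2, 2)` yields two conjugate points of the unit circle, and one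
beyond 2 yields a pair of reciprocal positive reals. -/
theorem exists_hasSalemRoots {ℓ m n : ℤ} (hn : 1 ≤ n)
    (hs : ∀ i : Fin 9, (traceQ ℓ m n).eval (signPoint n i.castSucc) *
      (traceQ ℓ m n).eval (signPoint n i.succ) < 0) :
    ∃ α β r, HasSalemRoots (Q ℓ m n) α β r := by
  have hn' : (1 : ℝ) ≤ n := mod_cast hn
  have hmono := strictMono_signPoint hn'
  obtain ⟨y, hy, hprod⟩ := exists_roots_of_sign_changes (monic_traceQ ℓ m n)
    (natDegree_traceQ ℓ m n) hmono hs
  have hy7 := hy 7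
  have hy8 := hy 8
  have hp7 : signPoint n (7 : Fin 9).castSucc = 2 := rfl
  have hp7' : signPoint n (7 : Fin 9).succ = 3 := rfl
  have hp8 : signPoint n (8 : Fin 9).castSucc = 3 := rfl
  rw [hp7, hp7'] at hy7
  rw [hp8] at hy8
  obtain ⟨β, hβ, hβy⟩ := exists_real_root hy7.1
  obtain ⟨α, hα, hαy⟩ := exists_real_root (y := y 8) (by linarith)
  have hunit : ∀ i : Fin 9, ∃ r : ℂ, (i ≠ 8 → i ≠ 7 → ‖r‖ = 1) ∧ (i = 8 → r = α) ∧
      (i = 7 → r = β) ∧ r ≠ 0 ∧ r + r⁻¹ = y i := by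
    intro i
    by_cases h8 : i = 8
    · subst h8
      refine ⟨α, fun h => absurd rfl h, fun _ => rfl, fun h => absurd h (by decide), ?_, ?_⟩
      · exact_mod_cast (zero_lt_one.trans hα).ne'
      · exact_mod_cast congrArg (Complex.ofReal) hαy
    by_cases h7 : i = 7
    · subst h7
      refine ⟨β, fun _ h => absurd rfl h, fun h => absurd h (by decide), fun _ => rfl, ?_, ?_⟩
      · exact_mod_cast (zero_lt_one.trans hβ).ne'
      · exact_mod_cast congrArg (Complex.ofReal) hβy
    · have hlo : -2 < y i := lt_of_le_of_lt (hmono.monotone (Fin.zero_le _)) (hy i).1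
      have hhi : y i < 2 := by
        refine (hy i).2.trans_le ?_
        rw [← hp7]
        have hle : ∀ i : Fin 9, i ≠ 8 → i ≠ 7 → i.succ ≤ (7 : Fin 9).castSucc := by decide
        exact hmono.monotone (hle i h8 h7)
      obtain ⟨r, hr, hry⟩ := exists_unit_root hlo hhi
      refine ⟨r, fun _ _ => hr, fun h => absurd h h8, fun h => absurd h h7, ?_, hry⟩
      rintro rfl
      simp at hr
  choose r hr1 hr8 hr7 hr0 hry using hunit
  refine ⟨α, β, r, hβ, ?_, hr8 8 rfl, hr7 7 rfl, hr1, ?_⟩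
  · refine lt_of_add_inv_lt hα hβ ?_
    rw [hαy, hβy]
    linarith
  · intro z
    have hquad : ∀ i, (z - r i) * (z - (r i)⁻¹) = z ^ 2 - y i * z + 1 := fun i => by
      rw [← hry]
      have := mul_inv_cancel₀ (hr0 i)
      linear_combination this
    simp only [hquad]
    by_cases hz : z = 0
    · simp [hz, aeval_Q]
    · rw [aeval_Q_eq_traceQ _ _ _ hz, hprod, map_prod]
      simp only [map_sub, aeval_X, aeval_C, Complex.coe_algebraMap]
      rw [show z ^ 9 = ∏ _i : Fin 9, z by simp, ← Finset.prod_mul_distrib]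
      refine Finset.prod_congr rfl fun i _ => ?_
      field_simp
      ring

end CoxeterDomino

end

/-! ### Growth rates from the dominant root, and the conclusion -/

noncomputable section

namespace CoxeterDomino

open Polynomial

/-! ## Absolutely convergent power series -/

/-- Absolute convergence of a power series at a point. -/
def AbsConv (F : PowerSeries ℂ) (z : ℂ) : Prop :=
  Summable fun k => ‖PowerSeries.coeff k F * z ^ k‖

theorem coeff_mul_mul_pow (F G : PowerSeries ℂ) (z : ℂ) (k : ℕ) :
    PowerSeries.coeff k (F * G) * z ^ k = ∑ p ∈ Finset.HasAntidiagonal.antidiagonal k,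
      (PowerSeries.coeff p.1 F * z ^ p.1) * (PowerSeries.coeff p.2 G * z ^ p.2) := by
  rw [PowerSeries.coeff_mul, Finset.sum_mul]
  refine Finset.sum_congr rfl fun p hp => ?_
  rw [← Finset.HasAntidiagonal.mem_antidiagonal.1 hp, pow_add]
  ring

theorem AbsConv.mul {F G : PowerSeries ℂ} {z : ℂ} (hF : AbsConv F z) (hG : AbsConv G z) :
    AbsConv (F * G) z := by
  have h := summable_norm_sum_mul_antidiagonal_of_summable_norm hF hG
  rw [AbsConv]
  simpa only [coeff_mul_mul_pow] using h

theorem absConv_polynomial (p : ℂ[X]) (z : ℂ) : AbsConv (p : PowerSeries ℂ) z :=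
  summable_of_ne_finset_zero (s := p.support) fun k hk => by
    rw [Polynomial.coeff_coe, Polynomial.notMem_support_iff.1 hk, zero_mul, norm_zero]

theorem tsum_polynomial (p : ℂ[X]) (z : ℂ) :
    ∑' k, PowerSeries.coeff k (p : PowerSeries ℂ) * z ^ k = p.eval z := by
  rw [tsum_eq_sum (s := p.support), eval_eq_sum, Polynomial.sum]
  · simp only [Polynomial.coeff_coe]
  · intro k hk
    rw [Polynomial.coeff_coe, Polynomial.notMem_support_iff.1 hk, zero_mul]

/-- The factor is inverted by a geometric series that converges absolutely at `z`. -/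
theorem AbsConv.of_mul_one_sub {F : PowerSeries ℂ} {r z : ℂ} (hr : ‖r * z‖ < 1)
    (h : AbsConv (((1 - C r * X : ℂ[X]) : PowerSeries ℂ) * F) z) : AbsConv F z := by
  set G : PowerSeries ℂ := PowerSeries.mk fun k => r ^ k with hG
  have hG1 : G * ((1 - C r * X : ℂ[X]) : PowerSeries ℂ) = 1 := by
    ext k
    rw [Polynomial.coe_sub, Polynomial.coe_one, Polynomial.coe_mul, Polynomial.coe_C,
      Polynomial.coe_X, mul_sub, mul_one, map_sub, mul_left_comm, PowerSeries.coeff_C_mul]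
    cases k with
    | zero => simp [hG]
    | succ k =>
      rw [PowerSeries.coeff_succ_mul_X, hG, PowerSeries.coeff_mk, PowerSeries.coeff_mk,
        PowerSeries.coeff_one, if_neg k.succ_ne_zero, pow_succ]
      ring
  have hGz : AbsConv G z := by
    have : Summable fun k : ℕ => ‖r * z‖ ^ k := summable_geometric_of_lt_one (norm_nonneg _) hr
    rw [AbsConv]
    simpa only [hG, PowerSeries.coeff_mk, ← mul_pow, norm_pow] using this
  have := hGz.mul h
  rwa [← mul_assoc, hG1, one_mul] at this

theorem AbsConv.of_mul_prod {F : PowerSeries ℂ} {z : ℂ} {ι : Type*} (s : Finset ι) {r : ι → ℂ}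
    (hr : ∀ i ∈ s, ‖r i * z‖ < 1)
    (h : AbsConv (((∏ i ∈ s, (1 - C (r i) * X) : ℂ[X]) : PowerSeries ℂ) * F) z) :
    AbsConv F z := by
  classical
  induction s using Finset.induction_on with
  | empty => simpa using h
  | insert i s hi ih =>
    rw [Finset.prod_insert hi, Polynomial.coe_mul, mul_assoc] at h
    exact ih (fun j hj => hr j (Finset.mem_insert_of_mem hj))
      (AbsConv.of_mul_one_sub (hr i (Finset.mem_insert_self i s)) h)

/-! ## Upper limits of roots -/

/-- The Cauchy–Hadamard formula: convergence at `1 / s` for all `s > α` bounds the upper limit by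
`α`, and a smaller one would give convergence at `1 / α`. -/
theorem limsup_root_eq {a : ℕ → ℝ} (ha : ∀ k, 0 ≤ a k) {α : ℝ} (hα : 0 < α)
    (hup : ∀ s, α < s → Summable fun k => a k * (s⁻¹) ^ k)
    (hlow : ¬ Summable fun k => a k * (α⁻¹) ^ k) :
    Filter.limsup (fun k : ℕ => a k ^ (1 / (k : ℝ))) Filter.atTop = α := by
  have hev : ∀ s, α < s → ∀ᶠ k : ℕ in Filter.atTop, a k ^ (1 / (k : ℝ)) ≤ s := by
    intro s hs
    have hs0 : 0 < s := hα.trans hs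
    filter_upwards [(hup s hs).tendsto_atTop_zero.eventually_le_const zero_lt_one,
      Filter.eventually_ne_atTop 0] with k hk hk0
    rw [inv_pow, ← div_eq_mul_inv, div_le_one (pow_pos hs0 k)] at hk
    calc a k ^ (1 / (k : ℝ)) ≤ (s ^ k) ^ (1 / (k : ℝ)) :=
          Real.rpow_le_rpow (ha k) hk (by positivity)
      _ = s := by rw [one_div, Real.pow_rpow_inv_natCast hs0.le hk0]
  have hnn : ∀ k : ℕ, 0 ≤ a k ^ (1 / (k : ℝ)) := fun k => Real.rpow_nonneg (ha k) _
  -- A real `limsup` has its meaning only for bounded sequences, so both bounds are recorded. The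
  -- index `0`, where `1 / k` is `0`, is discarded throughout.
  have hcob : Filter.IsCoboundedUnder (· ≤ ·) Filter.atTop fun k : ℕ => a k ^ (1 / (k : ℝ)) :=
    Filter.IsBoundedUnder.isCoboundedUnder_le ⟨0, Filter.eventually_map.2 (Filter.Eventually.of_forall hnn)⟩
  have hbdd : Filter.IsBoundedUnder (· ≤ ·) Filter.atTop fun k : ℕ => a k ^ (1 / (k : ℝ)) :=
    ⟨α + 1, Filter.eventually_map.2 (hev _ (lt_add_one α))⟩
  refine le_antisymm (le_of_forall_gt_imp_ge_of_dense fun s hs =>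
    Filter.limsup_le_of_le hcob (hev s hs)) ?_
  by_contra hlt
  push Not at hlt
  obtain ⟨s, hs1, hs2⟩ := exists_between hlt
  have hlts := Filter.eventually_lt_of_limsup_lt hs1 hbdd
  have hs0 : 0 < s := by
    obtain ⟨k, hk⟩ := hlts.exists
    exact (hnn k).trans_lt hk
  refine hlow ?_
  have hgeo : Summable fun k : ℕ => (s / α) ^ k :=
    summable_geometric_of_lt_one (by positivity) ((div_lt_one hα).2 hs2)
  refine Summable.of_norm_bounded_eventually_nat hgeo ?_
  filter_upwards [hlts, Filter.eventually_ne_atTop 0] with k hk hk0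
  have h1 : a k ≤ s ^ k := by
    calc a k = (a k ^ (1 / (k : ℝ))) ^ k := by
          rw [one_div, Real.rpow_inv_natCast_pow (ha k) hk0]
      _ ≤ s ^ k := pow_le_pow_left₀ (hnn k) hk.le k
  rw [Real.norm_of_nonneg (mul_nonneg (ha k) (by positivity)), div_pow, inv_pow, ← div_eq_mul_inv]
  gcongr

/-! ## Growth rates -/

namespace HasSalemRoots

variable {q : ℤ[X]} {α β : ℝ} {r : Fin 9 → ℂ}

theorem one_lt_large (h : HasSalemRoots q α β r) : 1 < α := h.one_lt.trans h.lt

theorem cases_index (h : HasSalemRoots q α β r) (i : Fin 9) :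
    r i = α ∨ r i = β ∨ ‖r i‖ = 1 := by
  by_cases h8 : i = 8
  · rw [h8]; exact Or.inl h.root_large
  by_cases h7 : i = 7
  · rw [h7]; exact Or.inr (Or.inl h.root_second)
  · exact Or.inr (Or.inr (h.root_unit i h8 h7))

theorem norm_ofReal {x : ℝ} (hx : 1 < x) : ‖(x : ℂ)‖ = x := by
  rw [Complex.norm_real, Real.norm_of_nonneg (by linarith)]

theorem one_le_norm (h : HasSalemRoots q α β r) (i : Fin 9) : 1 ≤ ‖r i‖ ∧ ‖r i‖ ≤ α := by
  have h1 := h.one_lt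
  have h2 := h.lt
  rcases h.cases_index i with h' | h' | h'
  · rw [h', norm_ofReal h.one_lt_large]; constructor <;> linarith
  · rw [h', norm_ofReal h1]; constructor <;> linarith
  · rw [h']; constructor <;> linarith

theorem norm_inv_le (h : HasSalemRoots q α β r) (i : Fin 9) : ‖(r i)⁻¹‖ ≤ 1 := by
  rw [norm_inv]
  exact inv_le_one_of_one_le₀ (h.one_le_norm i).1

theorem root_ne_zero (h : HasSalemRoots q α β r) (i : Fin 9) : r i ≠ 0 := by
  have := (h.one_le_norm i).1
  rintro h0
  rw [h0, norm_zero] at this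
  linarith

theorem aeval_eq_zero_iff (h : HasSalemRoots q α β r) {z : ℂ} :
    aeval z q = 0 ↔ ∃ i, z = r i ∨ z = (r i)⁻¹ := by
  simp [h.eval_eq, Finset.prod_eq_zero_iff, sub_eq_zero]

/-- Since roots come in reciprocal pairs, `(z - r) * (z - r⁻¹) = (1 - r * z) * (1 - r⁻¹ * z)`. The
second form can be inverted as a power series. -/
theorem map_eq (h : HasSalemRoots q α β r) : q.map (Int.castRingHom ℂ) =
    (∏ i, (1 - C (r i) * X)) * ∏ i, (1 - C ((r i)⁻¹) * X) := by
  refine Polynomial.funext fun z => ?_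
  have h1 := h.eval_eq z
  rw [aeval_def, ← eval_map, algebraMap_int_eq] at h1
  rw [h1, ← Finset.prod_mul_distrib, eval_prod]
  refine Finset.prod_congr rfl fun i _ => ?_
  have := mul_inv_cancel₀ (h.root_ne_zero i)
  simp only [eval_mul, eval_sub, eval_one, eval_C, eval_X]
  linear_combination (1 - z ^ 2) * this

variable {Γ : Type*} [Group Γ] {S : Set Γ} {p : ℤ[X]}

theorem map_mul_growthSeries
    (hS : (q : PowerSeries ℤ) * growthSeries S = (p : PowerSeries ℤ)) :
    ((q.map (Int.castRingHom ℂ) : ℂ[X]) : PowerSeries ℂ) *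
      (growthSeries S).map (Int.castRingHom ℂ) = (p.map (Int.castRingHom ℂ) : ℂ[X]) := by
  have := congrArg (PowerSeries.map (Int.castRingHom ℂ)) hS
  rwa [map_mul, ← Polynomial.polynomial_map_coe, ← Polynomial.polynomial_map_coe] at this

theorem norm_coeff (S : Set Γ) (s : ℝ) (hs : 0 ≤ s) (k : ℕ) :
    ‖PowerSeries.coeff k ((growthSeries S).map (Int.castRingHom ℂ)) * (s : ℂ) ^ k‖ =
      growthCoeff S k * s ^ k := by
  rw [PowerSeries.coeff_map, growthSeries, PowerSeries.coeff_mk, norm_mul, norm_pow,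
    Complex.norm_real, Real.norm_of_nonneg hs]
  simp

/-- Inside the disc of radius `1 / α` every factor of `q` can be divided out. Convergence at `1 / α`
itself would give `q * f = p` there, but `q` vanishes at that point and `p` does not. -/
theorem growthRate_eq (h : HasSalemRoots q α β r)
    (hS : (q : PowerSeries ℤ) * growthSeries S = (p : PowerSeries ℤ))
    (hp : aeval (α : ℂ)⁻¹ p ≠ 0) : growthRate S = α := by
  have hα := h.one_lt_large
  have hS' := map_mul_growthSeries hS
  refine limsup_root_eq (fun k => Nat.cast_nonneg _) (by linarith) (fun s hs => ?_) fun hsum => ?_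
  · have hs0 : 0 < s := by linarith
    have hz : ‖((s⁻¹ : ℝ) : ℂ)‖ = s⁻¹ := by
      rw [Complex.norm_real, Real.norm_of_nonneg (inv_nonneg.2 hs0.le)]
    have hlt : ∀ w : ℂ, ‖w‖ ≤ α → ‖w * ((s⁻¹ : ℝ) : ℂ)‖ < 1 := fun w hw => by
      rw [norm_mul, hz, ← div_eq_mul_inv, div_lt_one hs0]
      exact hw.trans_lt hs
    have hc : AbsConv ((growthSeries S).map (Int.castRingHom ℂ)) ((s⁻¹ : ℝ) : ℂ) := by
      refine AbsConv.of_mul_prod Finset.univ (r := fun i => (r i)⁻¹)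
        (fun i _ => hlt _ ((h.norm_inv_le i).trans hα.le)) ?_
      refine AbsConv.of_mul_prod Finset.univ (r := r)
        (fun i _ => hlt _ (h.one_le_norm i).2) ?_
      rw [← mul_assoc, ← Polynomial.coe_mul, ← h.map_eq, hS']
      exact absConv_polynomial _ _
    rw [AbsConv] at hc
    simpa only [norm_coeff S _ (inv_nonneg.2 hs0.le)] using hc
  · have hα0 : 0 ≤ α⁻¹ := inv_nonneg.2 (by linarith)
    have hc : AbsConv ((growthSeries S).map (Int.castRingHom ℂ)) ((α⁻¹ : ℝ) : ℂ) := by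
      rw [AbsConv]
      simpa only [norm_coeff S _ hα0] using hsum
    have hmul := tsum_mul_tsum_eq_tsum_sum_antidiagonal_of_summable_norm
      (absConv_polynomial (q.map (Int.castRingHom ℂ)) ((α⁻¹ : ℝ) : ℂ)) hc
    simp only [← coeff_mul_mul_pow] at hmul
    rw [hS', tsum_polynomial, tsum_polynomial, eval_map, eval_map, ← algebraMap_int_eq,
      ← aeval_def, ← aeval_def, h.aeval_eq_zero_iff.2 ⟨8, Or.inr ?_⟩, zero_mul] at hmul
    · rw [Complex.ofReal_inv] at hmul
      exact hp hmul.symm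
    · rw [h.root_large, Complex.ofReal_inv]

/-- By irreducibility `q` is the minimal polynomial of `α`, so the conjugates of `α` are exactly the
listed roots and their inverses. -/
theorem isTwoSalem (h : HasSalemRoots q α β r) (hq : q.Monic) (hirr : Irreducible q) :
    IsTwoSalem (α : ℂ) := by
  have h1 := h.one_lt
  have h2 := h.lt
  have hα := h.one_lt_large
  have hroot : aeval (α : ℂ) q = 0 := h.aeval_eq_zero_iff.2 ⟨8, Or.inl h.root_large.symm⟩
  have hint : IsIntegral ℤ (α : ℂ) := ⟨q, hq, by rwa [← aeval_def]⟩
  have hmin : minpoly ℚ (α : ℂ) = q.map (algebraMap ℤ ℚ) := by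
    refine (minpoly.eq_of_irreducible_of_monic
      ((hq.irreducible_iff_irreducible_map_fraction_map).1 hirr) ?_ (hq.map _)).symm
    rwa [aeval_map_algebraMap]
  have hconj : ∀ ω : ℂ, IsConjRoot ℚ (α : ℂ) ω ↔ ∃ i, ω = r i ∨ ω = (r i)⁻¹ := fun ω => by
    rw [isConjRoot_iff_aeval_eq_zero (hint.tower_top), hmin, aeval_map_algebraMap,
      h.aeval_eq_zero_iff]
  have hr0 : ‖r 0‖ = 1 := h.root_unit 0 (by decide) (by decide)
  refine ⟨hint, by rwa [norm_ofReal hα], β, (hconj _).2 ⟨7, Or.inl h.root_second.symm⟩,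
    fun h0 => h2.ne (Complex.ofReal_injective h0), by rwa [norm_ofReal h1],
    fun ω hω hωα hωβ => ?_, r 0, (hconj _).2 ⟨0, Or.inl rfl⟩, fun h0 => ?_, fun h0 => ?_, hr0⟩
  · obtain ⟨i, rfl | rfl⟩ := (hconj ω).1 hω
    · exact (((h.cases_index i).resolve_left hωα).resolve_left hωβ).le
    · exact h.norm_inv_le i
  · rw [h0, norm_ofReal hα] at hr0
    linarith
  · rw [h0, norm_ofReal h1] at hr0
    linarith

/-- An irreducible `q` not prime to `p` would divide it, and then `p` would vanish at `1 / α`. -/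
theorem isGrowthDenominator (h : HasSalemRoots q α β r) (hirr : Irreducible q)
    (h0 : q.coeff 0 = 1) (hS : (q : PowerSeries ℤ) * growthSeries S = (p : PowerSeries ℤ))
    (hp : aeval (α : ℂ)⁻¹ p ≠ 0) : IsGrowthDenominator S q := by
  refine ⟨h0, p, (IsRelPrime.symm ((hirr.isRelPrime_iff_not_dvd).2 ?_)), hS⟩
  rintro ⟨c, rfl⟩
  refine hp ?_
  rw [map_mul, h.aeval_eq_zero_iff.2 ⟨8, Or.inr (by rw [h.root_large])⟩, zero_mul]

end HasSalemRoots

/-! ## Growth of dominoes -/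

/-- The numerator polynomial of the growth series. -/
def numerator : ℤ[X] :=
  (1 + X) ^ 4 * (1 + X + X ^ 2) * (1 + X ^ 2) * (1 + X + X ^ 2 + X ^ 3 + X ^ 4) * (1 - X + X ^ 2) *
    (1 - X + X ^ 2 - X ^ 3 + X ^ 4)

theorem aeval_numerator_ne_zero {x : ℝ} (hx : 1 < x) : aeval (x : ℂ)⁻¹ numerator ≠ 0 := by
  have h0 : 0 < x⁻¹ := inv_pos.2 (by linarith)
  have h1 : x⁻¹ < 1 := inv_lt_one_of_one_lt₀ hx
  rw [← Complex.ofReal_inv]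
  set y := x⁻¹
  have h2 : 0 < 1 - y + y ^ 2 := by nlinarith
  have h3 : 0 < 1 - y + y ^ 2 - y ^ 3 + y ^ 4 := by
    have : 0 < y ^ 2 * (1 - y) := by
      have : 0 < 1 - y := by linarith
      positivity
    nlinarith [pow_pos h0 4]
  have h4 : (1 + y) ^ 4 * (1 + y + y ^ 2) * (1 + y ^ 2) * (1 + y + y ^ 2 + y ^ 3 + y ^ 4) *
      (1 - y + y ^ 2) * (1 - y + y ^ 2 - y ^ 3 + y ^ 4) ≠ 0 := by positivity
  simp only [numerator, map_mul, map_add, map_sub, map_pow, map_one, aeval_X]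
  exact_mod_cast h4

theorem toField_coe (p : ℤ[X]) :
    toField (p : PowerSeries ℤ) = p.eval₂ (Int.castRingHom SeriesField) tt := by
  have h := Polynomial.hom_eval₂ p Polynomial.C
    (toField.comp (Polynomial.coeToPowerSeries.ringHom (R := ℤ))) X
  rw [eval₂_C_X] at h
  simpa [tt, RingHom.ext_int _ (Int.castRingHom SeriesField)] using h

theorem eval₂_Q {K : Type*} [CommRing K] (ℓ m n : ℤ) (x : K) :
    (Q ℓ m n).eval₂ (Int.castRingHom K) x =
    x ^ 18 - (4 * n + 6) * x ^ 17 + (2 * n - m + 3) * x ^ 16 - (3 * n - m + ℓ + 5) * x ^ 15 +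
      (5 * n - 3 * m + 5) * x ^ 14 - (n - 4 * m + 1) * x ^ 13 +
      (8 * n - 4 * m + ℓ + 9) * x ^ 12 + (5 * m - ℓ) * x ^ 11 +
      (10 * n - 5 * m + ℓ + 11) * x ^ 10 - (2 * n - 6 * m + 2) * x ^ 9 +
      (10 * n - 5 * m + ℓ + 11) * x ^ 8 + (5 * m - ℓ) * x ^ 7 +
      (8 * n - 4 * m + ℓ + 9) * x ^ 6 - (n - 4 * m + 1) * x ^ 5 + (5 * n - 3 * m + 5) * x ^ 4 -
      (3 * n - m + ℓ + 5) * x ^ 3 + (2 * n - m + 3) * x ^ 2 - (4 * n + 6) * x + 1 :=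
  aeval_Q ℓ m n x

theorem toField_numerator : toField (numerator : PowerSeries ℤ) = cycProd := by
  rw [toField_coe, numerator, cycProd]
  simp only [eval₂_mul, eval₂_add, eval₂_sub, eval₂_pow, eval₂_one, eval₂_X]

theorem IsDomino.mul_growthSeries {ℓ m n : ℕ} {L : List (Fin 5 → LorentzSpace)}
    (h : IsDomino ℓ m n L) : (Q ℓ m n : PowerSeries ℤ) * growthSeries (dominoReflections L) =
      (numerator : PowerSeries ℤ) := by
  obtain ⟨Φ, hT, c, rfl, hΦ⟩ := h.exists_tiling
  have hg : growthSeries (dominoReflections L) = growth Φ := by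
    rw [← growthSeries_reflections, ← hT.facetNormals_eq]
    rfl
  refine toField_injective ?_
  have hne := hT.base.toField_growth_ne_zero
  have hc := cycProd_ne_zero
  rw [invGrowth, eq_div_iff hc, inv_mul_eq_iff_eq_mul₀ hne] at hΦ
  rw [hg, map_mul, toField_coe, eval₂_Q, toField_numerator, hΦ, mul_comm]
  congr 1
  simp only [sidePoly]
  push_cast
  ring

theorem IsDomino.isGrowthDenominator_and_isTwoSalem {ℓ m n : ℕ} {L : List (Fin 5 → LorentzSpace)}
    (h : IsDomino ℓ m n L) (hn : 1 ≤ n) (hirr : Irreducible (Q ℓ m n))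
    (hs : ∀ i : Fin 9, (traceQ ℓ m n).eval (signPoint n i.castSucc) *
      (traceQ ℓ m n).eval (signPoint n i.succ) < 0) :
    IsGrowthDenominator (dominoReflections L) (Q ℓ m n) ∧
      IsTwoSalem ((growthRate (dominoReflections L) : ℝ) : ℂ) := by
  obtain ⟨α, β, r, hr⟩ := exists_hasSalemRoots (ℓ := ℓ) (m := m) (n := n) (mod_cast hn)
    (by exact_mod_cast hs)
  have hp := aeval_numerator_ne_zero hr.one_lt_large
  have h0 : (Q ℓ m n).coeff 0 = 1 := by
    rw [coeff_zero_eq_eval_zero]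
    simp [Q]
  rw [hr.growthRate_eq h.mul_growthSeries hp]
  exact ⟨hr.isGrowthDenominator hirr h0 h.mul_growthSeries hp, hr.isTwoSalem (monic_Q ℓ m n) hirr⟩

end CoxeterDomino

end

theorem mainTheorem1 (n : ℕ) (hn : n ≡ 1 [MOD 3]) :
    Irreducible (CoxeterDomino.Q 0 n n) ∧
    Irreducible (CoxeterDomino.Q n 0 n) ∧
    ((∃ L, CoxeterDomino.IsDomino 0 n n L) ∧
      ∀ L, CoxeterDomino.IsDomino 0 n n L →
        CoxeterDomino.IsGrowthDenominator (CoxeterDomino.dominoReflections L)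
          (CoxeterDomino.Q 0 n n) ∧
        CoxeterDomino.IsTwoSalem
          ((CoxeterDomino.growthRate (CoxeterDomino.dominoReflections L) : ℝ) : ℂ)) ∧
    ((∃ L, CoxeterDomino.IsDomino n 0 n L) ∧
      ∀ L, CoxeterDomino.IsDomino n 0 n L →
        CoxeterDomino.IsGrowthDenominator (CoxeterDomino.dominoReflections L)
          (CoxeterDomino.Q n 0 n) ∧
        CoxeterDomino.IsTwoSalem
          ((CoxeterDomino.growthRate (CoxeterDomino.dominoReflections L) : ℝ) : ℂ)) := by
  have h1 : 1 ≤ n := by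
    by_contra h0
    have h0 : n = 0 := by omega
    rw [h0] at hn
    exact absurd hn (by decide)
  have h1' : (1 : ℝ) ≤ n := mod_cast h1
  have hA := CoxeterDomino.irreducible_Q_A hn
  have hB := CoxeterDomino.irreducible_Q_B hn
  refine ⟨hB, hA, ⟨CoxeterDomino.exists_isDomino_B n, fun L hL => ?_⟩,
    CoxeterDomino.exists_isDomino_A n, fun L hL => ?_⟩
  · exact hL.isGrowthDenominator_and_isTwoSalem h1 hB
      (by simpa using CoxeterDomino.sign_changes_B h1')
  · exact hL.isGrowthDenominator_and_isTwoSalem h1 hA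
      (by simpa using CoxeterDomino.sign_changes_A h1')
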